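/- Let $n\ge 1$ and $r\ge 0$ be integers and $(z;q)_k=\prod_{j=0}^{k-1}(1-q^jz)$. Let $q,t\in\mathbb C$ with $0<|q|<1$, $t\neq0$. For $T\neq 0$ and a partition $\lambda=(\lambda_1\ge\dots\ge\lambda_n\ge0)$, the Macdonald polynomial $P^{(C_n)}_\lambda(x;q,t,T)$ of type $C_n$ is the Koornwinder polynomial with parameters $(a,b,c,d)=(-T^{1/2},T^{1/2},-q^{1/2}T^{1/2},q^{1/2}T^{1/2})$, that is, the Laurent polynomial in $x_1,\dots,x_n$ characterized by: (a) it is invariant under $S_n\ltimes(\mathbb Z/2\mathbb Z)^n$ (permutations and inversions of the variables) and equals $m_\lambda(x)$ plus a linear combination of the orbit sums $m_\mu(x)$ with $\mu<\lambda$ in the dominance order ($\mu\ne\lambda$ and $\mu_1+\dots+\mu_k\le\lambda_1+\dots+\lambda_k$ for all $k$); (b) $\mathcal D_xP=d_\lambda P$, where, with $\alpha=(abcd/q)^{1/2}$ and $T_{q^{\pm1},x_i}$ the shift $x_i\mapsto q^{\pm1}x_i$, $$\mathcal D_x=\sum_{i=1}^n\sum_{\sigma=\pm1}\frac{(1-ax_i^\sigma)(1-bx_i^\sigma)(1-cx_i^\sigma)(1-dx_i^\sigma)}{\alpha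 t^{n-1}(1-x_i^{2\sigma})(1-qx_i^{2\sigma})}\prod_{j\ne i}\frac{(1-tx_i^\sigma x_j)(1-tx_i^\sigma/x_j)}{(1-x_i^\sigma x_j)(1-x_i^\sigma/x_j)}\,(T_{q^{\sigma},x_i}-1),$$ $$d_\lambda=\sum_{j=1}^n\bigl(\alpha t^{n-j}q^{\lambda_j}+\alpha^{-1}t^{j-n}q^{-\lambda_j}-\alpha t^{n-j}-\alpha^{-1}t^{j-n}\bigr).$$ Assume that $q,t$ are generic in the following sense, with $T=t^2/q$ and $\alpha=t^2/q$: $d_\mu\ne d_{(r)}$ for every partition $\mu<(r)=(r,0,\dots,0)$; and, for all integers $0\le m<r$, $t^kq^m\neq1$ for $1\le k\le n$ and $t^kq^{m-1}\ne1$ for $2\le k\le n+1$ (so that no denominator below vanishes). Then $P^{(C_n)}_{(r)}(x;q,t,t^2/q)$ exists, is unique, and is given by $$P^{(C_n)}_{(r)}(x;q,t,t^2/q)=\frac{(q;q)_r}{(t;q)_r}\sum_{\theta}\ \prod_{k\in I}\frac{(t;q)_{\theta_k}}{(q;q)_{\theta_k}}\ \prod_{l=1}^n\frac{(t^{n-l+1}q^{A_l};q)_{\theta_{\bar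 l}}\,(t^{n-l+2}q^{B_l-1};q)_{\theta_{\bar l}}}{(t^{n-l+2}q^{A_l-1};q)_{\theta_{\bar l}}\,(t^{n-l+1}q^{B_l};q)_{\theta_{\bar l}}}\ \prod_{i=1}^n x_i^{\theta_i-\theta_{\bar i}},$$ where $I=\{1,\dots,n,\bar n,\dots,\bar1\}$, the sum runs over all $\theta=(\theta_k)_{k\in I}\in\mathbb Z_{\ge0}^I$ with $\sum_{k\in I}\theta_k=r$, and $B_l=\sum_{k=l+1}^{n}(\theta_k+\theta_{\bar k})$, $A_l=\theta_l+B_l$. -/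

import Mathlib

open Finset

noncomputable section

/-- The `q`-shifted factorial `(z;q)_k` for `k ≥ 0`, that is `(1 - z)(1 - q z) ⋯ (1 - q^(k-1) z)`. -/
def qShift (z q : ℂ) (k : ℕ) : ℂ := ∏ j ∈ range k, (1 - q ^ j * z)

/-- Laurent polynomials in `x_1, …, x_n` with complex coefficients; the exponent vector `ν`
stands for the monomial `∏ x_i ^ ν_i`. -/
abbrev LaurentPoly (n : ℕ) : Type := AddMonoidAlgebra ℂ (Fin n → ℤ)

/-- The value of a Laurent polynomial at a point (meaningful when all coordinates are nonzero). -/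
def LaurentPoly.evalAt {n : ℕ} (P : LaurentPoly n) (x : Fin n → ℂ) : ℂ :=
  P.coeff.sum fun ν c => c * ∏ i, x i ^ ν i

/-- The action of the signed permutation `(ε, σ)` on exponent vectors. -/
def signedPerm {n : ℕ} (ε : Fin n → ℤˣ) (σ : Equiv.Perm (Fin n)) (ν : Fin n → ℤ) : Fin n → ℤ :=
  fun i => (ε i : ℤ) * ν (σ i)

/-- Invariance under the hyperoctahedral group `S_n ⋉ (ℤ/2ℤ)^n`, which permutes the `x_i` and
replaces them by their inverses. -/
def LaurentPoly.IsWeylInvariant {n : ℕ} (P : LaurentPoly n) : Prop :=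
  ∀ (ε : Fin n → ℤˣ) (σ : Equiv.Perm (Fin n)) (ν : Fin n → ℤ),
    P.coeff (signedPerm ε σ ν) = P.coeff ν

/-- Partitions with at most `n` parts: `lam 0 ≥ lam 1 ≥ ⋯ ≥ 0`. -/
def IsPartition {n : ℕ} (lam : Fin n → ℕ) : Prop := Antitone lam

/-- The orbit of the exponent vector `mu` under the hyperoctahedral group. -/
def weylOrbit {n : ℕ} (mu : Fin n → ℕ) : Finset (Fin n → ℤ) :=
  (univ : Finset ((Fin n → ℤˣ) × Equiv.Perm (Fin n))).image
    fun w => signedPerm w.1 w.2 fun i => (mu i : ℤ)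

/-- The monomial symmetric Laurent polynomial `m_mu`, the sum of the distinct monomials in the
orbit of `x ^ mu`. -/
def monomialSymm {n : ℕ} (mu : Fin n → ℕ) : LaurentPoly n :=
  ∑ ν ∈ weylOrbit mu, AddMonoidAlgebra.single ν (1 : ℂ)

/-- The strict dominance order on partitions with at most `n` parts (of possibly different sizes):
`mu ≠ lam` and `mu_1 + ⋯ + mu_k ≤ lam_1 + ⋯ + lam_k` for all `k`. -/
def DominanceLT {n : ℕ} (mu lam : Fin n → ℕ) : Prop :=
  mu ≠ lam ∧ ∀ k : Fin n, ∑ i ∈ Iic k, mu i ≤ ∑ i ∈ Iic k, lam i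

/-- The points at which no denominator of Koornwinder's operator vanishes. -/
def IsRegularPoint {n : ℕ} (q : ℂ) (x : Fin n → ℂ) : Prop :=
  (∀ i, x i ≠ 0 ∧ x i ^ 2 ≠ 1 ∧ q * x i ^ 2 ≠ 1 ∧ x i ^ 2 ≠ q) ∧
    ∀ i j, i ≠ j → x i ≠ x j ∧ x i * x j ≠ 1

/-- `alpha = (abcd/q)^(1/2)`. The choice of the root is immaterial: the eigenvalue equation below
is unchanged when `alpha` is replaced by `-alpha`. -/
def koornwinderAlpha (a b c d q : ℂ) : ℂ := (a * b * c * d / q) ^ (1 / 2 : ℂ)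

/-- Koornwinder's `q`-difference operator applied to the function `f`, at the point `x`. -/
def koornwinderOp {n : ℕ} (a b c d q t : ℂ) (f : (Fin n → ℂ) → ℂ) (x : Fin n → ℂ) : ℂ :=
  (∑ i,
    (1 - a * x i) * (1 - b * x i) * (1 - c * x i) * (1 - d * x i) /
        (koornwinderAlpha a b c d q * t ^ (n - 1) * (1 - x i ^ 2) * (1 - q * x i ^ 2)) *
      (∏ j ∈ univ.erase i,
        (1 - t * x i * x j) * (1 - t * x i / x j) / ((1 - x i * x j) * (1 - x i / x j))) *
      (f (Function.update x i (q * x i)) - f x)) +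
  ∑ i,
    (1 - a / x i) * (1 - b / x i) * (1 - c / x i) * (1 - d / x i) /
        (koornwinderAlpha a b c d q * t ^ (n - 1) * (1 - 1 / x i ^ 2) * (1 - q / x i ^ 2)) *
      (∏ j ∈ univ.erase i,
        (1 - t * x j / x i) * (1 - t / (x i * x j)) / ((1 - x j / x i) * (1 - 1 / (x i * x j)))) *
      (f (Function.update x i (q⁻¹ * x i)) - f x)

/-- The eigenvalue `∑_j ⟨alpha t^(n-j) q^(lam_j); alpha t^(n-j)⟩`, where
`⟨u; v⟩ = u + u⁻¹ - v - v⁻¹`. (The index `j` runs from `0` to `n - 1` here.) -/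
def koornwinderEigenvalue {n : ℕ} (alpha q t : ℂ) (lam : Fin n → ℕ) : ℂ :=
  ∑ j : Fin n,
    (alpha * t ^ (n - 1 - (j : ℕ)) * q ^ lam j + (alpha * t ^ (n - 1 - (j : ℕ)) * q ^ lam j)⁻¹
      - alpha * t ^ (n - 1 - (j : ℕ)) - (alpha * t ^ (n - 1 - (j : ℕ)))⁻¹)

/-- `P` is a Koornwinder polynomial `P_lam(x; a,b,c,d,q,t)`: an invariant Laurent polynomial of the
form `m_lam + lower terms` that is an eigenfunction of Koornwinder's operator. As `ℂ` is infinite,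
the identity of rational functions is the same as the identity at all regular points. -/
def IsKoornwinder {n : ℕ} (a b c d q t : ℂ) (lam : Fin n → ℕ) (P : LaurentPoly n) : Prop :=
  P.IsWeylInvariant ∧
  P - monomialSymm lam ∈
    Submodule.span ℂ (monomialSymm '' {mu : Fin n → ℕ | IsPartition mu ∧ DominanceLT mu lam}) ∧
  ∀ x : Fin n → ℂ, IsRegularPoint q x →
    koornwinderOp a b c d q t P.evalAt x =
      koornwinderEigenvalue (koornwinderAlpha a b c d q) q t lam * P.evalAt x

/-- `P` is a Macdonald polynomial `P_lam^{(C_n)}(x; q,t,T)` of type `C_n`: the Koornwinder polynomial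
with parameters `(-T^{1/2}, T^{1/2}, -q^{1/2} T^{1/2}, q^{1/2} T^{1/2}, q, t)`. -/
def IsMacdonaldC {n : ℕ} (q t T : ℂ) (lam : Fin n → ℕ) (P : LaurentPoly n) : Prop :=
  IsKoornwinder (-T ^ (1 / 2 : ℂ)) (T ^ (1 / 2 : ℂ))
    (-(q ^ (1 / 2 : ℂ) * T ^ (1 / 2 : ℂ))) (q ^ (1 / 2 : ℂ) * T ^ (1 / 2 : ℂ)) q t lam P

/-- The one-row partition `(r) = (r, 0, …, 0)`. -/
def oneRow (n r : ℕ) : Fin n → ℕ := fun i => if (i : ℕ) = 0 then r else 0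

/-- The index set `{1, …, n, n̄, …, 1̄}`: `inl i` is the letter `i + 1` and `inr i` is the barred
letter with the same number. -/
abbrev LetterC (n : ℕ) : Type := Fin n ⊕ Fin n

/-- The sum of `θ_k` over the letters `k` from `l + 1` to `\overline{l + 1}`, both included, when
`l` is the number of a letter: all letters strictly between `l` and its barred counterpart. -/
def innerSum {n : ℕ} (θ : LetterC n → ℕ) (l : Fin n) : ℕ :=
  ∑ k ∈ Ioi l, (θ (Sum.inl k) + θ (Sum.inr k))

/-- The coefficient attached to `θ` in the tableau formula. Here `l : Fin n` counts from `0`, so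
that `n - l` and `n - l + 1` stand for the exponents `n - l + 1` and `n - l + 2` with `l` counted
from `1`; `θ (inl l) + innerSum θ l` is the sum of `θ_k` from `l` to `\overline{l + 1}`. -/
def tableauCoeffC {n : ℕ} (q t : ℂ) (θ : LetterC n → ℕ) : ℂ :=
  (∏ k, qShift t q (θ k) / qShift q q (θ k)) *
  ∏ l : Fin n,
    (qShift (t ^ (n - (l : ℕ)) * q ^ (θ (Sum.inl l) + innerSum θ l)) q (θ (Sum.inr l)) *
      qShift (t ^ (n - (l : ℕ) + 1) * q ^ ((innerSum θ l : ℤ) - 1)) q (θ (Sum.inr l))) /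
    (qShift (t ^ (n - (l : ℕ) + 1) * q ^ (((θ (Sum.inl l) + innerSum θ l : ℕ) : ℤ) - 1)) q
        (θ (Sum.inr l)) *
      qShift (t ^ (n - (l : ℕ)) * q ^ innerSum θ l) q (θ (Sum.inr l)))

/-- The tableau sum over all `θ : LetterC n → ℕ` of total `r`. -/
def tableauSumC (n r : ℕ) (q t : ℂ) : LaurentPoly n :=
  ∑ θ ∈ (univ : Finset (LetterC n)).piAntidiag r,
    AddMonoidAlgebra.single (fun i => (θ (Sum.inl i) : ℤ) - (θ (Sum.inr i) : ℤ))
      (qShift q q r / qShift t q r * tableauCoeffC q t θ)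

end

/-! Write g(z) = ∑ (t;q)_k/(q;q)_k z^k, F(u) = ∏_i g(x_i u) g(u/x_i) (`genSeries`), H_s for the
tableau sum without its constant (`tabFun`), and φ_i(Z) for the coefficients of a ₂φ₁ (`phiCoeff`).
Two independent facts about F give the theorem.

Expansion: the coefficient of u^R in F is ∑_{s+2i=R} φ_i(t^n q^s) H_s (`coeff_genSeries`). Induction
on n removes the outermost pair of letters, whose weight sees the inner letters only through their
total s. The step is a summation formula for one pair of exponents (`sum_pairWeight_phiCoeff`), a
case of Watson's transformation: a q-Saalschütz sum (`sum_saalTerm`) is inserted, the sums are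
exchanged, and the inner one is a terminating ₆φ₅ (`sum_rogersTerm`).

Kernel identity: shifting x_i by q^{±1} multiplies F by a rational function of u. So the operator in
x sends F to F times a sum over the points x_i^{±1}. Lagrange interpolation (`sum_kernelTerm`)
trades this sum for contributions of 0, ∞, 1/(tu) and u/q, and the last two are multiples of
F(qu)/F(u) and F(u/q)/F(u) up to elementary terms. Hence the operator in x acts on F as a
q-difference operator in u (`eqnDen_mul_macSeries`).

For T = t²/q the series u^s ∑ φ_i(t^n q^s) u^{2i} is an eigenseries of the u-equation, with the
eigenvalue of the row (s) (`rhsOp_levelSeq`). These series are unitriangular in s, so comparing the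
two descriptions of the operator on F shows that every H_s with s ≤ r is an eigenfunction
(`macOp_tabFun`). By the same triangularity H_s inherits the Weyl invariance of F, which the tableau
coefficients do not display. Genericity controls denominators only up to degree r, so all
comparisons are truncated there.

Uniqueness: along a ray to infinity on which one monomial dominates, an invariant eigenfunction has
the eigenvalue of its dominant exponent, a partition (`eq_zero_of_macOp`). The difference of two
solutions involves only partitions below (r), whose eigenvalues are excluded. -/

noncomputable section

/-! ### Shifted factorials -/

section QShift

theorem qShift_zero (z q : ℂ) : qShift z q 0 = 1 := by simp [qShift]

theorem qShift_succ (z q : ℂ) (k : ℕ) : qShift z q (k + 1) = qShift z q k * (1 - q ^ k * z) := by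
  simp [qShift, prod_range_succ]

theorem qShift_add (z q : ℂ) (a b : ℕ) :
    qShift z q (a + b) = qShift z q a * qShift (z * q ^ a) q b := by
  simp only [qShift, prod_range_add]
  congr 1
  exact prod_congr rfl fun j _ => by ring

theorem qShift_succ_left (z q : ℂ) (k : ℕ) :
    qShift z q (k + 1) = (1 - z) * qShift (z * q) q k := by
  rw [add_comm, qShift_add, pow_one]
  simp [qShift]

theorem qShift_ne_zero_iff {z q : ℂ} {k : ℕ} :
    qShift z q k ≠ 0 ↔ ∀ j < k, q ^ j * z ≠ 1 := by
  simp only [qShift, prod_ne_zero_iff, mem_range, sub_ne_zero]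
  exact forall₂_congr fun _ _ => ne_comm

theorem qShift_one_succ (q : ℂ) (k : ℕ) : qShift 1 q (k + 1) = 0 := by
  simp [qShift_succ_left]

theorem qShift_self_ne_zero {q : ℂ} (hq : ‖q‖ < 1) (k : ℕ) : qShift q q k ≠ 0 := by
  rw [qShift_ne_zero_iff]
  intro j _ h
  have h' : ‖q ^ (j + 1)‖ < 1 := by
    rw [norm_pow]
    exact pow_lt_one₀ (norm_nonneg q) hq (Nat.succ_ne_zero j)
  rw [pow_succ, h, norm_one] at h'
  exact lt_irrefl _ h'

end QShift

/-! ### The terminating q-Saalschütz sum -/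

section Saalschutz

/-- The summand of the terminating `q`-Saalschütz sum. -/
def saalTerm (q c X Y : ℂ) (p : ℕ × ℕ) : ℂ :=
  qShift q q (p.1 + p.2) / (qShift q q p.1 * qShift q q p.2) * c ^ p.1 * qShift c q p.2 *
    qShift X q p.1 * qShift Y q p.1 * qShift (c * X * Y * q ^ p.1) q p.2

theorem saalTerm_zero_succ {q : ℂ} (hq : ∀ k, qShift q q k ≠ 0) (c X Y : ℂ) (l : ℕ) :
    saalTerm q c X Y (0, l + 1) =
      ((1 - c * X * q ^ l) * (1 - c * Y * q ^ l) - q ^ l * c * (1 - X) * (1 - Y)) *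
        saalTerm q c X Y (0, l) := by
  have h1 := hq l
  have h2 := hq (l + 1)
  simp only [saalTerm, qShift_zero, zero_add, pow_zero, mul_one, one_mul, div_self h1, div_self h2]
  rw [qShift_succ, qShift_succ]
  ring

theorem saalTerm_succ_zero {q : ℂ} (hq : ∀ k, qShift q q k ≠ 0) (c X Y : ℂ) (k : ℕ) :
    saalTerm q c X Y (k + 1, 0) =
      c * (1 - X * q ^ k) * (1 - Y * q ^ k) * saalTerm q c X Y (k, 0) := by
  have h1 := hq k
  have h2 := hq (k + 1)
  simp only [saalTerm, qShift_zero, add_zero, mul_one, div_self h1, div_self h2]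
  rw [qShift_succ, qShift_succ]
  ring

/-- Pascal-type rule: a term of row i + 1 is split between its two neighbours in row i. The split is
chosen so that what a term `(k, l)` of row i passes on in the two directions has total factor (1 -
cXq^i)(1 - cYq^i), the same for the whole row. The two preceding lemmas are the boundary cases with
one neighbour missing. -/
theorem saalTerm_succ_succ {q : ℂ} (hq : ∀ k, qShift q q k ≠ 0) (c X Y : ℂ) (k l : ℕ) :
    saalTerm q c X Y (k + 1, l + 1) =
      ((1 - c * X * q ^ (k + 1 + l)) * (1 - c * Y * q ^ (k + 1 + l)) -
        q ^ l * c * (1 - X * q ^ (k + 1)) * (1 - Y * q ^ (k + 1))) * saalTerm q c X Y (k + 1, l) +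
      q ^ (l + 1) * c * (1 - X * q ^ k) * (1 - Y * q ^ k) * saalTerm q c X Y (k, l + 1) := by
  have e1 : qShift (c * X * Y * q ^ k) q (l + 1) =
      (1 - c * X * Y * q ^ k) * qShift (c * X * Y * q ^ (k + 1)) q l := by
    rw [qShift_succ_left, pow_succ, ← mul_assoc]
  have h1 := hq (k + 1)
  have h2 := hq (l + 1)
  simp only [saalTerm]
  rw [e1, show k + 1 + (l + 1) = (k + l + 1) + 1 by ring, show k + 1 + l = k + l + 1 by ring,
    show k + (l + 1) = k + l + 1 by ring]
  rw [qShift_succ q q (k + l + 1), qShift_succ c, qShift_succ X, qShift_succ Y,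
    qShift_succ (c * X * Y * q ^ (k + 1))]
  rw [qShift_succ] at h1 h2
  rw [qShift_succ q q k, qShift_succ q q l]
  have a1 := left_ne_zero_of_mul h1
  have a2 := right_ne_zero_of_mul h1
  have a3 := left_ne_zero_of_mul h2
  have a4 := right_ne_zero_of_mul h2
  generalize qShift q q k = u1 at *
  generalize qShift q q l = u2 at *
  generalize qShift q q (k + l + 1) = u3 at *
  generalize qShift c q l = u4 at *
  generalize qShift X q k = u5 at *
  generalize qShift Y q k = u6 at *
  generalize qShift (c * X * Y * q ^ (k + 1)) q l = u7 at *
  clear e1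
  simp only [pow_succ, pow_add] at *
  generalize q ^ k = K at *
  generalize q ^ l = L at *
  field_simp
  ring

/-- The terminating `q`-Saalschütz summation. -/
theorem sum_saalTerm {q : ℂ} (hq : ∀ k, qShift q q k ≠ 0) (c X Y : ℂ) (i : ℕ) :
    ∑ p ∈ antidiagonal i, saalTerm q c X Y p = qShift (c * X) q i * qShift (c * Y) q i := by
  induction i with
  | zero => simp [saalTerm, qShift_zero]
  | succ i ih =>
    have key : ∀ p ∈ antidiagonal (i + 1), saalTerm q c X Y p =
        (if p.2 = 0 then 0 else
          ((1 - c * X * q ^ i) * (1 - c * Y * q ^ i) - q ^ (p.2 - 1) * c * (1 - X * q ^ p.1) *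
            (1 - Y * q ^ p.1)) * saalTerm q c X Y (p.1, p.2 - 1)) +
        (if p.1 = 0 then 0 else
          q ^ p.2 * c * (1 - X * q ^ (p.1 - 1)) * (1 - Y * q ^ (p.1 - 1)) *
            saalTerm q c X Y (p.1 - 1, p.2)) := by
      rintro ⟨k, l⟩ h
      rw [HasAntidiagonal.mem_antidiagonal] at h
      rcases k with - | k <;> rcases l with - | l
      · simp at h
      · obtain rfl : l = i := by simpa using h
        simp [saalTerm_zero_succ hq]
      · simp [saalTerm_succ_zero hq]
      · obtain rfl : k + 1 + l = i := by simp at h; omega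
        simp [saalTerm_succ_succ hq]
    rw [sum_congr rfl key, sum_add_distrib, Nat.sum_antidiagonal_succ', Nat.sum_antidiagonal_succ]
    simp only [if_true, Nat.add_eq_zero_iff, one_ne_zero, and_false, if_false, zero_add,
      Nat.add_sub_cancel]
    rw [← sum_add_distrib, qShift_succ, qShift_succ]
    -- The transfers `q ^ p.2 * c * …` of the two halves cancel; the remaining factor depends on `i`
    -- alone.
    calc _ = ∑ p ∈ antidiagonal i,
          (1 - c * X * q ^ i) * (1 - c * Y * q ^ i) * saalTerm q c X Y p :=
          sum_congr rfl fun p _ => by ring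
      _ = _ := by rw [← mul_sum, ih]; ring

end Saalschutz

/-! ### The connection formula for Rogers polynomials -/

section Rogers

/-- The summand of the connection formula for Rogers polynomials. -/
def rogersTerm (q c d : ℂ) (α β k : ℕ) : ℂ :=
  c ^ k * qShift d q k / qShift q q k * qShift (c * d) q (α + β + k) /
    (qShift c q (α + β) * qShift (c * q ^ (α + β + 1)) q k) *
    (qShift c q α * qShift c q β / (qShift q q α * qShift q q β))

/-- The summand of the connection formula, without its very-well-poised factor. -/
def rogersAux (q c d : ℂ) (α β k : ℕ) : ℂ :=
  c ^ k * qShift d q k / qShift q q k * qShift (c * d) q (α + β + k) /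
    qShift c q (α + β + k + 1) * (qShift c q α * qShift c q β / (qShift q q α * qShift q q β))

/-- The quantity whose differences telescope the connection formula. -/
def rogersDiff (q c d : ℂ) (α β k : ℕ) : ℂ :=
  q ^ β * c * (1 - d * q ^ k) * (1 - q ^ α) * rogersAux q c d α β k

/-- Pulling out the very-well-poised factor leaves terms whose denominators `qShift c q (α + β + k +
1)` have comparable lengths, which the telescoping below needs. -/
theorem rogersTerm_eq_aux (q c d : ℂ) (α β k : ℕ) (h : q ^ (α + β) * c ≠ 1) :
    rogersTerm q c d α β k = (1 - q ^ (α + β) * c) * rogersAux q c d α β k := by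
  have h1 : 1 - q ^ (α + β) * c ≠ 0 := sub_ne_zero.2 h.symm
  have e : qShift c q (α + β + k + 1) =
      (1 - q ^ (α + β) * c) * (qShift c q (α + β) * qShift (c * q ^ (α + β + 1)) q k) := by
    rw [show α + β + k + 1 = (α + β + 1) + k by ring, qShift_add, qShift_succ]
    ring
  rw [rogersTerm, rogersAux, e, ← mul_assoc, ← mul_div_assoc (1 - q ^ (α + β) * c),
    mul_div_mul_left _ _ h1]

theorem rogersTerm_succ_zero {q : ℂ} (hq : ∀ k, qShift q q k ≠ 0) (c d : ℂ) (α k : ℕ)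
    (hc : ∀ j ≤ α + k + 1, q ^ j * c ≠ 1) :
    (1 - q ^ (k + 1)) * rogersTerm q c d α 0 (k + 1) = rogersDiff q c d (α + 1) 0 k := by
  have h0 := qShift_ne_zero_iff.2 fun j (hj : j < α + k + 2) => hc j (by omega)
  have h1 := hq (k + 1)
  have h2 := hq (α + 1)
  rw [rogersTerm_eq_aux _ _ _ _ _ _ (hc _ (by omega)), rogersDiff, rogersAux, rogersAux,
    show α + 0 + (k + 1) + 1 = α + k + 2 by ring, show α + 1 + 0 + k + 1 = α + k + 2 by ring,
    show α + 0 + (k + 1) = α + k + 1 by ring, show α + 1 + 0 + k = α + k + 1 by ring,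
    qShift_succ d, qShift_succ q q k, qShift_succ q q α, qShift_succ c q α]
  rw [qShift_succ] at h1 h2
  have a1 := left_ne_zero_of_mul h1
  have a2 := right_ne_zero_of_mul h1
  have a3 := left_ne_zero_of_mul h2
  have a4 := right_ne_zero_of_mul h2
  simp only [qShift_zero]
  clear h1 h2
  generalize qShift q q k = u1 at *
  generalize qShift q q α = u2 at *
  generalize qShift c q (α + k + 2) = u3 at *
  generalize qShift (c * d) q (α + k + 1) = u4 at *
  generalize qShift c q α = u5 at *
  generalize qShift d q k = u6 at *
  clear hc hq
  simp only [pow_succ, pow_add, pow_zero] at *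
  generalize q ^ k = K at *
  generalize q ^ α = L at *
  generalize 1 - L * q = D at *
  field_simp

theorem rogersTerm_zero {q : ℂ} (hq : ∀ k, qShift q q k ≠ 0) (c d : ℂ) (α β : ℕ)
    (hc : ∀ j ≤ α + β, q ^ j * c ≠ 1) :
    (1 - q ^ (β + 1)) * rogersTerm q c d α (β + 1) 0 =
      (1 - c * d * q ^ β) * rogersTerm q c d α β 0 - rogersDiff q c d α β 0 := by
  have h0 := qShift_ne_zero_iff.2 fun j (hj : j < α + β + 1) => hc j (by omega)
  have h1 := hq (β + 1)
  have h2 := hq α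
  rw [rogersTerm, rogersTerm, rogersDiff, rogersAux]
  simp only [qShift_zero, add_zero, pow_zero, mul_one, div_one, one_mul]
  rw [← add_assoc, qShift_succ (c * d), qShift_succ c q (α + β), qShift_succ c q β,
    qShift_succ q q β]
  rw [qShift_succ] at h0 h1
  have a1 := left_ne_zero_of_mul h1
  have a2 := right_ne_zero_of_mul h1
  have a3 := left_ne_zero_of_mul h0
  have a4 := right_ne_zero_of_mul h0
  clear h0 h1 hc hq
  generalize qShift q q β = u1 at *
  generalize qShift q q α = u2 at *
  generalize qShift c q (α + β) = u3 at *
  generalize qShift (c * d) q (α + β) = u4 at *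
  generalize qShift c q α = u5 at *
  generalize qShift c q β = u6 at *
  simp only [pow_succ, pow_add] at *
  generalize q ^ β = K at *
  generalize q ^ α = L at *
  generalize hD : 1 - L * K * c = D at *
  field_simp
  rw [← hD]
  ring

/-- A WZ-type certificate. With A = α + k + 1 fixed and B = β + k + 1, the (k+1)-st summand for B +
1, times 1 - q^(B+1), is the one for B, times 1 - cdq^B, plus a difference of two consecutive values
of `rogersDiff`. `rogersTerm_zero` and `rogersTerm_succ_zero` are the two ends of the range. -/
theorem rogersTerm_succ_succ {q : ℂ} (hq : ∀ k, qShift q q k ≠ 0) (c d : ℂ) (α β k : ℕ)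
    (hc : ∀ j ≤ α + β + k + 2, q ^ j * c ≠ 1) :
    (1 - q ^ (β + k + 2)) * rogersTerm q c d α (β + 1) (k + 1) =
      (1 - c * d * q ^ (β + k + 1)) * rogersTerm q c d α β (k + 1) - rogersDiff q c d α β (k + 1) +
        rogersDiff q c d (α + 1) (β + 1) k := by
  have h0 := qShift_ne_zero_iff.2 fun j (hj : j < α + β + k + 3) => hc j (by omega)
  have h1 := hq (β + 1)
  have h2 := hq (α + 1)
  have h3 := hq (k + 1)
  rw [rogersTerm_eq_aux _ _ _ _ _ _ (hc _ (by omega)),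
    rogersTerm_eq_aux _ _ _ _ _ _ (hc _ (by omega)), rogersDiff, rogersDiff]
  simp only [rogersAux]
  rw [show α + (β + 1) + (k + 1) + 1 = α + β + k + 2 + 1 by ring,
    show α + 1 + (β + 1) + k + 1 = α + β + k + 2 + 1 by ring,
    show α + (β + 1) + (k + 1) = α + β + k + 1 + 1 by ring,
    show α + 1 + (β + 1) + k = α + β + k + 1 + 1 by ring,
    show α + β + (k + 1) + 1 = α + β + k + 2 by ring,
    show α + β + (k + 1) = α + β + k + 1 by ring,
    qShift_succ (c * d) q (α + β + k + 1), qShift_succ c q (α + β + k + 2), qShift_succ c q α,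
    qShift_succ c q β, qShift_succ q q β, qShift_succ q q α, qShift_succ q q k, qShift_succ d]
  rw [qShift_succ] at h0 h1 h2 h3
  have a1 := left_ne_zero_of_mul h1
  have a2 := right_ne_zero_of_mul h1
  have a3 := left_ne_zero_of_mul h0
  have a4 := right_ne_zero_of_mul h0
  have a5 := left_ne_zero_of_mul h2
  have a6 := right_ne_zero_of_mul h2
  have a7 := left_ne_zero_of_mul h3
  have a8 := right_ne_zero_of_mul h3
  clear h0 h1 h2 h3 hc hq
  generalize qShift q q β = u1 at *
  generalize qShift q q α = u2 at *
  generalize qShift q q k = u3 at *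
  generalize qShift c q (α + β + k + 2) = u4 at *
  generalize qShift (c * d) q (α + β + k + 1) = u5 at *
  generalize qShift c q α = u6 at *
  generalize qShift c q β = u7 at *
  generalize qShift d q k = u8 at *
  simp only [pow_succ, pow_add] at *
  generalize q ^ β = B at *
  generalize q ^ α = A at *
  generalize q ^ k = K at *
  generalize hD : 1 - A * B * K * q * q * c = D at *
  generalize hE : 1 - B * q = E at *
  generalize hF : 1 - A * q = F at *
  generalize hG : 1 - K * q = G at *
  field_simp
  rw [← hD, ← hE, ← hG]
  ring

/-- The connection formula for Rogers polynomials, compared at one monomial; a terminating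
very-well-poised `₆φ₅` summation. -/
theorem sum_rogersTerm {q : ℂ} (hq : ∀ k, qShift q q k ≠ 0) (c d : ℂ) {A B : ℕ} (hAB : B ≤ A)
    (hc : ∀ j < A + B, q ^ j * c ≠ 1) :
    ∑ p ∈ antidiagonal B, rogersTerm q c d (A - p.1) p.2 p.1 =
      qShift (c * d) q A * qShift (c * d) q B / (qShift q q A * qShift q q B) := by
  induction B with
  | zero =>
    have h := qShift_ne_zero_iff.2 hc
    rw [add_zero] at h
    simp only [Finset.Nat.antidiagonal_zero, sum_singleton, rogersTerm, qShift_zero, Nat.sub_zero, add_zero,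
      pow_zero, mul_one, div_one, one_mul]
    field_simp
  | succ B ih =>
    have h1 := hq (B + 1)
    have h2 := hq A
    have key : ∀ p ∈ antidiagonal (B + 1),
        (1 - q ^ (B + 1)) * rogersTerm q c d (A - p.1) p.2 p.1 =
        (if p.2 = 0 then 0 else
          (1 - c * d * q ^ B) * rogersTerm q c d (A - p.1) (p.2 - 1) p.1 -
            rogersDiff q c d (A - p.1) (p.2 - 1) p.1) +
        (if p.1 = 0 then 0 else rogersDiff q c d (A - (p.1 - 1)) p.2 (p.1 - 1)) := by
      rintro ⟨k, l⟩ h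
      rw [HasAntidiagonal.mem_antidiagonal] at h
      rcases k with - | k <;> rcases l with - | l
      · simp at h
      · obtain rfl : l = B := by simpa using h
        simpa using rogersTerm_zero hq c d A l fun j hj => hc j (by omega)
      · obtain rfl : k = B := by simpa using h
        obtain ⟨α, rfl⟩ := Nat.exists_eq_add_of_le hAB
        have := rogersTerm_succ_zero hq c d α k fun j hj => hc j (by omega)
        rw [show k + 1 + α - (k + 1) = α by omega, show k + 1 + α - (k + 1 - 1) = α + 1 by omega]
        simpa using this
      · obtain rfl : l + k + 1 = B := by simp at h; omega
        obtain ⟨α, rfl⟩ := Nat.exists_eq_add_of_le (show k + 1 ≤ A by omega)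
        have := rogersTerm_succ_succ hq c d α l k fun j hj => hc j (by omega)
        rw [show k + 1 + α - (k + 1) = α by omega, show k + 1 + α - (k + 1 - 1) = α + 1 by omega]
        simpa using this
    have h3 : 1 - q ^ (B + 1) ≠ 0 := by
      rw [qShift_succ, ← pow_succ] at h1
      exact right_ne_zero_of_mul h1
    have h4 := ih (by omega) fun j hj => hc j (by omega)
    -- After the shifts of index the two families of `rogersDiff` cancel, leaving a first-order
    -- recurrence in `B`.
    have h5 : (1 - q ^ (B + 1)) * ∑ p ∈ antidiagonal (B + 1), rogersTerm q c d (A - p.1) p.2 p.1 =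
        (1 - c * d * q ^ B) * ∑ p ∈ antidiagonal B, rogersTerm q c d (A - p.1) p.2 p.1 := by
      rw [mul_sum, sum_congr rfl key, sum_add_distrib, Nat.sum_antidiagonal_succ',
        Nat.sum_antidiagonal_succ]
      simp only [if_true, Nat.add_eq_zero_iff, one_ne_zero, and_false, if_false, zero_add,
        Nat.add_sub_cancel]
      rw [← sum_add_distrib, mul_sum]
      exact sum_congr rfl fun p _ => by ring
    apply mul_left_cancel₀ h3
    rw [h5, h4, qShift_succ (c * d), qShift_succ q q B, ← pow_succ]
    have h6 := hq B
    field_simp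

end Rogers

/-! ### Watson's transformation for a pair of exponents -/

section Watson

theorem sum_antidiagonal_assoc {M : Type*} [AddCommMonoid M] (n : ℕ) (f : ℕ → ℕ → ℕ → M) :
    ∑ p ∈ antidiagonal n, ∑ r ∈ antidiagonal p.1, f r.1 r.2 p.2 =
      ∑ p ∈ antidiagonal n, ∑ r ∈ antidiagonal p.2, f p.1 r.1 r.2 := by
  rw [sum_sigma', sum_sigma']
  refine sum_nbij' (fun x => ⟨(x.2.1, x.2.2 + x.1.2), (x.2.2, x.1.2)⟩)
    (fun x => ⟨(x.1.1 + x.2.1, x.2.2), (x.1.1, x.2.1)⟩) ?_ ?_ ?_ ?_ fun _ _ => rfl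
  all_goals
    rintro ⟨⟨a, b⟩, ⟨c, d⟩⟩ h
    simp only [mem_sigma, HasAntidiagonal.mem_antidiagonal] at h ⊢
    obtain ⟨h1, h2⟩ := h
    subst h1
    subst h2
    simp [add_assoc]

/-- The ratio `(t;q)_k / (q;q)_k`. -/
def gCoeff (q t : ℂ) (k : ℕ) : ℂ := qShift t q k / qShift q q k

/-- The weight of a pair of letters `i`, `ī` occurring `a` and `b` times in the tableau sum. -/
def pairWeight (q t Z : ℂ) (a b : ℕ) : ℂ :=
  gCoeff q t a * gCoeff q t b * (qShift (Z * q ^ a) q b * qShift (Z * t / q) q b /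
    (qShift (Z * t / q * q ^ a) q b * qShift Z q b))

/-- The coefficients of `₂φ₁(q/t, Z; t Z; q, t² v / q)` in powers of `v`. -/
def phiCoeff (q t Z : ℂ) (i : ℕ) : ℂ :=
  qShift (q / t) q i * qShift Z q i / (qShift q q i * qShift (Z * t) q i) * (t ^ 2 / q) ^ i

set_option maxHeartbeats 2000000 in
-- With c = Z/t, X = tq^α, Y = tq^β one has cX = Zq^α and cY = Zq^β, so the prefactor on the right
-- is the value of the q-Saalschütz sum and will cancel. Once A = α + k + j, B = β + k + j and j are
-- fixed, the rest depends on k only through `rogersTerm`.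
theorem pairWeight_mul_phiCoeff {q t Z : ℂ} (hq : ∀ k, qShift q q k ≠ 0) (hq0 : q ≠ 0)
    (ht0 : t ≠ 0) {α β k j : ℕ} (hZ : ∀ m < α + β + 2 * (k + j), q ^ m * Z ≠ 1)
    (hc : ∀ m < α + β + 2 * (k + j), q ^ m * (Z * t / q) ≠ 1) :
    pairWeight q t Z α β * phiCoeff q t (Z * q ^ (α + β)) (k + j) *
        saalTerm q (Z / t) (t * q ^ α) (t * q ^ β) (k, j) =
      qShift (Z * q ^ α) q (k + j) * qShift (Z * q ^ β) q (k + j) *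
        (qShift (q / t) q j * qShift (Z / t) q j / qShift q q j * (t ^ 2 / q) ^ j * qShift Z q j *
          (qShift t q (α + k) * qShift t q (β + k)) /
            (qShift Z q (α + k + j) * qShift Z q (β + k + j)) *
          rogersTerm q (Z * t / q) (q ^ (j + 1) / t) α β k) := by
  have d1 : qShift Z q (α + k + j) ≠ 0 := qShift_ne_zero_iff.2 fun m hm => hZ m (by omega)
  have d2 : qShift Z q (β + k + j) ≠ 0 := qShift_ne_zero_iff.2 fun m hm => hZ m (by omega)
  have d3 : qShift (Z * t / q) q (α + β) ≠ 0 := qShift_ne_zero_iff.2 fun m hm => hc m (by omega)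
  have d4 : qShift (Z * q ^ (α + β) * t) q (k + j) ≠ 0 := by
    rw [qShift_ne_zero_iff]
    intro m hm h
    apply hc (m + α + β + 1) (by omega)
    rw [← h]
    field_simp
    ring
  have e1 : Z * t / q * (q ^ (j + 1) / t) = Z * q ^ j := by
    field_simp
    ring
  -- Both sides are (Z;q)_{α+β+k+j}; this is the only relation left after clearing denominators.
  have e2 : qShift Z q j * qShift (Z * q ^ j) q (α + β + k) =
      qShift Z q α * qShift (Z * q ^ α) q β * qShift (Z * q ^ (α + β)) q (k + j) := by
    rw [← qShift_add, ← qShift_add, ← qShift_add]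
    congr 1
    ring
  have e3 : Z / t * (t * q ^ α) * (t * q ^ β) * q ^ k = Z * q ^ (α + β) * t * q ^ k := by
    field_simp
    ring
  have e4 : Z * t / q * q ^ (α + β + 1) = Z * q ^ (α + β) * t := by
    field_simp
    ring
  have e5 : q ^ (j + 1) / t = q / t * q ^ j := by ring
  have e6 : qShift (q / t) q (k + j) = qShift (q / t) q j * qShift (q / t * q ^ j) q k := by
    rw [add_comm, qShift_add]
  have e7 : (Z * t / q) ^ k = (Z / t) ^ k * (t ^ 2 / q) ^ k := by
    rw [← mul_pow]
    congr 1
    field_simp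
  rw [pairWeight, phiCoeff, saalTerm, rogersTerm, e1, e3, e4, e5, e7]
  simp only [gCoeff]
  rw [add_assoc α k j, qShift_add Z q α] at d1 ⊢
  rw [add_assoc β k j, qShift_add Z q β] at d2 ⊢
  rw [qShift_add _ q α β] at d3 ⊢
  rw [qShift_add (Z * q ^ (α + β) * t) q k j] at d4 ⊢
  rw [qShift_add t q α k, qShift_add t q β k, e6, pow_add (t ^ 2 / q)]
  have b1 := left_ne_zero_of_mul d1
  have b2 := right_ne_zero_of_mul d1
  have b3 := left_ne_zero_of_mul d2
  have b4 := right_ne_zero_of_mul d2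
  have b5 := left_ne_zero_of_mul d3
  have b6 := right_ne_zero_of_mul d3
  have b7 := left_ne_zero_of_mul d4
  have b8 := right_ne_zero_of_mul d4
  have c1 := hq k
  have c2 := hq j
  have c3 := hq α
  have c4 := hq β
  have c5 := hq (k + j)
  clear hZ hc hq d1 d2 d3 d4 e1 e3 e4 e5 e6 e7
  generalize qShift q q k = u1 at *
  generalize qShift q q j = u2 at *
  generalize qShift q q α = u3 at *
  generalize qShift q q β = u4 at *
  generalize qShift q q (k + j) = u5 at *
  generalize qShift Z q α = u6 at *
  generalize qShift Z q β = u7 at *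
  generalize qShift (Z * q ^ α) q (k + j) = u8 at *
  generalize qShift (Z * q ^ β) q (k + j) = u9 at *
  generalize qShift (Z * q ^ α) q β = u10 at *
  generalize qShift (Z * q ^ (α + β)) q (k + j) = u11 at *
  generalize qShift (Z * t / q) q α = u12 at *
  generalize qShift (Z * t / q) q β = u13 at *
  generalize qShift (Z * t / q * q ^ α) q β = u14 at *
  generalize qShift (Z * q ^ (α + β) * t) q k = u15 at *
  generalize qShift (Z * q ^ (α + β) * t * q ^ k) q j = u16 at *
  generalize qShift Z q j = u17 at *
  generalize qShift (Z * q ^ j) q (α + β + k) = u18 at *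
  generalize qShift t q α = u19 at *
  generalize qShift t q β = u20 at *
  generalize qShift (t * q ^ α) q k = u21 at *
  generalize qShift (t * q ^ β) q k = u22 at *
  generalize qShift (q / t) q j = u23 at *
  generalize qShift (q / t * q ^ j) q k = u24 at *
  generalize qShift (Z / t) q j = u25 at *
  generalize (Z / t) ^ k = u26 at *
  generalize (t ^ 2 / q) ^ k = u27 at *
  generalize (t ^ 2 / q) ^ j = u28 at *
  field_simp
  linear_combination (-u13 * u19 * u20 * u21 * u22 * u23 * u24 * u25 * u26 * u27 * u28) * e2

/-- A special case of Watson's transformation of a terminating very-well-poised `₈φ₇`. -/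
theorem sum_pairWeight_phiCoeff {q t Z : ℂ} (hq : ∀ k, qShift q q k ≠ 0) (hq0 : q ≠ 0)
    (ht0 : t ≠ 0) {A B : ℕ} (hAB : B ≤ A) (hZ : ∀ m < A + B, q ^ m * Z ≠ 1)
    (hc : ∀ m < A + B, q ^ m * (Z * t / q) ≠ 1) :
    ∑ p ∈ antidiagonal B,
        pairWeight q t Z (A - p.1) p.2 * phiCoeff q t (Z * q ^ (A - p.1 + p.2)) p.1 =
      ∑ p ∈ antidiagonal B, gCoeff q t (A - p.1) * gCoeff q t p.2 * phiCoeff q t (Z / t) p.1 := by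
  have hZA : qShift Z q A ≠ 0 := qShift_ne_zero_iff.2 fun m hm => hZ m (by omega)
  have hZB : qShift Z q B ≠ 0 := qShift_ne_zero_iff.2 fun m hm => hZ m (by omega)
  -- The summand after inserting the q-Saalschütz sum, with `i = j + k`.
  set X : ℕ → ℕ → ℕ → ℂ := fun j k β =>
    qShift (q / t) q j * qShift (Z / t) q j / qShift q q j * (t ^ 2 / q) ^ j * qShift Z q j *
      (qShift t q (A - j) * qShift t q (β + k)) / (qShift Z q A * qShift Z q B) *
        rogersTerm q (Z * t / q) (q ^ (j + 1) / t) (A - j - k) β k with hX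
  have h1 : ∀ p ∈ antidiagonal B,
      pairWeight q t Z (A - p.1) p.2 * phiCoeff q t (Z * q ^ (A - p.1 + p.2)) p.1 =
        ∑ r ∈ antidiagonal p.1, X r.1 r.2 p.2 := by
    rintro ⟨i, β⟩ h
    obtain rfl : i + β = B := by simpa using h
    obtain ⟨α, rfl⟩ := Nat.exists_eq_add_of_le (show i ≤ A by omega)
    have hne : qShift (Z * q ^ α) q i * qShift (Z * q ^ β) q i ≠ 0 := by
      rw [add_comm, qShift_add] at hZA hZB
      exact mul_ne_zero (right_ne_zero_of_mul hZA) (right_ne_zero_of_mul hZB)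
    have hS := sum_saalTerm hq (Z / t) (t * q ^ α) (t * q ^ β) i
    have e : ∀ m, Z / t * (t * q ^ m) = Z * q ^ m := fun m => by field_simp
    rw [e, e] at hS
    apply mul_left_cancel₀ hne
    rw [mul_comm, ← hS, mul_sum, mul_sum, ← Nat.sum_antidiagonal_swap]
    refine sum_congr rfl ?_
    rintro ⟨j, k⟩ h'
    obtain rfl : k + j = i := by simpa [add_comm] using h'
    simp only [Prod.swap, show k + j + α - (k + j) = α by omega]
    rw [pairWeight_mul_phiCoeff hq hq0 ht0 (fun m hm => hZ m (by omega))
      (fun m hm => hc m (by omega)), hS]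
    simp only [hX]
    rw [show k + j + α - j = α + k by omega, show α + k - k = α by omega,
      show k + j + α = α + k + j by omega, show k + j + β = β + k + j by omega]
  -- With `j` now outermost, the inner sum over `k` is the connection formula for the exponents A -
  -- j and B - j, with cd = Zq^j.
  rw [sum_congr rfl h1, sum_antidiagonal_assoc]
  refine sum_congr rfl ?_
  rintro ⟨j, b⟩ h
  obtain rfl : j + b = B := by simpa using h
  obtain ⟨a, rfl⟩ := Nat.exists_eq_add_of_le (show j ≤ A by omega)
  have hR := sum_rogersTerm hq (Z * t / q) (q ^ (j + 1) / t) (A := a) (B := b) (by omega)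
    (fun m hm => hc m (by omega))
  have e1 : Z * t / q * (q ^ (j + 1) / t) = Z * q ^ j := by
    field_simp
    ring
  have h2 : ∀ p ∈ antidiagonal b, X j p.1 p.2 =
      qShift (q / t) q j * qShift (Z / t) q j / qShift q q j * (t ^ 2 / q) ^ j * qShift Z q j *
      (qShift t q a * qShift t q b) / (qShift Z q (j + a) * qShift Z q (j + b)) *
        rogersTerm q (Z * t / q) (q ^ (j + 1) / t) (a - p.1) p.2 p.1 := by
    rintro ⟨k, β⟩ h
    obtain rfl : k + β = b := by simpa using h
    simp only [hX]
    rw [show j + a - j = a by omega, add_comm β k]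
  rw [sum_congr rfl h2, ← mul_sum, hR, e1, show j + a - j = a by omega, phiCoeff, gCoeff, gCoeff]
  have e2 : Z / t * t = Z := by field_simp
  rw [qShift_add] at hZA hZB
  have b1 := left_ne_zero_of_mul hZA
  have b2 := right_ne_zero_of_mul hZA
  have b3 := right_ne_zero_of_mul hZB
  have c1 := hq a
  have c2 := hq b
  have c3 := hq j
  rw [e2, qShift_add Z q j a, qShift_add Z q j b]
  field_simp

end Watson

/-! ### Removing the outermost pair of letters -/

section Tableau

/-- The tableau sum as a function of `x`, without its normalizing constant. -/
def tabFun (q t : ℂ) {n : ℕ} (x : Fin n → ℂ) (r : ℕ) : ℂ :=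
  ∑ θ ∈ (univ : Finset (LetterC n)).piAntidiag r,
    tableauCoeffC q t θ * ∏ i, x i ^ θ (Sum.inl i) * (x i)⁻¹ ^ θ (Sum.inr i)

/-- The restriction of `θ` to the letters other than the outermost pair. -/
def innerLetters {n : ℕ} (θ : LetterC (n + 1) → ℕ) : LetterC n → ℕ :=
  Sum.elim (fun i => θ (Sum.inl i.succ)) fun i => θ (Sum.inr i.succ)

theorem innerSum_succ {n : ℕ} (θ : LetterC (n + 1) → ℕ) (l : Fin n) :
    innerSum θ l.succ = innerSum (innerLetters θ) l := by
  simp [innerSum, innerLetters, Fin.sum_Ioi_succ]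

theorem innerSum_zero {n : ℕ} (θ : LetterC (n + 1) → ℕ) :
    innerSum θ 0 = ∑ k, innerLetters θ k := by
  simp [innerSum, innerLetters, Fintype.sum_sum_type, sum_add_distrib]

/-- The factor of the outermost pair depends on the other letters only through their total, which
enters as a power of q in Z; the other factors never see the outermost pair. -/
theorem tableauCoeffC_succ {q t : ℂ} (hq0 : q ≠ 0) {n : ℕ} (θ : LetterC (n + 1) → ℕ) :
    tableauCoeffC q t θ =
      pairWeight q t (t ^ (n + 1) * q ^ (∑ k, innerLetters θ k)) (θ (Sum.inl 0)) (θ (Sum.inr 0)) *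
        tableauCoeffC q t (innerLetters θ) := by
  have e : ∀ m : ℕ, t ^ (n + 1 + 1) * q ^ ((m : ℤ) - 1) = t ^ (n + 1) * q ^ m * t / q := by
    intro m
    rw [zpow_sub₀ hq0, zpow_natCast, zpow_one]
    ring
  simp only [tableauCoeffC, pairWeight, gCoeff, Fintype.prod_sum_type, Fin.prod_univ_succ,
    innerSum_succ, innerSum_zero, Fin.val_zero, Fin.val_succ, Nat.sub_zero, Nat.add_sub_add_right,
    e]
  have f1 : t ^ (n + 1) * q ^ (θ (Sum.inl 0) + ∑ k, innerLetters θ k) =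
      t ^ (n + 1) * q ^ (∑ k, innerLetters θ k) * q ^ θ (Sum.inl 0) := by ring
  have f2 : t ^ (n + 1) * q ^ (θ (Sum.inl 0) + ∑ k, innerLetters θ k) * t / q =
      t ^ (n + 1) * q ^ (∑ k, innerLetters θ k) * t / q * q ^ θ (Sum.inl 0) := by ring
  rw [f2, f1]
  simp only [innerLetters, Sum.elim_inl, Sum.elim_inr]
  ring

theorem tabFun_succ {q t : ℂ} (hq0 : q ≠ 0) {n : ℕ} (x : Fin (n + 1) → ℂ) (r : ℕ) :
    tabFun q t x r = ∑ p ∈ antidiagonal r, (∑ ab ∈ antidiagonal p.1,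
      pairWeight q t (t ^ (n + 1) * q ^ p.2) ab.1 ab.2 * (x 0 ^ ab.1 * (x 0)⁻¹ ^ ab.2)) *
        tabFun q t (Fin.tail x) p.2 := by
  simp only [tabFun, sum_mul_sum, ← sum_product']
  rw [sum_sigma']
  refine sum_nbij'
    (fun θ => ⟨(θ (Sum.inl 0) + θ (Sum.inr 0), ∑ k, innerLetters θ k),
      ((θ (Sum.inl 0), θ (Sum.inr 0)), innerLetters θ)⟩)
    (fun y => Sum.elim (Fin.cons y.2.1.1 fun i => y.2.2 (Sum.inl i))
      (Fin.cons y.2.1.2 fun i => y.2.2 (Sum.inr i))) ?_ ?_ ?_ ?_ ?_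
  · intro θ hθ
    simp only [mem_piAntidiag, mem_univ, implies_true, and_true] at hθ
    simp only [mem_sigma, HasAntidiagonal.mem_antidiagonal, mem_product, mem_piAntidiag, mem_univ,
      implies_true, and_true]
    rw [← hθ]
    simp [innerLetters, Fintype.sum_sum_type, Fin.sum_univ_succ]
    ring
  · rintro ⟨⟨N, s⟩, ⟨⟨a, b⟩, θ⟩⟩ h
    simp only [mem_sigma, HasAntidiagonal.mem_antidiagonal, mem_product, mem_piAntidiag, mem_univ,
      implies_true, and_true] at h ⊢
    obtain ⟨h1, h2, h3⟩ := h
    rw [← h1, ← h2, ← h3]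
    simp [Fintype.sum_sum_type, Fin.sum_univ_succ]
    ring
  · intro θ _
    funext k
    rcases k with k | k <;> refine Fin.cases ?_ (fun i => ?_) k <;> simp [innerLetters]
  · rintro ⟨⟨N, s⟩, ⟨⟨a, b⟩, θ⟩⟩ h
    simp only [mem_sigma, HasAntidiagonal.mem_antidiagonal, mem_product, mem_piAntidiag, mem_univ,
      implies_true, and_true] at h
    obtain ⟨h1, h2, h3⟩ := h
    have e : innerLetters (Sum.elim (Fin.cons a fun i => θ (Sum.inl i) : Fin (n + 1) → ℕ)
        (Fin.cons b fun i => θ (Sum.inr i) : Fin (n + 1) → ℕ)) = θ := by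
      funext k
      rcases k with k | k <;> simp [innerLetters]
    simp only [Sum.elim_inl, Sum.elim_inr, Fin.cons_zero, e, h2, h3]
  · intro θ _
    simp only [tableauCoeffC_succ hq0, Fin.prod_univ_succ, innerLetters, Sum.elim_inl,
      Sum.elim_inr, Fin.tail]
    ring

theorem tabFun_zero (q t : ℂ) (x : Fin 0 → ℂ) (r : ℕ) :
    tabFun q t x r = if r = 0 then 1 else 0 := by
  rcases r with - | r
  · simp [tabFun, tableauCoeffC]
  · simp [tabFun]

end Tableau

/-! ### Expansion of the generating function in tableau sums -/

section Expansion

open PowerSeries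

/-- The power series `∑ (t;q)_k / (q;q)_k (y u)^k`. -/
def gSeries (q t y : ℂ) : PowerSeries ℂ := PowerSeries.mk fun k => gCoeff q t k * y ^ k

/-- The generating function of the polynomials `G_r`. -/
def genSeries (q t : ℂ) {n : ℕ} (x : Fin n → ℂ) : PowerSeries ℂ :=
  ∏ i, gSeries q t (x i) * gSeries q t (x i)⁻¹

theorem sum_antidiagonal_left_comm {M : Type*} [AddCommMonoid M] (n : ℕ) (f : ℕ → ℕ → ℕ → M) :
    ∑ p ∈ antidiagonal n, ∑ r ∈ antidiagonal p.1, f r.1 r.2 p.2 =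
      ∑ p ∈ antidiagonal n, ∑ r ∈ antidiagonal p.2, f r.1 p.1 r.2 := by
  rw [← sum_antidiagonal_assoc n fun a b c => f b a c]
  refine sum_congr rfl fun p _ => ?_
  rw [← Nat.sum_antidiagonal_swap]
  rfl

/-- `phiCoeff` spread over the even indices. -/
def phiEven (q t Z : ℂ) (k : ℕ) : ℂ := if Even k then phiCoeff q t Z (k / 2) else 0

/-- Collects terms by A = a + j and B = b + j. As x^a x^{-b} = x^A x^{-B}, this isolates the
coefficient of a single x-monomial. -/
theorem sum_antidiagonal_even {M : Type*} [AddCommMonoid M] (n : ℕ) (f : ℕ → ℕ → ℕ → M) :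
    ∑ p ∈ antidiagonal n, ∑ r ∈ antidiagonal p.1, (if Even p.2 then f r.1 r.2 (p.2 / 2) else 0) =
      ∑ p ∈ antidiagonal n, ∑ j ∈ range (min p.1 p.2 + 1), f (p.1 - j) (p.2 - j) j := by
  rw [sum_sigma', sum_sigma', ← sum_filter]
  refine sum_nbij' (fun y => ⟨(y.2.1 + y.1.2 / 2, y.2.2 + y.1.2 / 2), y.1.2 / 2⟩)
    (fun y => ⟨(y.1.1 - y.2 + (y.1.2 - y.2), 2 * y.2), (y.1.1 - y.2, y.1.2 - y.2)⟩) ?_ ?_ ?_ ?_ ?_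
  · rintro ⟨⟨a, b⟩, ⟨c, d⟩⟩ h
    simp only [mem_filter, mem_sigma, HasAntidiagonal.mem_antidiagonal] at h
    obtain ⟨⟨h1, h2⟩, ⟨k, rfl⟩⟩ := h
    simp only [mem_sigma, HasAntidiagonal.mem_antidiagonal, mem_range]
    omega
  · rintro ⟨⟨a, b⟩, j⟩ h
    simp only [mem_sigma, HasAntidiagonal.mem_antidiagonal, mem_range] at h
    simp only [mem_filter, mem_sigma, HasAntidiagonal.mem_antidiagonal]
    refine ⟨⟨by omega, trivial⟩, even_two_mul j⟩
  · rintro ⟨⟨a, b⟩, ⟨c, d⟩⟩ h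
    simp only [mem_filter, mem_sigma, HasAntidiagonal.mem_antidiagonal] at h
    obtain ⟨⟨h1, h2⟩, ⟨k, rfl⟩⟩ := h
    simp only [Nat.add_sub_cancel, h2]
    congr 2
    omega
  · rintro ⟨⟨a, b⟩, j⟩ h
    simp only [mem_sigma, HasAntidiagonal.mem_antidiagonal, mem_range] at h
    simp only [Nat.mul_div_cancel_left j two_pos]
    congr 2 <;> omega
  · rintro ⟨⟨a, b⟩, ⟨c, d⟩⟩ _
    simp

/-- With W = Zt/q, the weight is g_a g_b (Z)_{a+b} (W)_a (W)_b / ((W)_{a+b} (Z)_a (Z)_b), visibly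
symmetric. This removes the assumption B ≤ A from the summation formula. -/
theorem pairWeight_comm {q t Z : ℂ} {a b : ℕ} (hZ : ∀ m < a + b, q ^ m * Z ≠ 1)
    (hc : ∀ m < a + b, q ^ m * (Z * t / q) ≠ 1) : pairWeight q t Z a b = pairWeight q t Z b a := by
  have h1 := qShift_ne_zero_iff.2 hZ
  have h2 := qShift_ne_zero_iff.2 hc
  have e1 := qShift_add Z q a b
  have e2 := qShift_add (Z * t / q) q a b
  have e3 := qShift_add Z q b a
  have e4 := qShift_add (Z * t / q) q b a
  rw [add_comm b a] at e3 e4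
  rw [e1] at e3
  rw [e2] at e4
  rw [e1] at h1
  rw [e2] at h2
  have g1 := h1
  have g2 := h2
  rw [e3] at g1
  rw [e4] at g2
  have b1 := left_ne_zero_of_mul h1
  have b2 := left_ne_zero_of_mul g1
  have b3 := right_ne_zero_of_mul h2
  have b4 := right_ne_zero_of_mul g2
  have b5 := left_ne_zero_of_mul h2
  have b6 := left_ne_zero_of_mul g2
  have r1 : qShift (Z * q ^ b) q a =
      qShift Z q a * qShift (Z * q ^ a) q b / qShift Z q b := by
    rw [e3, mul_div_cancel_left₀ _ b2]
  have r2 : qShift (Z * t / q * q ^ b) q a = qShift (Z * t / q) q a *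
      qShift (Z * t / q * q ^ a) q b / qShift (Z * t / q) q b := by
    rw [e4, mul_div_cancel_left₀ _ b6]
  rw [pairWeight, pairWeight, r1, r2]
  field_simp

/-- The one-variable step of the induction on n, obtained from `sum_pairWeight_phiCoeff` monomial by
monomial in x: two free factors g accompanied by φ(Z/t) become a pair weight accompanied by φ(Zq^N),
N being the number of letters in the pair. -/
theorem sum_pairWeight_phiEven {q t Z : ℂ} (hq : ∀ k, qShift q q k ≠ 0) (hq0 : q ≠ 0)
    (ht0 : t ≠ 0) {M : ℕ} (hZ : ∀ m < M, q ^ m * Z ≠ 1)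
    (hc : ∀ m < M, q ^ m * (Z * t / q) ≠ 1) {x : ℂ} (hx : x ≠ 0) :
    ∑ p ∈ antidiagonal M, ∑ ab ∈ antidiagonal p.1,
        pairWeight q t Z ab.1 ab.2 * (x ^ ab.1 * x⁻¹ ^ ab.2) * phiEven q t (Z * q ^ p.1) p.2 =
      ∑ p ∈ antidiagonal M, ∑ ab ∈ antidiagonal p.1,
        gCoeff q t ab.1 * gCoeff q t ab.2 * (x ^ ab.1 * x⁻¹ ^ ab.2) *
          phiEven q t (Z / t) p.2 := by
  have hx' : ∀ A B j : ℕ, j ≤ A → j ≤ B →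
      x ^ (A - j) * x⁻¹ ^ (B - j) = x ^ A * x⁻¹ ^ B := by
    intro A B j h1 h2
    obtain ⟨a, rfl⟩ := Nat.exists_eq_add_of_le h1
    obtain ⟨b, rfl⟩ := Nat.exists_eq_add_of_le h2
    simp only [Nat.add_sub_cancel_left, pow_add]
    have : x ^ j * x⁻¹ ^ j = 1 := by rw [← mul_pow, mul_inv_cancel₀ hx, one_pow]
    linear_combination (-(x ^ a * x⁻¹ ^ b)) * this
  have h1 := sum_antidiagonal_even M fun a b j =>
    pairWeight q t Z a b * (x ^ a * x⁻¹ ^ b) * phiCoeff q t (Z * q ^ (a + b)) j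
  have h2 := sum_antidiagonal_even M fun a b j =>
    gCoeff q t a * gCoeff q t b * (x ^ a * x⁻¹ ^ b) * phiCoeff q t (Z / t) j
  have key : ∀ A B : ℕ, A + B = M →
      ∑ j ∈ range (min A B + 1),
          pairWeight q t Z (A - j) (B - j) * phiCoeff q t (Z * q ^ (A - j + (B - j))) j =
        ∑ j ∈ range (min A B + 1),
          gCoeff q t (A - j) * gCoeff q t (B - j) * phiCoeff q t (Z / t) j := by
    have key' : ∀ A B : ℕ, A + B = M → B ≤ A →
      ∑ j ∈ range (B + 1),
          pairWeight q t Z (A - j) (B - j) * phiCoeff q t (Z * q ^ (A - j + (B - j))) j =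
        ∑ j ∈ range (B + 1),
          gCoeff q t (A - j) * gCoeff q t (B - j) * phiCoeff q t (Z / t) j := by
      rintro A B rfl hAB
      have := sum_pairWeight_phiCoeff hq hq0 ht0 hAB hZ hc
      rwa [Nat.sum_antidiagonal_eq_sum_range_succ_mk,
        Nat.sum_antidiagonal_eq_sum_range_succ_mk] at this
    intro A B h
    rcases le_total B A with hAB | hAB
    · rw [min_eq_right hAB]
      exact key' A B h hAB
    · rw [min_eq_left hAB]
      have := key' B A (by omega) hAB
      refine Eq.trans (sum_congr rfl fun j _ => ?_) (this.trans (sum_congr rfl fun j _ => ?_))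
      · rw [pairWeight_comm (fun m hm => hZ m (by omega)) fun m hm => hc m (by omega),
          add_comm (A - j)]
      · ring
  calc _ = _ := sum_congr rfl fun p _ => sum_congr rfl fun ab hab => ?_
    _ = _ := h1
    _ = _ := sum_congr rfl fun p hp => ?_
    _ = _ := h2.symm
    _ = _ := sum_congr rfl fun p _ => sum_congr rfl fun ab hab => ?_
  · rw [phiEven, HasAntidiagonal.mem_antidiagonal.1 hab, mul_ite, mul_zero]
  · have := congrArg (fun s => x ^ p.1 * x⁻¹ ^ p.2 * s) (key p.1 p.2 (by simpa using hp))
    simp only [mul_sum] at this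
    refine Eq.trans (sum_congr rfl fun j hj => ?_) (this.trans (sum_congr rfl fun j hj => ?_))
    all_goals
      rw [mem_range] at hj
      rw [hx' _ _ _ (by omega) (by omega)]
      ring
  · rw [phiEven, mul_ite, mul_zero]

theorem coeff_genSeries_succ (q t : ℂ) {n : ℕ} (x : Fin (n + 1) → ℂ) (R : ℕ) :
    coeff R (genSeries q t x) = ∑ p ∈ antidiagonal R, (∑ ab ∈ antidiagonal p.1,
      gCoeff q t ab.1 * gCoeff q t ab.2 * (x 0 ^ ab.1 * (x 0)⁻¹ ^ ab.2)) *
        coeff p.2 (genSeries q t (Fin.tail x)) := by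
  rw [genSeries, Fin.prod_univ_succ, coeff_mul]
  refine sum_congr rfl fun p _ => ?_
  rw [coeff_mul]
  congr 1
  refine sum_congr rfl fun ab _ => ?_
  simp only [gSeries, coeff_mk]
  ring

/-- The expansion of the generating function in terms of the tableau sums. -/
theorem coeff_genSeries {q t : ℂ} (hq : ∀ k, qShift q q k ≠ 0) (hq0 : q ≠ 0) (ht0 : t ≠ 0)
    {n : ℕ} (x : Fin n → ℂ) (hx : ∀ i, x i ≠ 0) (R : ℕ)
    (h1 : ∀ k m : ℕ, 1 ≤ k → k ≤ n → m < R → q ^ m * t ^ k ≠ 1)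
    (h2 : ∀ k m : ℕ, 2 ≤ k → k ≤ n + 1 → m < R → q ^ m * (t ^ k / q) ≠ 1) :
    coeff R (genSeries q t x) =
      ∑ p ∈ antidiagonal R, phiEven q t (t ^ n * q ^ p.1) p.2 * tabFun q t x p.1 := by
  induction n generalizing R with
  | zero =>
    -- With no variables only s = 0 survives, where Z = 1; the factor (1;q)_i kills φ_i for i > 0,
    -- in agreement with F = 1.
    simp only [tabFun_zero, mul_ite, mul_one, mul_zero, genSeries, Finset.univ_eq_empty,
      prod_empty, coeff_one]
    rw [Nat.sum_antidiagonal_eq_sum_range_succ_mk]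
    simp only [sum_ite_eq', mem_range, Nat.succ_pos, if_true, Nat.sub_zero, pow_zero, mul_one,
      phiEven]
    split_ifs with h3 h4 h4
    · subst h3
      simp [phiCoeff, qShift_zero]
    · subst h3
      simp at h4
    · obtain ⟨k, hk⟩ := Nat.exists_eq_add_of_lt (show 0 < R / 2 by
        obtain ⟨k, rfl⟩ := h4; omega)
      rw [hk, zero_add, phiCoeff, qShift_one_succ]
      simp
    · rfl
  | succ n ih =>
    -- Here `s` is the total of the inner letters: Z/t = t^n q^s is the argument supplied by the
    -- induction hypothesis, and Zq^N = t^(n+1) q^(s+N) is the one required. The computation below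
    -- brings `s` outermost, applies this, and regroups.
    have hk : ∀ s M, s + M = R → _ := fun s M hs =>
      sum_pairWeight_phiEven (Z := t ^ (n + 1) * q ^ s) hq hq0 ht0 (M := M)
        (fun m hm h => h1 (n + 1) (m + s) (by omega) le_rfl (by omega) (by rw [← h]; ring))
        (fun m hm h => h2 (n + 2) (m + s) (by omega) le_rfl (by omega) (by rw [← h]; ring))
        (hx 0)
    have e : ∀ s : ℕ, t ^ (n + 1) * q ^ s / t = t ^ n * q ^ s := fun s => by
      rw [pow_succ]
      field_simp
    have ih' : ∀ p ∈ antidiagonal R, coeff p.2 (genSeries q t (Fin.tail x)) =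
        ∑ r ∈ antidiagonal p.2, phiEven q t (t ^ n * q ^ r.1) r.2 *
          tabFun q t (Fin.tail x) r.1 := by
      intro p hp
      have : p.1 + p.2 = R := by simpa using hp
      exact ih (Fin.tail x) (fun i => hx i.succ) p.2
        (fun k m a b c => h1 k m a (by omega) (by omega))
        (fun k m a b c => h2 k m a (by omega) (by omega))
    rw [coeff_genSeries_succ]
    calc _ = ∑ p ∈ antidiagonal R, ∑ r ∈ antidiagonal p.2, (∑ ab ∈ antidiagonal p.1,
              gCoeff q t ab.1 * gCoeff q t ab.2 * (x 0 ^ ab.1 * (x 0)⁻¹ ^ ab.2)) *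
              (phiEven q t (t ^ n * q ^ r.1) r.2 * tabFun q t (Fin.tail x) r.1) := by
          refine sum_congr rfl fun p hp => ?_
          rw [ih' p hp, mul_sum]
      _ = ∑ p ∈ antidiagonal R, ∑ r ∈ antidiagonal p.2, (∑ ab ∈ antidiagonal r.1,
              gCoeff q t ab.1 * gCoeff q t ab.2 * (x 0 ^ ab.1 * (x 0)⁻¹ ^ ab.2)) *
              (phiEven q t (t ^ n * q ^ p.1) r.2 * tabFun q t (Fin.tail x) p.1) := by
          have := sum_antidiagonal_left_comm R fun N s k => (∑ ab ∈ antidiagonal N,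
              gCoeff q t ab.1 * gCoeff q t ab.2 * (x 0 ^ ab.1 * (x 0)⁻¹ ^ ab.2)) *
              (phiEven q t (t ^ n * q ^ s) k * tabFun q t (Fin.tail x) s)
          rw [← this, sum_antidiagonal_assoc R fun N s k => (∑ ab ∈ antidiagonal N,
              gCoeff q t ab.1 * gCoeff q t ab.2 * (x 0 ^ ab.1 * (x 0)⁻¹ ^ ab.2)) *
              (phiEven q t (t ^ n * q ^ s) k * tabFun q t (Fin.tail x) s)]
      _ = ∑ p ∈ antidiagonal R, ∑ r ∈ antidiagonal p.2, (∑ ab ∈ antidiagonal r.1,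
              pairWeight q t (t ^ (n + 1) * q ^ p.1) ab.1 ab.2 *
                (x 0 ^ ab.1 * (x 0)⁻¹ ^ ab.2)) *
              (phiEven q t (t ^ (n + 1) * q ^ p.1 * q ^ r.1) r.2 *
                tabFun q t (Fin.tail x) p.1) := by
          refine sum_congr rfl fun p hp => ?_
          have := congrArg (· * tabFun q t (Fin.tail x) p.1) (hk p.1 p.2 (by simpa using hp))
          simp only [sum_mul, e] at this
          simp only [sum_mul, ← mul_assoc] at this ⊢
          exact this.symm
      _ = ∑ p ∈ antidiagonal R, ∑ r ∈ antidiagonal p.1, (∑ ab ∈ antidiagonal r.1,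
              pairWeight q t (t ^ (n + 1) * q ^ r.2) ab.1 ab.2 *
                (x 0 ^ ab.1 * (x 0)⁻¹ ^ ab.2)) *
              (phiEven q t (t ^ (n + 1) * q ^ r.2 * q ^ r.1) p.2 *
                tabFun q t (Fin.tail x) r.2) :=
          (sum_antidiagonal_left_comm R fun N s k => (∑ ab ∈ antidiagonal N,
              pairWeight q t (t ^ (n + 1) * q ^ s) ab.1 ab.2 *
                (x 0 ^ ab.1 * (x 0)⁻¹ ^ ab.2)) *
              (phiEven q t (t ^ (n + 1) * q ^ s * q ^ N) k *
                tabFun q t (Fin.tail x) s)).symm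
      _ = _ := by
          refine sum_congr rfl fun p _ => ?_
          rw [tabFun_succ hq0, mul_sum]
          refine sum_congr rfl fun r hr => ?_
          have e' : t ^ (n + 1) * q ^ r.2 * q ^ r.1 = t ^ (n + 1) * q ^ p.1 := by
            rw [← HasAntidiagonal.mem_antidiagonal.1 hr]
            ring
          rw [e']
          ring

end Expansion

/-! ### Partial fractions of the kernel -/

section PartialFractions

open Polynomial

theorem prod_univ_erase {ι M : Type*} [Fintype ι] [DecidableEq ι] [CommMonoid M] (f : ι → M)
    (a : ι) : ∏ j ∈ univ.erase a, f j = ∏ j, if j = a then 1 else f j := by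
  rw [← prod_erase univ (a := a) (by simp)]
  exact prod_congr rfl fun j hj => by rw [if_neg (ne_of_mem_erase hj)]

variable {K : Type*} [Field K]

/-- `∏ (1 - w x_j) (1 - w / x_j)` over the indices in `S`. -/
def pairProd {n : ℕ} (x : Fin n → K) (S : Finset (Fin n)) (w : K) : K :=
  ∏ j ∈ S, (1 - w * x j) * (1 - w * (x j)⁻¹)

/-- The polynomial `∏ (1 - c x_j X) (1 - c x_j⁻¹ X)` over the indices in `S`. -/
def pairPoly {n : ℕ} (x : Fin n → K) (c : K) (S : Finset (Fin n)) : K[X] :=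
  ∏ j ∈ S, (1 - C (c * x j) * X) * (1 - C (c * (x j)⁻¹) * X)

theorem eval_pairPoly {n : ℕ} (x : Fin n → K) (c : K) (S : Finset (Fin n)) (w : K) :
    (pairPoly x c S).eval w = pairProd x S (c * w) := by
  rw [pairPoly, pairProd, eval_prod]
  refine prod_congr rfl fun j _ => ?_
  simp only [eval_mul, eval_sub, eval_one, eval_C, eval_X]
  ring

/-- Modulo 1 - tX² the pair of factors with parameter t is t times the pair with parameter 1. Taking
products, this makes the difference in `exists_quotient` divisible by 1 - tX². -/
theorem pairPoly_factor {n : ℕ} {x : Fin n → K} (hx : ∀ i, x i ≠ 0) (t : K) (j : Fin n) :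
    (1 - C (t * x j) * X) * (1 - C (t * (x j)⁻¹) * X) =
      C t * ((1 - C (1 * x j) * X) * (1 - C (1 * (x j)⁻¹) * X)) +
        C (1 - t) * (1 - C t * X ^ 2) := by
  have h : C (x j) * C (x j)⁻¹ = (1 : K[X]) := by rw [← C_mul, mul_inv_cancel₀ (hx j), C_1]
  simp only [one_mul, C_mul, C_sub, C_1]
  linear_combination (C t * C t * X ^ 2 - C t * X ^ 2) * h

theorem natDegree_pairPoly_le {n : ℕ} (x : Fin n → K) (c : K) (S : Finset (Fin n)) :
    (pairPoly x c S).natDegree ≤ 2 * #S := by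
  rw [pairPoly]
  refine (natDegree_prod_le _ _).trans ?_
  rw [mul_comm, ← smul_eq_mul]
  refine sum_le_card_nsmul _ _ _ fun j _ => ?_
  compute_degree

theorem coeff_pairPoly {n : ℕ} {x : Fin n → K} (hx : ∀ i, x i ≠ 0) (c : K) (S : Finset (Fin n)) :
    (pairPoly x c S).coeff (2 * #S) = c ^ (2 * #S) := by
  rw [pairPoly, mul_comm, coeff_prod_of_natDegree_le]
  · rw [mul_comm #S, pow_mul, ← prod_const (c ^ 2)]
    refine prod_congr rfl fun j _ => ?_
    have e : (1 - C (c * x j) * X) * (1 - C (c * (x j)⁻¹) * X) =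
        C (c ^ 2) * X ^ 2 + C (-(c * x j + c * (x j)⁻¹)) * X + C 1 := by
      have h : C (x j) * C (x j)⁻¹ = (1 : K[X]) := by rw [← C_mul, mul_inv_cancel₀ (hx j), C_1]
      simp only [C_mul, C_neg, C_add, C_1, C_pow]
      linear_combination (C c * C c * X ^ 2) * h
    rw [e, coeff_add, coeff_add, coeff_C_mul, coeff_C_mul, coeff_X_pow, coeff_X, coeff_C]
    simp
  · intro j _
    compute_degree

theorem exists_quotient {n : ℕ} {x : Fin n → K} (hx : ∀ i, x i ≠ 0) (t : K) (S : Finset (Fin n)) :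
    ∃ M : K[X], pairPoly x t S - C (t ^ #S) * pairPoly x 1 S = (1 - C t * X ^ 2) * M := by
  classical
  induction S using Finset.induction_on with
  | empty => exact ⟨0, by simp [pairPoly]⟩
  | insert i S hi ih =>
    obtain ⟨M, hM⟩ := ih
    refine ⟨C t * ((1 - C (1 * x i) * X) * (1 - C (1 * (x i)⁻¹) * X)) * M +
      C (1 - t) * pairPoly x t S, ?_⟩
    rw [pairPoly, pairPoly, prod_insert hi, prod_insert hi, card_insert_of_notMem hi]
    have h3 : (C (t ^ (#S + 1)) : K[X]) = C t * C (t ^ #S) := by rw [← C_mul, ← pow_succ']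
    rw [pairPoly_factor hx, ← pairPoly, ← pairPoly, h3]
    linear_combination (C t * ((1 - C (1 * x i) * X) * (1 - C (1 * (x i)⁻¹) * X))) * hM

theorem one_sub_C_mul_X_sq_ne_zero (t : K) : (1 - C t * X ^ 2 : K[X]) ≠ 0 := by
  intro h
  have := congrArg (eval 0) h
  simp at this

/-- At y = x_i^{±1} the i-th pair with parameter 1 vanishes, and only the second term of
`pairPoly_factor` survives. The division by 1 - tX² takes place among polynomials, so 1 - ty² is
allowed to be zero. -/
theorem eval_quotient {n : ℕ} {x : Fin n → K} (hx : ∀ i, x i ≠ 0) (t : K) {M : K[X]}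
    (hM : pairPoly x t univ - C (t ^ n) * pairPoly x 1 univ = (1 - C t * X ^ 2) * M)
    (i : Fin n) {y : K} (hy : y = x i ∨ y = (x i)⁻¹) :
    M.eval y = (1 - t) * pairProd x (univ.erase i) (t * y) := by
  obtain ⟨M', hM'⟩ := exists_quotient hx t (univ.erase i)
  have h1 : M = C t * ((1 - C (1 * x i) * X) * (1 - C (1 * (x i)⁻¹) * X)) * M' +
      C (1 - t) * pairPoly x t (univ.erase i) := by
    apply mul_left_cancel₀ (one_sub_C_mul_X_sq_ne_zero t)
    rw [← hM, pairPoly, pairPoly, ← mul_prod_erase univ _ (mem_univ i),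
      ← mul_prod_erase univ _ (mem_univ i), pairPoly_factor hx, ← pairPoly, ← pairPoly]
    have h2 : n = #(univ.erase i) + 1 := by
      rw [card_erase_add_one (mem_univ i), card_univ, Fintype.card_fin]
    have h3 : (C (t ^ n) : K[X]) = C t * C (t ^ #(univ.erase i)) := by
      rw [← C_mul, ← pow_succ', ← h2]
    rw [h3]
    linear_combination (C t * ((1 - C (1 * x i) * X) * (1 - C (1 * (x i)⁻¹) * X))) * hM'
  have h4 : (1 - x i * y) * (1 - (x i)⁻¹ * y) = 0 := by
    rcases hy with rfl | rfl <;> simp [hx i]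
  rw [h1, eval_add, eval_mul, eval_mul, eval_mul, eval_mul, eval_pairPoly]
  simp only [one_mul, eval_C, eval_sub, eval_one, eval_mul, eval_X, h4, mul_zero, zero_mul,
    zero_add]

theorem quotient_degree {n : ℕ} (hn : 1 ≤ n) {x : Fin n → K} (hx : ∀ i, x i ≠ 0) {t : K}
    (ht : t ≠ 0) {M : K[X]}
    (hM : pairPoly x t univ - C (t ^ n) * pairPoly x 1 univ = (1 - C t * X ^ 2) * M) :
    M.natDegree ≤ 2 * n - 2 ∧ t * M.coeff (2 * n - 2) = t ^ n - t ^ (2 * n) := by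
  have hd : (1 - C t * X ^ 2 : K[X]).natDegree = 2 := by
    compute_degree!
  have h0 : (pairPoly x t univ - C (t ^ n) * pairPoly x 1 univ).natDegree ≤ 2 * n := by
    refine (natDegree_sub_le _ _).trans (max_le ?_ ((natDegree_C_mul_le _ _).trans ?_))
    · simpa using natDegree_pairPoly_le x t univ
    · simpa using natDegree_pairPoly_le x 1 univ
  have hdeg : M.natDegree ≤ 2 * n - 2 := by
    by_cases hM0 : M = 0
    · simp [hM0]
    · rw [hM, natDegree_mul (one_sub_C_mul_X_sq_ne_zero t) hM0, hd] at h0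
      omega
  refine ⟨hdeg, ?_⟩
  have h1 := congrArg (fun P => P.coeff (2 * n)) hM
  have h2 := coeff_pairPoly hx t univ
  have h3 := coeff_pairPoly hx 1 univ
  simp only [card_univ, Fintype.card_fin, one_pow] at h2 h3
  simp only [coeff_sub, coeff_C_mul, h2, h3, mul_one, sub_mul, one_mul, mul_assoc] at h1
  rw [coeff_eq_zero_of_natDegree_lt (show M.natDegree < 2 * n by omega)] at h1
  obtain ⟨m, rfl⟩ := Nat.exists_eq_add_of_le hn
  rw [show 2 * (1 + m) = 2 * m + 2 by ring, mul_comm (X ^ 2), coeff_mul_X_pow] at h1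
  rw [show 2 * (1 + m) - 2 = 2 * m by omega, show 2 * (1 + m) = 2 * m + 2 by ring]
  linear_combination h1

theorem sub_mul_sub_inv {x : K} (hx : x ≠ 0) (w : K) :
    (w - x) * (w - x⁻¹) = (1 - w * x) * (1 - w * x⁻¹) := by
  linear_combination (1 - w ^ 2) * mul_inv_cancel₀ hx

/-- The points `x_1, …, x_n, x_1⁻¹, …, x_n⁻¹`. -/
def letterPoint {n : ℕ} (x : Fin n → K) : LetterC n → K := Sum.elim x fun i => (x i)⁻¹

theorem prod_sub_letterPoint {n : ℕ} {x : Fin n → K} (hx : ∀ i, x i ≠ 0) (w : K) :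
    ∏ k, (w - letterPoint x k) = pairProd x univ w := by
  rw [Fintype.prod_sum_type, ← prod_mul_distrib]
  exact prod_congr rfl fun j _ => sub_mul_sub_inv (hx j) w

theorem prod_erase_sub_letterPoint {n : ℕ} {x : Fin n → K} (hx : ∀ i, x i ≠ 0) (i : Fin n)
    {k : LetterC n} (hk : k = Sum.inl i ∨ k = Sum.inr i) :
    ∏ l ∈ univ.erase k, (letterPoint x k - letterPoint x l) =
      (letterPoint x k - (letterPoint x k)⁻¹) * pairProd x (univ.erase i) (letterPoint x k) := by
  have h : ∀ w, pairProd x (univ.erase i) w =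
      (∏ j ∈ univ.erase i, (w - x j)) * ∏ j ∈ univ.erase i, (w - (x j)⁻¹) := by
    intro w
    rw [pairProd, ← prod_mul_distrib]
    exact prod_congr rfl fun j _ => (sub_mul_sub_inv (hx j) w).symm
  rw [prod_univ_erase, Fintype.prod_sum_type, h]
  rcases hk with rfl | rfl
  · simp only [letterPoint, Sum.elim_inl, Sum.elim_inr, Sum.inl.injEq, reduceCtorEq, if_false]
    rw [← prod_univ_erase, ← mul_prod_erase univ (fun j => x i - (x j)⁻¹) (mem_univ i)]
    ring
  · simp only [letterPoint, Sum.elim_inl, Sum.elim_inr, Sum.inr.injEq, reduceCtorEq, if_false]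
    rw [← prod_univ_erase, ← mul_prod_erase univ (fun j => (x i)⁻¹ - x j) (mem_univ i), inv_inv]
    ring

/-- The contribution of the point `y`, which is `x_i` or its inverse, to the action of the
`q`-difference operator on the generating function. -/
def kernelTerm {n : ℕ} (q t T u : K) (x : Fin n → K) (i : Fin n) (y : K) : K :=
  (1 - T * y ^ 2) * (1 - q * T * y ^ 2) / (1 - y ^ 2) *
    (pairProd x (univ.erase i) (t * y) / pairProd x (univ.erase i) y) *
    ((1 - t) * u / ((1 - t * u * y) * (q * y - u)))

/-- Residue theorem in polynomial form: Q = (1 - TX²)(1 - qTX²)M has degree at most 2n + 2, so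
Lagrange interpolation at the 2n + 3 nodes x_i^{±1}, 0, w₁, w₂ expresses its coefficient of X^(2n+2)
as ∑ Q(v)/∏(v - v'). The nodes x_i^{±1} give the kernel terms, the other three the explicit terms,
and the coefficient itself is the contribution of infinity. -/
theorem sum_kernelTerm {n : ℕ} (hn : 1 ≤ n) {x : Fin n → K} (hx : ∀ i, x i ≠ 0)
    {q t u w₁ w₂ : K} (T : K) (hq : q ≠ 0) (ht : t ≠ 0) (hu : u ≠ 0)
    (hinj : Function.Injective (letterPoint x)) (hw₁ : w₁ = (t * u)⁻¹) (hw₂ : w₂ = u / q)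
    (h₁ : ∀ k, letterPoint x k ≠ w₁) (h₂ : ∀ k, letterPoint x k ≠ w₂) (h₁₂ : w₁ ≠ w₂)
    (ht₁ : 1 - t * w₁ ^ 2 ≠ 0) (ht₂ : 1 - t * w₂ ^ 2 ≠ 0) :
    t * q * ∑ i, (kernelTerm q t T u x i (x i) + kernelTerm q t T u x i (x i)⁻¹) =
      q * T ^ 2 * (t ^ n - t ^ (2 * n)) / t - t * q * (1 - t ^ n) -
        (1 - T * w₁ ^ 2) * (1 - q * T * w₁ ^ 2) / ((1 - t * w₁ ^ 2) * (w₁ * (w₁ - w₂))) *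
          (pairProd x univ (t * w₁) / pairProd x univ w₁ - t ^ n) -
        (1 - T * w₂ ^ 2) * (1 - q * T * w₂ ^ 2) / ((1 - t * w₂ ^ 2) * (w₂ * (w₂ - w₁))) *
          (pairProd x univ (t * w₂) / pairProd x univ w₂ - t ^ n) := by
  obtain ⟨M, hM⟩ := exists_quotient hx t univ
  rw [card_univ, Fintype.card_fin] at hM
  obtain ⟨hdeg, hlead⟩ := quotient_degree hn hx ht hM
  have hw₁0 : w₁ ≠ 0 := by rw [hw₁]; exact inv_ne_zero (mul_ne_zero ht hu)
  have hw₂0 : w₂ ≠ 0 := by rw [hw₂]; exact div_ne_zero hu hq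
  have hy0 : ∀ k, letterPoint x k ≠ 0 := by
    rintro (k | k)
    · exact hx k
    · exact inv_ne_zero (hx k)
  set Q : K[X] := (1 - C T * X ^ 2) * (1 - C (q * T) * X ^ 2) * M with hQ
  set v : LetterC n ⊕ Fin 3 → K := Sum.elim (letterPoint x) ![0, w₁, w₂] with hv
  have hv_inj : Function.Injective v := by
    refine hinj.sumElim ?_ ?_
    · intro a b
      fin_cases a <;> fin_cases b <;> simp [hw₁0, hw₂0, h₁₂, hw₁0.symm, hw₂0.symm, h₁₂.symm]
    · intro k b
      fin_cases b <;> simp [hy0, h₁, h₂]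
  have hcard : #(univ : Finset (LetterC n ⊕ Fin 3)) = 2 * n + 3 := by
    simp
    ring
  have hQdeg : Q.natDegree ≤ 2 * n + 2 := by
    refine natDegree_mul_le.trans ?_
    have : ((1 - C T * X ^ 2) * (1 - C (q * T) * X ^ 2) : K[X]).natDegree ≤ 4 := by
      compute_degree
    omega
  have hsum := Lagrange.coeff_eq_sum (s := univ) (v := v) hv_inj.injOn (P := Q) (by
    rw [hcard]
    refine degree_le_natDegree.trans_lt ?_
    exact_mod_cast (by omega : Q.natDegree < 2 * n + 3))
  -- Only the part of `Q` divisible by `M * X ^ 4` reaches this degree.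
  have hcoeff : Q.coeff (2 * n + 3 - 1) = q * T ^ 2 * (t ^ n - t ^ (2 * n)) / t := by
    obtain ⟨m, rfl⟩ := Nat.exists_eq_add_of_le' hn
    rw [show 2 * (m + 1) - 2 = 2 * m by omega] at hdeg hlead
    have e : Q = C (q * T ^ 2) * (M * X ^ 4) - C (T + q * T) * (M * X ^ 2) + M := by
      simp only [hQ, C_mul, C_add, C_pow]
      ring
    rw [e, show 2 * (m + 1) + 3 - 1 = 2 * m + 4 by omega, coeff_add, coeff_sub, coeff_C_mul,
      coeff_C_mul, coeff_mul_X_pow, show 2 * m + 4 = 2 * m + 2 + 2 by ring, coeff_mul_X_pow,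
      coeff_eq_zero_of_natDegree_lt (show M.natDegree < 2 * m + 2 by omega),
      coeff_eq_zero_of_natDegree_lt (show M.natDegree < 2 * m + 2 + 2 by omega), ← hlead]
    field_simp
    ring
  have hQ_eval : ∀ w, Q.eval w = (1 - T * w ^ 2) * (1 - q * T * w ^ 2) * M.eval w := by
    intro w
    simp [hQ]
  have hM_eval : ∀ w, 1 - t * w ^ 2 ≠ 0 → M.eval w =
      (pairProd x univ (t * w) - t ^ n * pairProd x univ w) / (1 - t * w ^ 2) := by
    intro w hw
    have := congrArg (eval w) hM
    simp only [eval_sub, eval_mul, eval_pairPoly, eval_C, eval_one, eval_pow, eval_X,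
      one_mul] at this
    rw [this, mul_div_cancel_left₀ _ hw]
  rw [hcard, hcoeff, Fintype.sum_sum_type] at hsum
  have hL : ∀ i k, (k = Sum.inl i ∨ k = Sum.inr i) →
      Q.eval (v (Sum.inl k)) / ∏ j ∈ univ.erase (Sum.inl k), (v (Sum.inl k) - v j) =
        t * q * kernelTerm q t T u x i (letterPoint x k) := by
    intro i k hk
    have hy : letterPoint x k = x i ∨ letterPoint x k = (x i)⁻¹ := by
      rcases hk with rfl | rfl
      · exact Or.inl rfl
      · exact Or.inr rfl
    have hprod : ∏ j ∈ univ.erase (Sum.inl k), (v (Sum.inl k) - v j) =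
        (∏ l ∈ univ.erase k, (letterPoint x k - letterPoint x l)) *
          (letterPoint x k * (letterPoint x k - w₁) * (letterPoint x k - w₂)) := by
      rw [prod_univ_erase, Fintype.prod_sum_type, prod_univ_erase, Fin.prod_univ_three]
      simp [hv]
    rw [hprod, prod_erase_sub_letterPoint hx i hk, hQ_eval, kernelTerm,
      show v (Sum.inl k) = letterPoint x k from rfl, eval_quotient hx t hM i hy]
    have hyk := hy0 k
    have g1 := sub_ne_zero.2 (h₁ k)
    have g2 := sub_ne_zero.2 (h₂ k)
    generalize letterPoint x k = y at *
    have e1 : (y - y⁻¹) * pairProd x (univ.erase i) y * (y * (y - w₁) * (y - w₂)) =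
        -(1 - y ^ 2) * pairProd x (univ.erase i) y * ((y - w₁) * (y - w₂)) := by
      field_simp
      ring
    -- As functions of `y` the two kernel denominators vanish exactly at `w₁` and `w₂`; this is
    -- where these nodes come from.
    have e2 : (1 - t * u * y) * (q * y - u) = -(t * u * q) * ((y - w₁) * (y - w₂)) := by
      rw [hw₁, hw₂]
      field_simp
      ring
    rw [e1, e2]
    field_simp
  have hR : ∀ a, ∏ j ∈ univ.erase (Sum.inr a), (v (Sum.inr a) - v j) =
      pairProd x univ (v (Sum.inr a)) * ∏ b ∈ univ.erase a, (v (Sum.inr a) - v (Sum.inr b)) := by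
    intro a
    rw [prod_univ_erase, Fintype.prod_sum_type, ← prod_sub_letterPoint hx, prod_univ_erase]
    simp [hv]
  have hS : ∑ k, Q.eval (v (Sum.inl k)) / ∏ j ∈ univ.erase (Sum.inl k), (v (Sum.inl k) - v j) =
      t * q * ∑ i, (kernelTerm q t T u x i (x i) + kernelTerm q t T u x i (x i)⁻¹) := by
    rw [Fintype.sum_sum_type, ← sum_add_distrib, mul_sum]
    refine sum_congr rfl fun i _ => ?_
    rw [hL i _ (Or.inl rfl), hL i _ (Or.inr rfl), mul_add]
    rfl
  have hE1 : ∏ b ∈ univ.erase (0 : Fin 3), (v (Sum.inr 0) - v (Sum.inr b)) = w₁ * w₂ := by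
    rw [prod_univ_erase, Fin.prod_univ_three]
    simp [hv]
  have hE2 : ∏ b ∈ univ.erase (1 : Fin 3), (v (Sum.inr 1) - v (Sum.inr b)) =
      w₁ * (w₁ - w₂) := by
    rw [prod_univ_erase, Fin.prod_univ_three]
    simp [hv]
  have hE3 : ∏ b ∈ univ.erase (2 : Fin 3), (v (Sum.inr 2) - v (Sum.inr b)) =
      w₂ * (w₂ - w₁) := by
    rw [prod_univ_erase, Fin.prod_univ_three]
    simp [hv]
  have hP : ∀ w, (∀ k, letterPoint x k ≠ w) → pairProd x univ w ≠ 0 := by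
    intro w hw
    rw [← prod_sub_letterPoint hx, prod_ne_zero_iff]
    exact fun k _ => sub_ne_zero.2 (hw k).symm
  have hP₁ := hP w₁ h₁
  have hP₂ := hP w₂ h₂
  have hP₀ : pairProd x univ (0 : K) = 1 := by simp [pairProd]
  have hv0 : v (Sum.inr 0) = 0 := rfl
  have hv1 : v (Sum.inr 1) = w₁ := rfl
  have hv2 : v (Sum.inr 2) = w₂ := rfl
  rw [hS, Fin.sum_univ_three, hR, hR, hR, hE1, hE2, hE3, hv0, hv1, hv2, hQ_eval, hQ_eval, hQ_eval,
    hM_eval w₁ ht₁, hM_eval w₂ ht₂, hM_eval 0 (by simp), mul_zero, hP₀] at hsum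
  have h12 : w₁ - w₂ ≠ 0 := sub_ne_zero.2 h₁₂
  have h21 : w₂ - w₁ ≠ 0 := sub_ne_zero.2 h₁₂.symm
  have e0 : w₁ * w₂ = (t * q)⁻¹ := by
    rw [hw₁, hw₂]
    field_simp
  rw [e0] at hsum
  rw [hsum]
  field_simp
  ring

end PartialFractions

/-! ### Action of the shifts on the generating function -/

section KernelIdentity

open PowerSeries

theorem gCoeff_succ {q : ℂ} (hq : ∀ k, qShift q q k ≠ 0) (t : ℂ) (k : ℕ) :
    gCoeff q t (k + 1) * (1 - q ^ (k + 1)) = gCoeff q t k * (1 - q ^ k * t) := by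
  have h := hq (k + 1)
  have h0 := hq k
  rw [qShift_succ, ← pow_succ] at h
  have h1 := right_ne_zero_of_mul h
  rw [gCoeff, gCoeff, qShift_succ, qShift_succ q, ← pow_succ]
  field_simp

/-- The functional equation of g(yu) = (tyu;q)_∞/(yu;q)_∞, read off from the coefficients so that no
infinite product is needed. -/
theorem gSeries_mul {q : ℂ} (hq : ∀ k, qShift q q k ≠ 0) (t y : ℂ) :
    gSeries q t (q * y) * (1 - C (t * y) * X) = gSeries q t y * (1 - C y * X) := by
  ext k
  rcases k with - | k
  · simp [gSeries]
  · rw [mul_sub, mul_sub, mul_one, mul_one, map_sub, map_sub, ← mul_assoc, ← mul_assoc,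
      coeff_succ_mul_X, coeff_succ_mul_X, coeff_mul_C, coeff_mul_C]
    simp only [gSeries, coeff_mk]
    linear_combination (-y ^ (k + 1)) * gCoeff_succ hq t k

theorem rescale_gSeries (q t c y : ℂ) : rescale c (gSeries q t y) = gSeries q t (c * y) := by
  ext k
  simp only [gSeries, coeff_rescale, coeff_mk]
  ring

/-- The power series `∏ (1 - c x_j X) (1 - c x_j⁻¹ X)`. -/
def pairSeries {n : ℕ} (x : Fin n → ℂ) (c : ℂ) : PowerSeries ℂ :=
  ∏ j, (1 - C (c * x j) * X) * (1 - C (c * (x j)⁻¹) * X)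

theorem rescale_genSeries {q : ℂ} (hq : ∀ k, qShift q q k ≠ 0) (t : ℂ) {n : ℕ} (x : Fin n → ℂ) :
    pairSeries x t * rescale q (genSeries q t x) = pairSeries x 1 * genSeries q t x := by
  simp only [pairSeries, genSeries, map_prod, ← prod_mul_distrib, map_mul (rescale q),
    rescale_gSeries]
  refine prod_congr rfl fun j _ => ?_
  have h1 := gSeries_mul hq t (x j)
  have h2 := gSeries_mul hq t (x j)⁻¹
  simp only [one_mul]
  linear_combination (gSeries q t (q * (x j)⁻¹) * (1 - C (t * (x j)⁻¹) * X)) * h1 +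
    (gSeries q t (x j) * (1 - C (x j) * X)) * h2

theorem rescale_C_mul_X (c a : ℂ) : rescale c (C a * X) = C (c * a) * X := by
  ext k
  rw [coeff_rescale, coeff_C_mul, coeff_C_mul, coeff_X]
  split_ifs with h <;> simp [h]

theorem rescale_pairSeries {n : ℕ} (x : Fin n → ℂ) (a c : ℂ) :
    rescale a (pairSeries x c) = pairSeries x (a * c) := by
  simp only [pairSeries, map_prod]
  refine prod_congr rfl fun j _ => ?_
  rw [map_mul, map_sub, map_sub, map_one, rescale_C_mul_X, rescale_C_mul_X, mul_assoc, mul_assoc]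

theorem rescale_inv_genSeries {q : ℂ} (hq : ∀ k, qShift q q k ≠ 0) (hq0 : q ≠ 0) (t : ℂ) {n : ℕ}
    (x : Fin n → ℂ) :
    pairSeries x (t / q) * genSeries q t x = pairSeries x q⁻¹ * rescale q⁻¹ (genSeries q t x) := by
  have h := congrArg (rescale q⁻¹) (rescale_genSeries hq t x)
  rw [map_mul, map_mul, rescale_pairSeries, rescale_pairSeries, rescale_rescale] at h
  simpa [hq0, div_eq_inv_mul, rescale_one] using h

/-- Only two factors of F change, and by `gSeries_mul` they change by (1 - xu)(qx - tu)/((1 -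
txu)(qx - u)), with x = x_i. Subtracting 1 leaves the numerator (1 - t)(1 - qx²)u, whose factor 1 -
qx² cancels one in the denominator of `macCoeff`. -/
theorem genSeries_update_mul {q : ℂ} (hq : ∀ k, qShift q q k ≠ 0) (hq0 : q ≠ 0) (t : ℂ) {n : ℕ}
    {x : Fin n → ℂ} (hx : ∀ i, x i ≠ 0) (i : Fin n) :
    (genSeries q t (Function.update x i (q * x i)) - genSeries q t x) *
        ((1 - C (t * x i) * X) * (C (q * x i) - X)) =
      C ((1 - t) * (1 - q * x i ^ 2)) * X * genSeries q t x := by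
  have e : ∀ y, genSeries q t (Function.update x i y) =
      gSeries q t y * gSeries q t y⁻¹ * ∏ j ∈ univ.erase i, gSeries q t (x j) * gSeries q t (x j)⁻¹ := by
    intro y
    rw [genSeries, ← mul_prod_erase univ _ (mem_univ i), Function.update_self]
    congr 1
    refine prod_congr rfl fun j hj => ?_
    rw [Function.update_of_ne (ne_of_mem_erase hj)]
  have e' := e (x i)
  rw [Function.update_eq_self] at e'
  rw [e, e']
  have h1 := gSeries_mul hq t (x i)
  have h2 := gSeries_mul hq t (q * x i)⁻¹
  have h3 : q * (q * x i)⁻¹ = (x i)⁻¹ := by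
    have := hx i
    field_simp
  rw [h3] at h2
  have h4 : gSeries q t (x i)⁻¹ * (C (q * x i) - C t * X) =
      gSeries q t (q * x i)⁻¹ * (C (q * x i) - X) := by
    have h5 : C (q * x i) * C (q * x i)⁻¹ = (1 : PowerSeries ℂ) := by
      rw [← C.map_mul, mul_inv_cancel₀ (mul_ne_zero hq0 (hx i)), C.map_one]
    rw [C.map_mul t] at h2
    linear_combination C (q * x i) * h2 + (gSeries q t (x i)⁻¹ * C t * X -
      gSeries q t (q * x i)⁻¹ * X) * h5
  simp only [map_mul, map_sub, map_one, map_pow] at h1 h4 ⊢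
  generalize ∏ j ∈ univ.erase i, gSeries q t (x j) * gSeries q t (x j)⁻¹ = P
  linear_combination (P * gSeries q t (q * x i)⁻¹ * (C q * C (x i) - X)) * h1 -
    (P * gSeries q t (x i) * (1 - C (x i) * X)) * h4

/-- F does not change under x_i ↦ x_i⁻¹, so this is the forward shift at the point with x_i
inverted. -/
theorem genSeries_update_inv_mul {q : ℂ} (hq : ∀ k, qShift q q k ≠ 0) (hq0 : q ≠ 0) (t : ℂ) {n : ℕ}
    {x : Fin n → ℂ} (hx : ∀ i, x i ≠ 0) (i : Fin n) :
    (genSeries q t (Function.update x i (q⁻¹ * x i)) - genSeries q t x) *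
        ((1 - C (t * (x i)⁻¹) * X) * (C (q * (x i)⁻¹) - X)) =
      C ((1 - t) * (1 - q * (x i)⁻¹ ^ 2)) * X * genSeries q t x := by
  have hinv : ∀ (x : Fin n → ℂ) (i : Fin n) (y : ℂ),
      genSeries q t (Function.update x i y⁻¹) =
        genSeries q t (Function.update (Function.update x i (x i)⁻¹) i y) := by
    intro x i y
    simp only [genSeries]
    refine prod_congr rfl fun j _ => ?_
    rcases eq_or_ne j i with rfl | h
    · simp [mul_comm]
    · simp [h]
  have h := genSeries_update_mul hq hq0 t (x := Function.update x i (x i)⁻¹) (fun j => by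
    rcases eq_or_ne j i with rfl | h
    · simpa using hx j
    · simpa [h] using hx j) i
  have hself : genSeries q t (Function.update x i (x i)⁻¹) = genSeries q t x := by
    rw [hinv, Function.update_idem, Function.update_eq_self]
  rw [Function.update_self, ← hinv, hself, mul_inv_rev, inv_inv, mul_comm (x i)] at h
  exact h

/-- The coefficient of the shift attached to `y`, which is `x_i` or its inverse, in the
`q`-difference operator of type `C_n` with `T = t² / q`. -/
def macCoeff {n : ℕ} (q t : ℂ) (x : Fin n → ℂ) (i : Fin n) (y : ℂ) : ℂ :=
  (1 - t ^ 2 / q * y ^ 2) * (1 - q * (t ^ 2 / q) * y ^ 2) /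
      (t ^ 2 / q * t ^ (n - 1) * (1 - y ^ 2) * (1 - q * y ^ 2)) *
    (pairProd x (univ.erase i) (t * y) / pairProd x (univ.erase i) y)

/-- The `q`-difference operator of type `C_n` with `T = t² / q`. -/
def macOp {n : ℕ} (q t : ℂ) (f : (Fin n → ℂ) → ℂ) (x : Fin n → ℂ) : ℂ :=
  ∑ i, (macCoeff q t x i (x i) * (f (Function.update x i (q * x i)) - f x) +
    macCoeff q t x i (x i)⁻¹ * (f (Function.update x i (q⁻¹ * x i)) - f x))

/-- The result of applying the `q`-difference operator to the generating function. -/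
def macSeries {n : ℕ} (q t : ℂ) (x : Fin n → ℂ) : PowerSeries ℂ :=
  ∑ i, (C (macCoeff q t x i (x i)) *
      (genSeries q t (Function.update x i (q * x i)) - genSeries q t x) +
    C (macCoeff q t x i (x i)⁻¹) *
      (genSeries q t (Function.update x i (q⁻¹ * x i)) - genSeries q t x))

theorem coeff_macSeries {n : ℕ} (q t : ℂ) (x : Fin n → ℂ) (R : ℕ) :
    coeff R (macSeries q t x) = macOp q t (fun x => coeff R (genSeries q t x)) x := by
  simp [macSeries, macOp, coeff_C_mul]

theorem map_pairProd {K L : Type*} [Field K] [Field L] (j : K →+* L) {n : ℕ} (x : Fin n → K)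
    (S : Finset (Fin n)) (w : K) : j (pairProd x S w) = pairProd (fun i => j (x i)) S (j w) := by
  simp [pairProd]

theorem pairProd_inv {K : Type*} [Field K] {n : ℕ} {x : Fin n → K} (hx : ∀ i, x i ≠ 0) {w : K}
    (hw : w ≠ 0) : pairProd x univ w⁻¹ = pairProd x univ w / w ^ (2 * n) := by
  rw [eq_div_iff (pow_ne_zero _ hw), pow_mul, pairProd, pairProd]
  have : (w ^ 2) ^ n = ∏ _j : Fin n, w ^ 2 := by simp
  rw [this, ← prod_mul_distrib]
  refine prod_congr rfl fun j _ => ?_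
  have := hx j
  field_simp
  ring

/-- The embedding of the constants into the fraction field of the power series. -/
def constHom : ℂ →+* FractionRing (PowerSeries ℂ) :=
  (algebraMap (PowerSeries ℂ) (FractionRing (PowerSeries ℂ))).comp C

theorem algebraMap_ne_zero_of_constantCoeff {p : PowerSeries ℂ} (h : constantCoeff p ≠ 0) :
    algebraMap (PowerSeries ℂ) (FractionRing (PowerSeries ℂ)) p ≠ 0 := by
  rw [Ne, FaithfulSMul.algebraMap_eq_zero_iff]
  rintro rfl
  simp at h

theorem algebraMap_pairSeries {n : ℕ} (x : Fin n → ℂ) (c : ℂ) :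
    algebraMap (PowerSeries ℂ) (FractionRing (PowerSeries ℂ)) (pairSeries x c) =
      pairProd (fun i => constHom (x i)) univ
        (constHom c * algebraMap (PowerSeries ℂ) (FractionRing (PowerSeries ℂ)) X) := by
  simp only [pairSeries, pairProd, map_prod, map_mul, map_sub, map_one]
  refine prod_congr rfl fun j _ => ?_
  have hC : ∀ a, algebraMap (PowerSeries ℂ) (FractionRing (PowerSeries ℂ)) (C a) = constHom a :=
    fun a => rfl
  simp only [hC, map_inv₀]
  ring

/-- The fraction field makes u invertible, so that the interpolation nodes 1/(tu) and u/q become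
available. -/
theorem algebraMap_macTerm {q t : ℂ} (hq0 : q ≠ 0) (ht0 : t ≠ 0) {n : ℕ} (x : Fin n → ℂ)
    (i : Fin n) {y : ℂ} (hy0 : y ≠ 0) (hy : 1 - q * y ^ 2 ≠ 0) {F G : PowerSeries ℂ}
    (h : (G - F) * ((1 - C (t * y) * X) * (C (q * y) - X)) =
      C ((1 - t) * (1 - q * y ^ 2)) * X * F) :
    algebraMap (PowerSeries ℂ) (FractionRing (PowerSeries ℂ)) (C (macCoeff q t x i y) * (G - F)) =
      kernelTerm (constHom q) (constHom t) (constHom (t ^ 2 / q))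
        (algebraMap (PowerSeries ℂ) (FractionRing (PowerSeries ℂ)) X)
        (fun i => constHom (x i)) i (constHom y) *
        (algebraMap (PowerSeries ℂ) (FractionRing (PowerSeries ℂ)) F /
          constHom (t ^ 2 / q * t ^ (n - 1))) := by
  have h' := congrArg (algebraMap (PowerSeries ℂ) (FractionRing (PowerSeries ℂ))) h
  have d1 := algebraMap_ne_zero_of_constantCoeff (p := 1 - C (t * y) * X) (by simp)
  have d2 := algebraMap_ne_zero_of_constantCoeff (p := C (q * y) - X) (by simp [hq0, hy0])
  have d3 : constHom (1 - q * y ^ 2) ≠ 0 := (map_ne_zero constHom).2 hy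
  have d4 : constHom (t ^ 2 / q * t ^ (n - 1)) ≠ 0 := (map_ne_zero constHom).2 (by positivity)
  have hC : ∀ a, algebraMap (PowerSeries ℂ) (FractionRing (PowerSeries ℂ)) (C a) = constHom a :=
    fun a => rfl
  simp only [map_mul (algebraMap (PowerSeries ℂ) (FractionRing (PowerSeries ℂ))),
    map_sub (algebraMap (PowerSeries ℂ) (FractionRing (PowerSeries ℂ))), map_one, hC] at h' d1 d2 ⊢
  rw [← eq_div_iff (mul_ne_zero d1 d2)] at h'
  rw [h', macCoeff, kernelTerm]
  simp only [map_mul, map_div₀, map_sub, map_one, map_pow, map_pairProd] at d1 d2 d3 d4 ⊢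
  generalize algebraMap (PowerSeries ℂ) (FractionRing (PowerSeries ℂ)) X = u at *
  generalize algebraMap (PowerSeries ℂ) (FractionRing (PowerSeries ℂ)) F = f at *
  generalize pairProd (fun i => constHom (x i)) (univ.erase i) (constHom t * constHom y) = N at *
  generalize pairProd (fun i => constHom (x i)) (univ.erase i) (constHom y) = D at *
  have e : 1 - constHom t * u * constHom y = 1 - constHom t * constHom y * u := by ring
  rw [e]
  have d5 := left_ne_zero_of_mul d4
  have d6 := right_ne_zero_of_mul d4
  generalize constHom t ^ (n - 1) = z at *
  generalize constHom t ^ 2 / constHom q = T at *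
  generalize constHom q * constHom y - u = a at *
  generalize 1 - constHom t * constHom y * u = b at *
  generalize 1 - constHom q * constHom y ^ 2 = c at *
  field_simp

end KernelIdentity

/-! ### The q-difference equation in the auxiliary variable -/

section KernelEquation

open PowerSeries

/-- The common denominator of the `q`-difference equation satisfied by the generating function. -/
def eqnDen (q t : ℂ) : PowerSeries ℂ :=
  (1 - C t * X ^ 2) * (C q - C t * X ^ 2) * (C q ^ 2 - C t * X ^ 2)

/-- The coefficient of the forward shift; `z` stands for `t ^ n`. -/
def eqnForward (q t z : ℂ) : PowerSeries ℂ :=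
  C (t * z) * (1 - C q * X ^ 2) * (1 - X ^ 2) * (C q ^ 2 - C t * X ^ 2)

/-- The coefficient of the backward shift. -/
def eqnBackward (q t z : ℂ) : PowerSeries ℂ :=
  C (t * z * q)⁻¹ * (C q ^ 3 - C t ^ 2 * X ^ 2) * (C q ^ 2 - C t ^ 2 * X ^ 2) * (1 - C t * X ^ 2)

/-- The coefficient of the unshifted term. -/
def eqnConst (q t z : ℂ) : PowerSeries ℂ :=
  C ((1 - z) * (t / q - q / (t * z))) * eqnDen q t - C z⁻¹ * eqnForward q t z -
    C z * eqnBackward q t z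

theorem letterPoint_injective {n : ℕ} {q : ℂ} {x : Fin n → ℂ} (hx : IsRegularPoint q x) :
    Function.Injective (letterPoint x) := by
  have h1 : ∀ i j, x i ≠ (x j)⁻¹ := by
    intro i j h
    have h := congrArg (· * x j) h
    simp only [inv_mul_cancel₀ (hx.1 j).1] at h
    rcases eq_or_ne i j with rfl | hij
    · exact (hx.1 i).2.1 (by rw [sq, h])
    · exact (hx.2 i j hij).2 h
  refine Function.Injective.sumElim ?_ ?_ h1
  · intro i j h
    by_contra hij
    exact (hx.2 i j hij).1 h
  · intro i j h
    by_contra hij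
    exact (hx.2 i j hij).1 (inv_injective h)

/-- The kernel function identity in rational form. -/
theorem kernel_rational {K : Type*} [Field K] {n : ℕ} (hn : 1 ≤ n) {x : Fin n → K}
    (hx : ∀ i, x i ≠ 0) {q t u f g h S : K} (hq : q ≠ 0) (ht : t ≠ 0) (hu : u ≠ 0)
    (hinj : Function.Injective (letterPoint x))
    (h₁ : ∀ k, 1 - t * u * letterPoint x k ≠ 0) (h₂ : ∀ k, q * letterPoint x k - u ≠ 0)
    (d₁ : 1 - t * u ^ 2 ≠ 0) (d₂ : q - t * u ^ 2 ≠ 0) (d₃ : q ^ 2 - t * u ^ 2 ≠ 0)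
    (hg : pairProd x univ (t * u) * g = pairProd x univ u * f)
    (hh : pairProd x univ (t / q * u) * f = pairProd x univ (q⁻¹ * u) * h)
    (hS : S = (∑ i, (kernelTerm q t (t ^ 2 / q) u x i (x i) +
      kernelTerm q t (t ^ 2 / q) u x i (x i)⁻¹)) * (f / (t ^ 2 / q * t ^ (n - 1)))) :
    (1 - t * u ^ 2) * (q - t * u ^ 2) * (q ^ 2 - t * u ^ 2) * S =
      t * t ^ n * (1 - q * u ^ 2) * (1 - u ^ 2) * (q ^ 2 - t * u ^ 2) * (g - (t ^ n)⁻¹ * f) +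
      (t * t ^ n * q)⁻¹ * (q ^ 3 - t ^ 2 * u ^ 2) * (q ^ 2 - t ^ 2 * u ^ 2) * (1 - t * u ^ 2) *
        (h - t ^ n * f) +
      (1 - t ^ n) * (t / q - q / (t * t ^ n)) *
        ((1 - t * u ^ 2) * (q - t * u ^ 2) * (q ^ 2 - t * u ^ 2)) * f := by
  have htu : t * u ≠ 0 := mul_ne_zero ht hu
  have hw₁ : ∀ k, letterPoint x k ≠ (t * u)⁻¹ := by
    intro k hk
    apply h₁ k
    rw [hk, mul_inv_cancel₀ htu, sub_self]
  have hw₂ : ∀ k, letterPoint x k ≠ u / q := by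
    intro k hk
    apply h₂ k
    rw [hk, mul_div_cancel₀ _ hq, sub_self]
  have hP : ∀ w, (∀ k, letterPoint x k ≠ w) → pairProd x univ w ≠ 0 := by
    intro w hw
    rw [← prod_sub_letterPoint hx, prod_ne_zero_iff]
    exact fun k _ => sub_ne_zero.2 (hw k).symm
  have hP₁ := hP _ hw₁
  have hP₂ := hP _ hw₂
  -- The conditions w₁ ≠ w₂, 1 - tw₁² ≠ 0 and 1 - tw₂² ≠ 0 amount to `d₂`, `d₁` and `d₃`
  -- respectively.
  have hsum := sum_kernelTerm hn hx (t ^ 2 / q) hq ht hu hinj rfl rfl hw₁ hw₂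
    (fun h => d₂ (by
      field_simp at h
      linear_combination h))
    (fun h => d₁ (by
      have e : t * (t * u)⁻¹ ^ 2 * (t * u ^ 2) = 1 := by field_simp
      linear_combination (-(t * u ^ 2)) * h - e))
    (fun h => d₃ (by
      have e : q ^ 2 - t * u ^ 2 = q ^ 2 * (1 - t * (u / q) ^ 2) := by field_simp
      rw [e, h, mul_zero]))
  rw [pairProd_inv hx htu] at hP₁
  have hP₁' : pairProd x univ (t * u) ≠ 0 := fun h => hP₁ (by rw [h, zero_div])
  have e₁ : t * (t * u)⁻¹ = u⁻¹ := by field_simp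
  have e₂ : t * (u / q) = t / q * u := by ring
  have e₃ : q⁻¹ * u = u / q := by ring
  rw [e₁, e₂, pairProd_inv hx htu, pairProd_inv hx hu] at hsum
  rw [e₃] at hh
  -- Thus the ratio at the node 1/(tu) is t^(2n) F(qu)/F(u), while at u/q it is F(u/q)/F(u)
  -- directly.
  have e₄ : pairProd x univ u / u ^ (2 * n) / (pairProd x univ (t * u) / (t * u) ^ (2 * n)) =
      t ^ (2 * n) * (pairProd x univ u / pairProd x univ (t * u)) := by
    rw [mul_pow]
    field_simp
  have hA₁ : (1 - t ^ 2 / q * (t * u)⁻¹ ^ 2) * (1 - q * (t ^ 2 / q) * (t * u)⁻¹ ^ 2) /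
      ((1 - t * (t * u)⁻¹ ^ 2) * ((t * u)⁻¹ * ((t * u)⁻¹ - u / q))) =
      -(t ^ 3 * (1 - q * u ^ 2) * (1 - u ^ 2) / ((1 - t * u ^ 2) * (q - t * u ^ 2))) := by
    have i₁ : 1 - t * (t * u)⁻¹ ^ 2 = -(1 - t * u ^ 2) / (t * u ^ 2) := by
      field_simp
      ring
    have i₂ : (t * u)⁻¹ * ((t * u)⁻¹ - u / q) = (q - t * u ^ 2) / (t ^ 2 * u ^ 2 * q) := by
      field_simp
    rw [i₁, i₂]
    field_simp
    ring
  have hA₂ : (1 - t ^ 2 / q * (u / q) ^ 2) * (1 - q * (t ^ 2 / q) * (u / q) ^ 2) /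
      ((1 - t * (u / q) ^ 2) * (u / q * (u / q - (t * u)⁻¹))) =
      -(t * (q ^ 3 - t ^ 2 * u ^ 2) * (q ^ 2 - t ^ 2 * u ^ 2) /
        (q * ((q ^ 2 - t * u ^ 2) * (q - t * u ^ 2)))) := by
    have i₁ : 1 - t * (u / q) ^ 2 = (q ^ 2 - t * u ^ 2) / q ^ 2 := by
      field_simp
    have i₂ : u / q * (u / q - (t * u)⁻¹) = -(q - t * u ^ 2) / (t * q ^ 2) := by
      field_simp
      ring
    rw [i₁, i₂]
    field_simp
  rw [e₄, hA₁, hA₂] at hsum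
  have hg' : g = pairProd x univ u / pairProd x univ (t * u) * f := by
    field_simp
    linear_combination hg
  have hh' : h = pairProd x univ (t / q * u) / pairProd x univ (u / q) * f := by
    rw [div_mul_eq_mul_div, eq_div_iff hP₂]
    linear_combination -hh
  obtain ⟨m, rfl⟩ := Nat.exists_eq_add_of_le' hn
  rw [hg', hh', hS, Nat.add_sub_cancel]
  rw [show 2 * (m + 1) = (m + 1) + (m + 1) by ring, pow_add t (m + 1) (m + 1)] at hsum
  have htm : t ^ m ≠ 0 := pow_ne_zero _ ht
  generalize (∑ i, (kernelTerm q t (t ^ 2 / q) u x i (x i) +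
    kernelTerm q t (t ^ 2 / q) u x i (x i)⁻¹)) = s at *
  generalize pairProd x univ u / pairProd x univ (t * u) = a at *
  generalize pairProd x univ (t / q * u) / pairProd x univ (u / q) = b at *
  rw [pow_succ t m] at hsum ⊢
  generalize t ^ m = z at *
  have hs : s = (t * q * s) / (t * q) := by field_simp
  rw [hs, hsum]
  clear hs hsum hg' hh' hg hh hS
  generalize hv : u ^ 2 = v at *
  generalize g₁ : 1 - t * v = c₁ at *
  generalize g₂ : q - t * v = c₂ at *
  generalize g₃ : q ^ 2 - t * v = c₃ at *
  field_simp
  ring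

/-- The `q`-difference equation satisfied by the generating function. -/
theorem eqnDen_mul_macSeries {q t : ℂ} (hq : ∀ k, qShift q q k ≠ 0) (hq0 : q ≠ 0) (ht0 : t ≠ 0)
    {n : ℕ} (hn : 1 ≤ n) {x : Fin n → ℂ} (hx : IsRegularPoint q x) :
    eqnDen q t * macSeries q t x =
      eqnForward q t (t ^ n) * rescale q (genSeries q t x) +
        eqnBackward q t (t ^ n) * rescale q⁻¹ (genSeries q t x) +
        eqnConst q t (t ^ n) * genSeries q t x := by
  have hx0 : ∀ i, x i ≠ 0 := fun i => (hx.1 i).1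
  apply FaithfulSMul.algebraMap_injective (PowerSeries ℂ) (FractionRing (PowerSeries ℂ))
  have hC : ∀ a, algebraMap (PowerSeries ℂ) (FractionRing (PowerSeries ℂ)) (C a) = constHom a :=
    fun a => rfl
  have hlp : ∀ k, letterPoint (fun i => constHom (x i)) k = constHom (letterPoint x k) := by
    rintro (k | k)
    · rfl
    · exact (map_inv₀ constHom _).symm
  have hlp0 : ∀ k, letterPoint x k ≠ 0 := by
    rintro (k | k)
    · exact hx0 k
    · exact inv_ne_zero (hx0 k)
  -- The conditions `h₁`, `h₂`, `d₁`, `d₂`, `d₃` hold because the power series concerned have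
  -- nonzero constant term.
  have key := kernel_rational hn (x := fun i => constHom (x i))
    (fun i => (map_ne_zero constHom).2 (hx0 i)) (q := constHom q) (t := constHom t)
    (u := algebraMap (PowerSeries ℂ) (FractionRing (PowerSeries ℂ)) X)
    (f := algebraMap (PowerSeries ℂ) (FractionRing (PowerSeries ℂ)) (genSeries q t x))
    (g := algebraMap (PowerSeries ℂ) (FractionRing (PowerSeries ℂ))
      (rescale q (genSeries q t x)))
    (h := algebraMap (PowerSeries ℂ) (FractionRing (PowerSeries ℂ))
      (rescale q⁻¹ (genSeries q t x)))
    (S := algebraMap (PowerSeries ℂ) (FractionRing (PowerSeries ℂ)) (macSeries q t x))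
    ((map_ne_zero constHom).2 hq0) ((map_ne_zero constHom).2 ht0)
    (by simp [X_ne_zero])
    (by
      intro k l hkl
      rw [hlp, hlp] at hkl
      exact letterPoint_injective hx (constHom.injective hkl))
    (fun k => by
      have := algebraMap_ne_zero_of_constantCoeff (p := 1 - C t * X * C (letterPoint x k)) (by simp)
      simpa only [map_sub, map_mul, map_one, hC, hlp] using this)
    (fun k => by
      have := algebraMap_ne_zero_of_constantCoeff (p := C q * C (letterPoint x k) - X)
        (by simp [hq0, hlp0])
      simpa only [map_sub, map_mul, map_one, hC, hlp] using this)
    (by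
      have := algebraMap_ne_zero_of_constantCoeff (p := 1 - C t * X ^ 2) (by simp)
      simpa only [map_sub, map_mul, map_one, map_pow, hC] using this)
    (by
      have := algebraMap_ne_zero_of_constantCoeff (p := C q - C t * X ^ 2) (by simp [hq0])
      simpa only [map_sub, map_mul, map_one, map_pow, hC] using this)
    (by
      have := algebraMap_ne_zero_of_constantCoeff (p := C q ^ 2 - C t * X ^ 2) (by simp [hq0])
      simpa only [map_sub, map_mul, map_one, map_pow, hC] using this)
    (by
      have := congrArg (algebraMap (PowerSeries ℂ) (FractionRing (PowerSeries ℂ)))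
        (rescale_genSeries hq t x)
      rwa [map_mul, map_mul, algebraMap_pairSeries, algebraMap_pairSeries, map_one, one_mul] at this)
    (by
      have := congrArg (algebraMap (PowerSeries ℂ) (FractionRing (PowerSeries ℂ)))
        (rescale_inv_genSeries hq hq0 t x)
      rwa [map_mul, map_mul, algebraMap_pairSeries, algebraMap_pairSeries, map_div₀,
        map_inv₀] at this)
    (by
      rw [macSeries, map_sum, sum_mul]
      refine sum_congr rfl fun i _ => ?_
      rw [map_add, algebraMap_macTerm hq0 ht0 x i (hx0 i) (sub_ne_zero.2 (hx.1 i).2.2.1.symm)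
        (genSeries_update_mul hq hq0 t hx0 i),
        algebraMap_macTerm hq0 ht0 x i (inv_ne_zero (hx0 i)) (by
          have h := (hx.1 i).2.2.2
          have h0 := hx0 i
          intro h'
          apply h
          field_simp at h'
          linear_combination h')
        (genSeries_update_inv_mul hq hq0 t hx0 i), ← add_mul]
      simp only [map_mul, map_div₀, map_pow, map_inv₀])
  have hz : constHom t ^ n ≠ 0 := pow_ne_zero _ ((map_ne_zero constHom).2 ht0)
  simp only [eqnDen, eqnForward, eqnBackward, eqnConst, map_add, map_sub, map_mul, map_one,
    map_pow, hC, map_inv₀, map_div₀] at key ⊢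
  rw [key]
  field_simp
  ring

end KernelEquation

/-! ### Coefficient sequences and the eigenvalue equation -/

section Sequences

open PowerSeries

/-- The coefficients of a power series, extended by zero to negative indices. -/
def zCoeff (F : PowerSeries ℂ) (R : ℤ) : ℂ := if 0 ≤ R then coeff R.toNat F else 0

/-- Multiplication by `a - b X²` on sequences of coefficients. -/
def stepOp (a b : ℂ) : (ℤ → ℂ) →ₗ[ℂ] (ℤ → ℂ) where
  toFun f R := a * f R - b * f (R - 2)
  map_add' f g := by
    funext R
    simp only [Pi.add_apply]
    ring
  map_smul' c f := by
    funext R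
    simp only [Pi.smul_apply, smul_eq_mul, RingHom.id_apply]
    ring

/-- Rescaling of the variable by `c` on sequences of coefficients. -/
def scaleOp (c : ℂ) : (ℤ → ℂ) →ₗ[ℂ] (ℤ → ℂ) where
  toFun f R := c ^ R * f R
  map_add' f g := by
    funext R
    simp only [Pi.add_apply]
    ring
  map_smul' c f := by
    funext R
    simp only [Pi.smul_apply, smul_eq_mul, RingHom.id_apply]
    ring

theorem stepOp_apply (a b : ℂ) (f : ℤ → ℂ) (R : ℤ) :
    stepOp a b f R = a * f R - b * f (R - 2) := rfl

theorem scaleOp_apply (c : ℂ) (f : ℤ → ℂ) (R : ℤ) : scaleOp c f R = c ^ R * f R := rfl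

theorem zCoeff_C_mul (a : ℂ) (F : PowerSeries ℂ) : zCoeff (C a * F) = a • zCoeff F := by
  funext R
  simp only [zCoeff, Pi.smul_apply, smul_eq_mul, coeff_C_mul]
  split_ifs <;> simp

theorem zCoeff_add (F G : PowerSeries ℂ) : zCoeff (F + G) = zCoeff F + zCoeff G := by
  funext R
  simp only [zCoeff, Pi.add_apply, map_add]
  split_ifs <;> simp

theorem zCoeff_sub (F G : PowerSeries ℂ) : zCoeff (F - G) = zCoeff F - zCoeff G := by
  funext R
  simp only [zCoeff, Pi.sub_apply, map_sub]
  split_ifs <;> simp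

theorem zCoeff_step (a b : ℂ) (F : PowerSeries ℂ) :
    zCoeff ((C a - C b * X ^ 2) * F) = stepOp a b (zCoeff F) := by
  funext R
  rw [stepOp_apply, sub_mul, mul_assoc, zCoeff_sub, zCoeff_C_mul, zCoeff_C_mul, Pi.sub_apply,
    Pi.smul_apply, Pi.smul_apply, smul_eq_mul, smul_eq_mul]
  congr 2
  simp only [zCoeff, coeff_X_pow_mul']
  rcases lt_or_ge R 2 with h | h
  · rw [if_neg (show ¬ (0 ≤ R - 2) by omega)]
    split_ifs with h1 h2
    · omega
    · rfl
    · rfl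
  · rw [if_pos (by omega), if_pos (by omega), if_pos (by omega)]
    congr 2
    omega

theorem zCoeff_rescale (c : ℂ) (F : PowerSeries ℂ) :
    zCoeff (rescale c F) = scaleOp c (zCoeff F) := by
  funext R
  rw [scaleOp_apply, zCoeff, zCoeff]
  split_ifs with h
  · lift R to ℕ using h
    simp [coeff_rescale]
  · rw [mul_zero]

/-- The action of `eqnDen` on sequences of coefficients. -/
def denOp (q t : ℂ) : (ℤ → ℂ) →ₗ[ℂ] (ℤ → ℂ) :=
  stepOp 1 t ∘ₗ stepOp q t ∘ₗ stepOp (q ^ 2) t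

/-- The action of `eqnForward` on sequences of coefficients. -/
def fwdOp (q t z : ℂ) : (ℤ → ℂ) →ₗ[ℂ] (ℤ → ℂ) :=
  (t * z) • stepOp 1 q ∘ₗ stepOp 1 1 ∘ₗ stepOp (q ^ 2) t

/-- The action of `eqnBackward` on sequences of coefficients. -/
def bwdOp (q t z : ℂ) : (ℤ → ℂ) →ₗ[ℂ] (ℤ → ℂ) :=
  (t * z * q)⁻¹ • stepOp (q ^ 3) (t ^ 2) ∘ₗ stepOp (q ^ 2) (t ^ 2) ∘ₗ stepOp 1 t

/-- The right-hand side of the `q`-difference equation on sequences of coefficients. -/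
def rhsOp (q t z : ℂ) : (ℤ → ℂ) →ₗ[ℂ] (ℤ → ℂ) :=
  fwdOp q t z ∘ₗ scaleOp q + bwdOp q t z ∘ₗ scaleOp q⁻¹ +
    (((1 - z) * (t / q - q / (t * z))) • denOp q t - z⁻¹ • fwdOp q t z - z • bwdOp q t z)

theorem denOp_zCoeff_macSeries {q t : ℂ} (hq : ∀ k, qShift q q k ≠ 0) (hq0 : q ≠ 0) (ht0 : t ≠ 0)
    {n : ℕ} (hn : 1 ≤ n) {x : Fin n → ℂ} (hx : IsRegularPoint q x) :
    denOp q t (zCoeff (macSeries q t x)) = rhsOp q t (t ^ n) (zCoeff (genSeries q t x)) := by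
  have h := congrArg zCoeff (eqnDen_mul_macSeries hq hq0 ht0 hn hx)
  have hd : ∀ F, zCoeff (eqnDen q t * F) = denOp q t (zCoeff F) := by
    intro F
    simp only [denOp, LinearMap.comp_apply, ← zCoeff_step, eqnDen, map_pow, map_one, mul_assoc]
  have hf : ∀ F, zCoeff (eqnForward q t (t ^ n) * F) = fwdOp q t (t ^ n) (zCoeff F) := by
    intro F
    simp only [fwdOp, LinearMap.smul_apply, LinearMap.comp_apply, ← zCoeff_step, ← zCoeff_C_mul,
      eqnForward, map_pow, map_one, mul_assoc, one_mul]
  have hb : ∀ F, zCoeff (eqnBackward q t (t ^ n) * F) = bwdOp q t (t ^ n) (zCoeff F) := by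
    intro F
    simp only [bwdOp, LinearMap.smul_apply, LinearMap.comp_apply, ← zCoeff_step, ← zCoeff_C_mul,
      eqnBackward, map_pow, map_one, mul_assoc]
  rw [hd, zCoeff_add, zCoeff_add, hf, hb, zCoeff_rescale, zCoeff_rescale] at h
  rw [h, rhsOp, eqnConst, sub_mul, sub_mul, mul_assoc, mul_assoc, mul_assoc, zCoeff_sub, zCoeff_sub,
    zCoeff_C_mul, zCoeff_C_mul, zCoeff_C_mul, hd, hf, hb]
  rfl

theorem denOp_apply (q t : ℂ) (f : ℤ → ℂ) (R : ℤ) :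
    denOp q t f R = q ^ 3 * f R - (q ^ 2 * t + q * t + q ^ 3 * t) * f (R - 2) +
      (q ^ 2 * t ^ 2 + q * t ^ 2 + t ^ 2) * f (R - 4) - t ^ 3 * f (R - 6) := by
  simp only [denOp, LinearMap.comp_apply, stepOp_apply, sub_sub]
  norm_num
  ring

/-- The value at R enters `denOp` with coefficient q³ ≠ 0 and all other values have smaller index,
so the sequence vanishes recursively. -/
theorem eq_zero_of_denOp {q t : ℂ} (hq0 : q ≠ 0) {f : ℤ → ℂ} {r : ℕ} (hneg : ∀ R < 0, f R = 0)
    (h : ∀ R ≤ (r : ℤ), denOp q t f R = 0) (R : ℕ) (hR : R ≤ r) : f R = 0 := by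
  induction R using Nat.strong_induction_on with
  | _ R ih =>
    have h1 : ∀ k : ℤ, 0 < k → f ((R : ℤ) - k) = 0 := by
      intro k hk
      rcases lt_or_ge ((R : ℤ) - k) 0 with h2 | h2
      · exact hneg _ h2
      · obtain ⟨m, hm⟩ := Int.eq_ofNat_of_zero_le h2
        rw [hm]
        exact ih m (by omega) (by omega)
    have h2 := h R (by exact_mod_cast hR)
    rw [denOp_apply, h1 2 (by norm_num), h1 4 (by norm_num), h1 6 (by norm_num)] at h2
    have h3 : q ^ 3 ≠ 0 := pow_ne_zero 3 hq0
    simpa [h3] using h2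

/-- Only the positions R, R - 2, R - 4 and R - 6 enter, which is why information truncated at degree
r is enough. -/
theorem op_congr {q t z : ℂ} {f g : ℤ → ℂ} {R : ℤ} (h : ∀ m ≤ R, f m = g m) :
    rhsOp q t z f R = rhsOp q t z g R := by
  simp only [rhsOp, fwdOp, bwdOp, denOp, LinearMap.add_apply, LinearMap.sub_apply,
    LinearMap.smul_apply, LinearMap.comp_apply, Pi.add_apply, Pi.sub_apply, Pi.smul_apply,
    stepOp_apply, scaleOp_apply, sub_sub]
  rw [h R le_rfl, h (R - 2) (by omega), h (R - (2 + 2)) (by omega), h (R - (2 + 2 + 2)) (by omega)]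

theorem denOp_congr {q t : ℂ} {f g : ℤ → ℂ} {R : ℤ} (h : ∀ m ≤ R, f m = g m) :
    denOp q t f R = denOp q t g R := by
  rw [denOp_apply, denOp_apply, h R le_rfl, h (R - 2) (by omega), h (R - 4) (by omega),
    h (R - 6) (by omega)]

/-- The coefficients `phiCoeff`, extended by zero to negative indices. -/
def phiInt (q t Z : ℂ) (i : ℤ) : ℂ := if 0 ≤ i then phiCoeff q t Z i.toNat else 0

theorem phiCoeff_succ (q t Z : ℂ) (k : ℕ) :
    phiCoeff q t Z (k + 1) = phiCoeff q t Z k * ((1 - q ^ k * (q / t)) * (1 - q ^ k * Z) /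
      ((1 - q ^ k * q) * (1 - q ^ k * (Z * t))) * (t ^ 2 / q)) := by
  simp only [phiCoeff, qShift_succ, pow_succ, div_eq_mul_inv, mul_inv]
  ring

/-- The ratio of consecutive coefficients in multiplied-out form. It persists for i ≤ 0, since 1 -
q^0 = 0 and the coefficients of negative index are zero; boundary terms then need no separate
treatment. -/
theorem phiInt_rec {q t Z : ℂ} (hq : ∀ k, qShift q q k ≠ 0) (i : ℤ)
    (h : ∀ k : ℕ, (k : ℤ) < i → q ^ k * (Z * t) ≠ 1) :
    phiInt q t Z i * ((1 - q ^ i) * (1 - Z * t * q ^ (i - 1))) =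
      phiInt q t Z (i - 1) * ((1 - q ^ i / t) * (1 - Z * q ^ (i - 1)) * (t ^ 2 / q)) := by
  rcases lt_or_ge i 0 with hi | hi
  · rw [phiInt, phiInt, if_neg hi.not_ge, if_neg (by omega)]
    simp
  · obtain ⟨k, rfl⟩ := Int.eq_ofNat_of_zero_le hi
    rcases k with - | k
    · simp [phiInt]
    · have e1 : ((k + 1 : ℕ) : ℤ) - 1 = (k : ℤ) := by push_cast; ring
      have e2 (j : ℕ) : phiInt q t Z (j : ℤ) = phiCoeff q t Z j := by
        rw [phiInt, if_pos (Int.natCast_nonneg j), Int.toNat_natCast]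
      rw [e1, e2, e2, zpow_natCast, zpow_natCast, phiCoeff_succ]
      have h1 := hq (k + 1)
      rw [qShift_succ] at h1
      have h3 := right_ne_zero_of_mul h1
      have h4 := sub_ne_zero.2 (h k (by push_cast; omega)).symm
      have e4 : 1 - Z * t * q ^ k = 1 - q ^ k * (Z * t) := by ring
      rw [e4, pow_succ q k]
      generalize 1 - q ^ k * (Z * t) = D at *
      generalize 1 - q ^ k * q = E at *
      field_simp

/-- The eigenvalue of the `q`-difference operator on the tableau sum of degree `s`; `z` stands
for `t ^ n`. -/
def rowEigenvalue (q t z : ℂ) (s : ℕ) : ℂ :=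
  z * t / q * (q ^ s - 1) + q / (z * t) * ((q ^ s)⁻¹ - 1)

/-- Here Q = q^i, S = q^s and F_j = φ_{i-j}(zS). The four-term eigenvalue equation is a combination
of three consecutive two-term recurrences for φ. -/
theorem four_term {q t z Q S F₀ F₁ F₂ F₃ : ℂ} (hq0 : q ≠ 0) (ht0 : t ≠ 0) (hz0 : z ≠ 0)
    (hQ : Q ≠ 0) (hS : S ≠ 0)
    (h₀ : F₀ * ((1 - Q) * (1 - z * S * t * (Q / q))) =
      F₁ * ((1 - Q / t) * (1 - z * S * (Q / q)) * (t ^ 2 / q)))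
    (h₁ : F₁ * ((1 - Q / q) * (1 - z * S * t * (Q / q ^ 2))) =
      F₂ * ((1 - Q / q / t) * (1 - z * S * (Q / q ^ 2)) * (t ^ 2 / q)))
    (h₂ : F₂ * ((1 - Q / q ^ 2) * (1 - z * S * t * (Q / q ^ 3))) =
      F₃ * ((1 - Q / q ^ 2 / t) * (1 - z * S * (Q / q ^ 3)) * (t ^ 2 / q)))
    {f : ℤ → ℂ} {R : ℤ} (hR : q ^ R = S * Q ^ 2) (e₀ : f R = F₀) (e₁ : f (R - 2) = F₁)
    (e₂ : f (R - 4) = F₂) (e₃ : f (R - 6) = F₃) :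
    rhsOp q t z f R =
      (z * t / q * (S - 1) + q / (z * t) * (S⁻¹ - 1)) * denOp q t f R := by
  have r₁ : q ^ (R - 2) = S * Q ^ 2 / q ^ 2 := by rw [zpow_sub₀ hq0, hR]; norm_cast
  have r₂ : q ^ (R - 4) = S * Q ^ 2 / q ^ 4 := by rw [zpow_sub₀ hq0, hR]; norm_cast
  have r₃ : q ^ (R - 6) = S * Q ^ 2 / q ^ 6 := by rw [zpow_sub₀ hq0, hR]; norm_cast
  -- The multipliers are forced: `F₀` and `F₃` each occur in a single recurrence, and `F₁` then
  -- fixes the middle one.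
  have h : rhsOp q t z f R -
      (z * t / q * (S - 1) + q / (z * t) * (S⁻¹ - 1)) * denOp q t f R =
      q ^ 3 / (Q ^ 2 * S * z * t) * (q + Q * q + Q * S * z * t + Q ^ 2 * S * z * t) *
        (F₀ * ((1 - Q) * (1 - z * S * t * (Q / q))) -
          F₁ * ((1 - Q / t) * (1 - z * S * (Q / q)) * (t ^ 2 / q))) -
      q / (Q ^ 2 * S * z) * (q ^ 5 + t * q ^ 3 + Q * q ^ 2 + Q * q ^ 4 + Q * S * z * t * q +
          Q * S * z * t * q ^ 3 + Q ^ 2 * S * z * q ^ 2 + Q ^ 2 * S * z * t) *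
        (F₁ * ((1 - Q / q) * (1 - z * S * t * (Q / q ^ 2))) -
          F₂ * ((1 - Q / q / t) * (1 - z * S * (Q / q ^ 2)) * (t ^ 2 / q))) +
      t * q / (Q ^ 2 * S * z) * (t * q ^ 5 + Q * q ^ 3 + Q * S * z * t * q ^ 2 + Q ^ 2 * S * z) *
        (F₂ * ((1 - Q / q ^ 2) * (1 - z * S * t * (Q / q ^ 3))) -
          F₃ * ((1 - Q / q ^ 2 / t) * (1 - z * S * (Q / q ^ 3)) * (t ^ 2 / q))) := by
    simp only [rhsOp, fwdOp, bwdOp, denOp, LinearMap.add_apply, LinearMap.sub_apply,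
      LinearMap.smul_apply, LinearMap.comp_apply, Pi.add_apply, Pi.sub_apply, Pi.smul_apply,
      stepOp_apply, scaleOp_apply, sub_sub, smul_eq_mul, inv_zpow]
    norm_num only
    rw [e₀, e₁, e₂, e₃, r₁, r₂, r₃, hR]
    field_simp
    ring
  rw [h₀, h₁, h₂, sub_self, sub_self, sub_self, mul_zero, mul_zero, mul_zero] at h
  exact sub_eq_zero.1 (by simpa using h)

/-- The sequence of coefficients of `X ^ s ∑ i, phiCoeff q t (z * q ^ s) i * X ^ (2 * i)`. -/
def levelSeq (q t z : ℂ) (s : ℕ) (R : ℤ) : ℂ :=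
  if (s : ℤ) ≤ R then phiEven q t (z * q ^ s) (R - s).toNat else 0

theorem levelSeq_of_lt (q t z : ℂ) {s : ℕ} {R : ℤ} (h : R < s) : levelSeq q t z s R = 0 :=
  if_neg h.not_ge

theorem levelSeq_even (q t z : ℂ) (s : ℕ) (i : ℤ) :
    levelSeq q t z s (s + 2 * i) = phiInt q t (z * q ^ s) i := by
  rcases lt_or_ge i 0 with hi | hi
  · rw [levelSeq_of_lt _ _ _ (by omega), phiInt, if_neg hi.not_ge]
  · obtain ⟨k, rfl⟩ := Int.eq_ofNat_of_zero_le hi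
    have e : ((s : ℤ) + 2 * (k : ℤ) - s).toNat = 2 * k := by omega
    rw [levelSeq, if_pos (by omega), phiInt, if_pos hi, e, phiEven, if_pos (even_two_mul k),
      Nat.mul_div_cancel_left k two_pos, Int.toNat_natCast]

theorem levelSeq_self (q t z : ℂ) (s : ℕ) : levelSeq q t z s s = 1 := by
  have := levelSeq_even q t z s 0
  rw [mul_zero, add_zero] at this
  rw [this]
  simp [phiInt, phiCoeff, qShift_zero]

theorem levelSeq_odd (q t z : ℂ) (s : ℕ) (i : ℤ) : levelSeq q t z s (s + 2 * i + 1) = 0 := by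
  rcases lt_or_ge i 0 with hi | hi
  · exact levelSeq_of_lt _ _ _ (by omega)
  · obtain ⟨k, rfl⟩ := Int.eq_ofNat_of_zero_le hi
    have e : ((s : ℤ) + 2 * (k : ℤ) + 1 - s).toNat = 2 * k + 1 := by omega
    rw [levelSeq, if_pos (by omega), e, phiEven, if_neg (by simp)]

/-- At positions of the parity of s this is `four_term`; at the others all four values vanish. -/
theorem rhsOp_levelSeq {q t z : ℂ} (hq : ∀ k, qShift q q k ≠ 0) (hq0 : q ≠ 0) (ht0 : t ≠ 0)
    (hz0 : z ≠ 0) {r s : ℕ} (h : ∀ m : ℕ, s + m + 2 ≤ r → q ^ (s + m) * (z * t) ≠ 1) {R : ℤ}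
    (hR : R ≤ r) :
    rhsOp q t z (levelSeq q t z s) R =
      rowEigenvalue q t z s * denOp q t (levelSeq q t z s) R := by
  obtain ⟨i, hi | hi⟩ : ∃ i : ℤ, R = s + 2 * i ∨ R = s + 2 * i + 1 := ⟨(R - s) / 2, by omega⟩
  · subst hi
    have hZ : ∀ j : ℤ, j ≤ i → ∀ k : ℕ, (k : ℤ) < j → q ^ k * (z * q ^ s * t) ≠ 1 := by
      intro j hj k hk h1
      refine h k (by omega) ?_
      rw [← h1, pow_add]
      ring
    have r₀ := phiInt_rec (Z := z * q ^ s) hq i (hZ i le_rfl)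
    have r₁ := phiInt_rec (Z := z * q ^ s) hq (i - 1) (hZ (i - 1) (by omega))
    have r₂ := phiInt_rec (Z := z * q ^ s) hq (i - 2) (hZ (i - 2) (by omega))
    have p₁ : q ^ (i - 1) = q ^ i / q := by rw [zpow_sub₀ hq0, zpow_one]
    have p₂ : q ^ (i - 2) = q ^ i / q ^ 2 := by rw [zpow_sub₀ hq0]; norm_cast
    have p₃ : q ^ (i - 3) = q ^ i / q ^ 3 := by rw [zpow_sub₀ hq0]; norm_cast
    rw [p₁] at r₀
    rw [show i - 1 - 1 = i - 2 by ring, p₁, p₂] at r₁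
    rw [show i - 2 - 1 = i - 3 by ring, p₂, p₃] at r₂
    refine four_term hq0 ht0 hz0 (zpow_ne_zero i hq0) (pow_ne_zero s hq0) r₀ r₁ r₂ ?_
      (levelSeq_even q t z s i) ?_ ?_ ?_
    · rw [zpow_add₀ hq0, zpow_natCast, two_mul, zpow_add₀ hq0, pow_two]
    · rw [show (s : ℤ) + 2 * i - 2 = s + 2 * (i - 1) by ring, levelSeq_even]
    · rw [show (s : ℤ) + 2 * i - 4 = s + 2 * (i - 2) by ring, levelSeq_even]
    · rw [show (s : ℤ) + 2 * i - 6 = s + 2 * (i - 3) by ring, levelSeq_even]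
  · have e₀ : levelSeq q t z s R = 0 := by rw [hi, levelSeq_odd]
    have e₁ : levelSeq q t z s (R - 2) = 0 := by
      rw [hi, show (s : ℤ) + 2 * i + 1 - 2 = s + 2 * (i - 1) + 1 by ring, levelSeq_odd]
    have e₂ : levelSeq q t z s (R - 4) = 0 := by
      rw [hi, show (s : ℤ) + 2 * i + 1 - 4 = s + 2 * (i - 2) + 1 by ring, levelSeq_odd]
    have e₃ : levelSeq q t z s (R - 6) = 0 := by
      rw [hi, show (s : ℤ) + 2 * i + 1 - 6 = s + 2 * (i - 3) + 1 by ring, levelSeq_odd]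
    simp only [rhsOp, fwdOp, bwdOp, denOp, LinearMap.add_apply, LinearMap.sub_apply,
      LinearMap.smul_apply, LinearMap.comp_apply, Pi.add_apply, Pi.sub_apply, Pi.smul_apply,
      stepOp_apply, scaleOp_apply, sub_sub, smul_eq_mul]
    norm_num only
    rw [e₀, e₁, e₂, e₃]
    ring

theorem coeff_genSeries_range {q t : ℂ} (hq : ∀ k, qShift q q k ≠ 0) (hq0 : q ≠ 0) (ht0 : t ≠ 0)
    {n r : ℕ} (h1 : ∀ k m : ℕ, 1 ≤ k → k ≤ n → m < r → q ^ m * t ^ k ≠ 1)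
    (h2 : ∀ k m : ℕ, 2 ≤ k → k ≤ n + 1 → m < r → q ^ m * (t ^ k / q) ≠ 1)
    {x : Fin n → ℂ} (hx : ∀ i, x i ≠ 0) {R : ℕ} (hR : R ≤ r) :
    coeff R (genSeries q t x) =
      ∑ s ∈ range (r + 1), tabFun q t x s * levelSeq q t (t ^ n) s R := by
  rw [coeff_genSeries hq hq0 ht0 x hx R (fun k m a b c => h1 k m a b (c.trans_le hR))
    (fun k m a b c => h2 k m a b (c.trans_le hR)), Finset.Nat.sum_antidiagonal_eq_sum_range_succ_mk]
  refine Finset.sum_subset_zero_on_sdiff (range_mono (by omega)) ?_ ?_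
  · intro s hs
    rw [mem_sdiff, mem_range, mem_range] at hs
    rw [levelSeq_of_lt _ _ _ (by omega), mul_zero]
  · intro s hs
    rw [mem_range] at hs
    rw [levelSeq, if_pos (by omega), mul_comm]
    congr 2
    omega

theorem macOp_sum (q t : ℂ) {n : ℕ} {ι : Type*} (S : Finset ι) (f : ι → (Fin n → ℂ) → ℂ)
    (c : ι → ℂ) (x : Fin n → ℂ) :
    macOp q t (fun y => ∑ s ∈ S, f s y * c s) x = ∑ s ∈ S, macOp q t (f s) x * c s := by
  simp only [macOp, Finset.sum_mul]
  rw [Finset.sum_comm]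
  refine Finset.sum_congr rfl fun i _ => ?_
  simp only [← Finset.sum_sub_distrib, Finset.mul_sum, ← Finset.sum_add_distrib]
  exact Finset.sum_congr rfl fun s _ => by ring

theorem macOp_congr {q t : ℂ} (hq0 : q ≠ 0) {n : ℕ} {f g : (Fin n → ℂ) → ℂ}
    (h : ∀ y : Fin n → ℂ, (∀ i, y i ≠ 0) → f y = g y) {x : Fin n → ℂ} (hx : ∀ i, x i ≠ 0) :
    macOp q t f x = macOp q t g x := by
  have hu : ∀ (i : Fin n) (c : ℂ), c ≠ 0 → ∀ j, Function.update x i (c * x i) j ≠ 0 := by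
    intro i c hc j
    rw [Function.update_apply]
    split_ifs
    · exact mul_ne_zero hc (hx i)
    · exact hx j
  simp only [macOp]
  refine Finset.sum_congr rfl fun i _ => ?_
  rw [h _ (hu i q hq0), h _ (hu i q⁻¹ (inv_ne_zero hq0)), h x hx]

/-- The tableau sums are eigenfunctions of the `q`-difference operator. -/
theorem macOp_tabFun {q t : ℂ} (hq : ∀ k, qShift q q k ≠ 0) (hq0 : q ≠ 0) (ht0 : t ≠ 0)
    {n r : ℕ} (hn : 1 ≤ n) (h1 : ∀ k m : ℕ, 1 ≤ k → k ≤ n → m < r → q ^ m * t ^ k ≠ 1)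
    (h2 : ∀ k m : ℕ, 2 ≤ k → k ≤ n + 1 → m < r → q ^ m * (t ^ k / q) ≠ 1)
    {x : Fin n → ℂ} (hx : IsRegularPoint q x) {s : ℕ} (hs : s ≤ r) :
    macOp q t (fun y => tabFun q t y s) x = rowEigenvalue q t (t ^ n) s * tabFun q t x s := by
  have hx0 : ∀ i, x i ≠ 0 := fun i => (hx.1 i).1
  set c := levelSeq q t (t ^ n) with hc
  set H : ℕ → ℂ := fun s => tabFun q t x s with hH
  set M : ℕ → ℂ := fun s => macOp q t (fun y => tabFun q t y s) x with hM
  set d := rowEigenvalue q t (t ^ n) with hd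
  have hF : ∀ R ≤ (r : ℤ), zCoeff (genSeries q t x) R = (∑ s ∈ range (r + 1), H s • c s) R := by
    intro R hR
    simp only [Finset.sum_apply, Pi.smul_apply, smul_eq_mul]
    rcases lt_or_ge R 0 with h | h
    · rw [zCoeff, if_neg h.not_ge, Finset.sum_eq_zero]
      intro s _
      rw [hc, levelSeq_of_lt _ _ _ (by omega), mul_zero]
    · lift R to ℕ using h
      rw [zCoeff, if_pos (Int.natCast_nonneg R), Int.toNat_natCast,
        coeff_genSeries_range hq hq0 ht0 h1 h2 hx0 (by exact_mod_cast hR)]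
  have hMF : ∀ R ≤ (r : ℤ), zCoeff (macSeries q t x) R = (∑ s ∈ range (r + 1), M s • c s) R := by
    intro R hR
    simp only [Finset.sum_apply, Pi.smul_apply, smul_eq_mul]
    rcases lt_or_ge R 0 with h | h
    · rw [zCoeff, if_neg h.not_ge, Finset.sum_eq_zero]
      intro s _
      rw [hc, levelSeq_of_lt _ _ _ (by omega), mul_zero]
    · lift R to ℕ using h
      rw [zCoeff, if_pos (Int.natCast_nonneg R), Int.toNat_natCast, coeff_macSeries,
        ← macOp_sum q t (range (r + 1)) (fun s y => tabFun q t y s) (fun s => c s R)]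
      exact macOp_congr hq0 (fun y hy =>
        coeff_genSeries_range hq hq0 ht0 h1 h2 hy (by exact_mod_cast hR)) hx0
  have hrec : ∀ s, ∀ R ≤ (r : ℤ), rhsOp q t (t ^ n) (c s) R = d s * denOp q t (c s) R := by
    intro s R hR
    refine rhsOp_levelSeq hq hq0 ht0 (pow_ne_zero n ht0) (fun m hm h => ?_) hR
    refine h2 (n + 1) (s + m + 1) (by omega) le_rfl (by omega) ?_
    rw [← h, pow_succ, pow_succ]
    field_simp
  -- Two evaluations of the operator on F are compared: termwise on the expansion, giving `M s`, and
  -- through the u-equation, giving `d s * H s`.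
  have hzero : ∀ R ≤ (r : ℤ), denOp q t (∑ s ∈ range (r + 1), (M s - d s * H s) • c s) R = 0 := by
    intro R hR
    have e1 : denOp q t (∑ s ∈ range (r + 1), M s • c s) R =
        rhsOp q t (t ^ n) (∑ s ∈ range (r + 1), H s • c s) R := by
      rw [← denOp_congr fun m hm => hMF m (hm.trans hR), ← op_congr fun m hm => hF m (hm.trans hR),
        denOp_zCoeff_macSeries hq hq0 ht0 hn hx]
    simp only [map_sum, map_smul, Finset.sum_apply, Pi.smul_apply, smul_eq_mul] at e1 ⊢
    simp only [sub_mul, Finset.sum_sub_distrib]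
    rw [e1, sub_eq_zero]
    refine Finset.sum_congr rfl fun s _ => ?_
    rw [hrec s R hR]
    ring
  -- Cancelling `denOp` leaves ∑ (M_s - d_s H_s) c_s = 0 up to degree r. As `c s` starts at position
  -- `s` with value 1, the coefficients vanish one after another.
  have hg := fun R hR => eq_zero_of_denOp (r := r) hq0 (fun R hR => ?_) hzero R hR
  · have : ∀ s ≤ r, M s - d s * H s = 0 := by
      intro s
      induction s using Nat.strong_induction_on with
      | _ s ih =>
        intro hs
        have h := hg s hs
        simp only [Finset.sum_apply, Pi.smul_apply, smul_eq_mul] at h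
        rw [Finset.sum_eq_single s] at h
        · rwa [hc, levelSeq_self, mul_one] at h
        · intro s' hs' hne
          rcases lt_or_gt_of_ne hne with hlt | hlt
          · rw [ih s' hlt (by omega), zero_mul]
          · rw [hc, levelSeq_of_lt _ _ _ (by omega), mul_zero]
        · intro h
          exact absurd (mem_range.2 (by omega)) h
    exact sub_eq_zero.1 (this s hs)
  · simp only [Finset.sum_apply, Pi.smul_apply, smul_eq_mul]
    refine Finset.sum_eq_zero fun s _ => ?_
    rw [hc, levelSeq_of_lt _ _ _ (by omega), mul_zero]

end Sequences

/-! ### Laurent polynomials and orbit sums -/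

section Laurent

variable {n : ℕ}

/-- Evaluation of Laurent polynomials at a point, as a linear map. -/
def evalLin (x : Fin n → ℂ) : LaurentPoly n →ₗ[ℂ] ℂ where
  toFun P := P.evalAt x
  map_add' P Q := Finsupp.sum_add_index' (fun _ => zero_mul _) fun _ _ _ => add_mul _ _ _
  map_smul' c P := by
    simp only [LaurentPoly.evalAt, AddMonoidAlgebra.coeff_smul, RingHom.id_apply, smul_eq_mul]
    rw [Finsupp.sum_smul_index (fun _ => zero_mul _), Finsupp.mul_sum]
    exact Finsupp.sum_congr fun _ _ => mul_assoc _ _ _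

theorem evalLin_apply (x : Fin n → ℂ) (P : LaurentPoly n) : evalLin x P = P.evalAt x := rfl

theorem evalAt_single (x : Fin n → ℂ) (ν : Fin n → ℤ) (c : ℂ) :
    LaurentPoly.evalAt (AddMonoidAlgebra.single ν c) x = c * ∏ i, x i ^ ν i :=
  Finsupp.sum_single_index (zero_mul _)

/-- The character `x ↦ ∏ x_i ^ ν_i` of the complex torus. -/
def torusChar (ν : Fin n → ℤ) : (Fin n → ℂˣ) →* ℂ where
  toFun u := ∏ i, (u i : ℂ) ^ ν i
  map_one' := by simp
  map_mul' u v := by simp [mul_zpow, Finset.prod_mul_distrib]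

theorem torusChar_injective : Function.Injective (torusChar (n := n)) := by
  intro ν μ h
  funext i
  have h1 := DFunLike.congr_fun h (Pi.mulSingle i (Units.mk0 (2 : ℂ) two_ne_zero))
  have h2 (κ : Fin n → ℤ) :
      torusChar κ (Pi.mulSingle i (Units.mk0 (2 : ℂ) two_ne_zero)) = (2 : ℂ) ^ κ i := by
    change ∏ j : Fin n, _ = _
    rw [Finset.prod_eq_single i]
    · simp
    · intro j _ hj
      simp [hj]
    · simp
  rw [h2, h2] at h1
  have h3 : (2 : ℝ) ^ ν i = (2 : ℝ) ^ μ i := by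
    have := congrArg norm h1
    simpa [norm_zpow] using this
  exact zpow_right_injective₀ two_pos (by norm_num) h3

/-- Dedekind's independence of characters, applied to the monomials as characters of the torus. -/
theorem eq_zero_of_evalAt {P : LaurentPoly n}
    (h : ∀ x : Fin n → ℂ, (∀ i, x i ≠ 0) → P.evalAt x = 0) : P = 0 := by
  have hli := (linearIndependent_monoidHom (Fin n → ℂˣ) ℂ).comp torusChar torusChar_injective
  rw [linearIndependent_iff] at hli
  rw [← AddMonoidAlgebra.coeff_eq_zero]
  refine hli _ ?_
  funext u
  have h1 := h (fun i => (u i : ℂ)) fun i => (u i).ne_zero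
  rw [LaurentPoly.evalAt] at h1
  rw [Finsupp.linearCombination_apply, Finsupp.sum, Finset.sum_apply, Pi.zero_apply, ← h1]
  rfl

theorem evalAt_injective {P Q : LaurentPoly n}
    (h : ∀ x : Fin n → ℂ, (∀ i, x i ≠ 0) → P.evalAt x = Q.evalAt x) : P = Q := by
  refine sub_eq_zero.1 (eq_zero_of_evalAt fun x hx => ?_)
  rw [← evalLin_apply, map_sub, evalLin_apply, evalLin_apply, h x hx, sub_self]

theorem signedPerm_signedPerm (ε ε' : Fin n → ℤˣ) (σ σ' : Equiv.Perm (Fin n)) (ν : Fin n → ℤ) :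
    signedPerm ε σ (signedPerm ε' σ' ν) =
      signedPerm (fun i => ε i * ε' (σ i)) (σ.trans σ') ν := by
  funext i
  simp only [signedPerm, Units.val_mul, Equiv.trans_apply, mul_assoc]

theorem signedPerm_one (ν : Fin n → ℤ) : signedPerm 1 1 ν = ν := by
  funext i
  simp [signedPerm]

theorem signedPerm_symm (ε : Fin n → ℤˣ) (σ : Equiv.Perm (Fin n)) (ν : Fin n → ℤ) :
    signedPerm (fun i => ε (σ.symm i)) σ.symm (signedPerm ε σ ν) = ν := by
  funext i
  simp [signedPerm, ← mul_assoc, ← Units.val_mul]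

theorem signedPerm_injective (ε : Fin n → ℤˣ) (σ : Equiv.Perm (Fin n)) :
    Function.Injective (signedPerm ε σ) :=
  Function.LeftInverse.injective (signedPerm_symm ε σ)

theorem prod_zpow_signedPerm (ε : Fin n → ℤˣ) (σ : Equiv.Perm (Fin n)) (ν : Fin n → ℤ)
    (x : Fin n → ℂ) :
    ∏ i, x i ^ signedPerm ε σ ν i = ∏ j, (x (σ.symm j) ^ (ε (σ.symm j) : ℤ)) ^ ν j := by
  refine Fintype.prod_equiv σ _ _ fun i => ?_
  rw [signedPerm, Equiv.symm_apply_apply, zpow_mul]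

theorem isWeylInvariant_of_evalAt {P : LaurentPoly n}
    (h : ∀ (ε : Fin n → ℤˣ) (σ : Equiv.Perm (Fin n)) (x : Fin n → ℂ), (∀ i, x i ≠ 0) →
      P.evalAt (fun j => x (σ.symm j) ^ (ε (σ.symm j) : ℤ)) = P.evalAt x) :
    P.IsWeylInvariant := by
  intro ε σ ν
  have h1 : AddMonoidAlgebra.ofCoeff (P.coeff.mapDomain (signedPerm ε σ)) = P := by
    refine evalAt_injective fun x hx => ?_
    rw [← h ε σ x hx, LaurentPoly.evalAt, LaurentPoly.evalAt, AddMonoidAlgebra.coeff_ofCoeff,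
      Finsupp.sum_mapDomain_index (fun _ => zero_mul _) fun _ _ _ => add_mul _ _ _]
    simp only [prod_zpow_signedPerm]
  calc P.coeff (signedPerm ε σ ν)
      = (AddMonoidAlgebra.ofCoeff (P.coeff.mapDomain (signedPerm ε σ))).coeff
          (signedPerm ε σ ν) := by rw [h1]
    _ = P.coeff ν := Finsupp.mapDomain_apply (signedPerm_injective ε σ) _ _

theorem coeff_monomialSymm (mu : Fin n → ℕ) (ν : Fin n → ℤ) :
    (monomialSymm mu).coeff ν = if ν ∈ weylOrbit mu then 1 else 0 := by
  classical
  rw [monomialSymm, AddMonoidAlgebra.coeff_sum, Finsupp.finsetSum_apply]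
  simp only [AddMonoidAlgebra.coeff_single, Finsupp.single_apply]
  exact Finset.sum_ite_eq' _ _ _

theorem mem_weylOrbit {mu : Fin n → ℕ} {ν : Fin n → ℤ} :
    ν ∈ weylOrbit mu ↔ ∃ ε σ, signedPerm ε σ (fun i => (mu i : ℤ)) = ν := by
  simp [weylOrbit]

theorem self_mem_weylOrbit (mu : Fin n → ℕ) : (fun i => (mu i : ℤ)) ∈ weylOrbit mu :=
  mem_weylOrbit.2 ⟨1, 1, signedPerm_one _⟩

theorem signedPerm_mem_weylOrbit {mu : Fin n → ℕ} {ν : Fin n → ℤ} (ε : Fin n → ℤˣ)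
    (σ : Equiv.Perm (Fin n)) : signedPerm ε σ ν ∈ weylOrbit mu ↔ ν ∈ weylOrbit mu := by
  have key : ∀ (ε : Fin n → ℤˣ) (σ : Equiv.Perm (Fin n)) (ν : Fin n → ℤ), ν ∈ weylOrbit mu →
      signedPerm ε σ ν ∈ weylOrbit mu := by
    intro ε σ ν h
    obtain ⟨ε', σ', rfl⟩ := mem_weylOrbit.1 h
    exact mem_weylOrbit.2 ⟨_, _, (signedPerm_signedPerm ε ε' σ σ' _).symm⟩
  refine ⟨fun h => ?_, key ε σ ν⟩
  rw [← signedPerm_symm ε σ ν]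
  exact key _ _ _ h

theorem isWeylInvariant_monomialSymm (mu : Fin n → ℕ) : (monomialSymm mu).IsWeylInvariant := by
  intro ε σ ν
  rw [coeff_monomialSymm, coeff_monomialSymm]
  simp only [signedPerm_mem_weylOrbit]

theorem LaurentPoly.IsWeylInvariant.sub {P Q : LaurentPoly n} (hP : P.IsWeylInvariant)
    (hQ : Q.IsWeylInvariant) : (P - Q).IsWeylInvariant := by
  intro ε σ ν
  rw [AddMonoidAlgebra.coeff_sub, Finsupp.sub_apply, Finsupp.sub_apply, hP, hQ]

theorem LaurentPoly.IsWeylInvariant.smul {P : LaurentPoly n} (hP : P.IsWeylInvariant) (c : ℂ) :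
    (c • P).IsWeylInvariant := by
  intro ε σ ν
  rw [AddMonoidAlgebra.coeff_smul_apply, AddMonoidAlgebra.coeff_smul_apply, hP]

/-- Every exponent vector lies in the orbit of a partition. -/
theorem exists_mem_weylOrbit (ν : Fin n → ℤ) : ∃ mu, IsPartition mu ∧ ν ∈ weylOrbit mu := by
  -- Sorting in the dual order arranges the absolute values decreasingly.
  let f : Fin n → ℕᵒᵈ := fun i => OrderDual.toDual (ν i).natAbs
  have hm := Tuple.monotone_sort f
  set τ := Tuple.sort f
  refine ⟨fun i => (ν (τ i)).natAbs, fun i j hij => hm hij, mem_weylOrbit.2 ?_⟩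
  refine ⟨fun i => if 0 ≤ ν i then 1 else -1, τ.symm, ?_⟩
  funext i
  simp only [signedPerm, Equiv.apply_symm_apply]
  split_ifs with h
  · simpa using h
  · simp only [Units.val_neg, Units.val_one, neg_mul, one_mul]
    omega

/-- The orbit of a partition contains no other partition. -/
theorem eq_of_mem_weylOrbit {mu mu' : Fin n → ℕ} (h : IsPartition mu) (h' : IsPartition mu')
    (hmem : (fun i => (mu' i : ℤ)) ∈ weylOrbit mu) : mu' = mu := by
  obtain ⟨ε, σ, hσ⟩ := mem_weylOrbit.1 hmem
  have e : mu' = mu ∘ σ := by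
    funext i
    have := congrArg Int.natAbs (congrFun hσ i)
    simpa [signedPerm, Int.natAbs_mul] using this.symm
  rw [e]
  exact Tuple.unique_antitone (σ := σ) (τ := 1) (e ▸ h') h

/-- An invariant Laurent polynomial is a combination of the `monomialSymm mu`, where `mu` runs over
the partitions that occur in it. -/
theorem mem_span_monomialSymm (S : Set (Fin n → ℕ)) (P : LaurentPoly n) (hP : P.IsWeylInvariant)
    (hS : ∀ mu : Fin n → ℕ, IsPartition mu → P.coeff (fun i => (mu i : ℤ)) ≠ 0 → mu ∈ S) :
    P ∈ Submodule.span ℂ (monomialSymm '' S) := by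
  induction hk : P.coeff.support.card using Nat.strong_induction_on generalizing P with
  | _ k ih =>
    rcases Finset.eq_empty_or_nonempty P.coeff.support with h0 | ⟨ν, hν⟩
    · rw [Finsupp.support_eq_empty, AddMonoidAlgebra.coeff_eq_zero] at h0
      rw [h0]
      exact Submodule.zero_mem _
    · obtain ⟨mu, hmu, hmem⟩ := exists_mem_weylOrbit ν
      have hc : ∀ ν ∈ weylOrbit mu, P.coeff ν = P.coeff fun i => (mu i : ℤ) := by
        intro ν h
        obtain ⟨ε, σ, rfl⟩ := mem_weylOrbit.1 h
        exact hP ε σ _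
      have hne : P.coeff (fun i => (mu i : ℤ)) ≠ 0 := by
        rw [← hc ν hmem]
        exact Finsupp.mem_support_iff.1 hν
      set c := P.coeff fun i => (mu i : ℤ)
      have hcoeff : ∀ κ, (P - c • monomialSymm mu).coeff κ =
          if κ ∈ weylOrbit mu then 0 else P.coeff κ := by
        intro κ
        rw [AddMonoidAlgebra.coeff_sub, Finsupp.sub_apply, AddMonoidAlgebra.coeff_smul_apply,
          coeff_monomialSymm]
        split_ifs with h
        · rw [hc κ h, smul_eq_mul, mul_one, sub_self]
        · rw [smul_zero, sub_zero]
      have hsub : (P - c • monomialSymm mu).coeff.support ⊂ P.coeff.support := by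
        rw [Finset.ssubset_iff_of_subset]
        · refine ⟨ν, hν, ?_⟩
          rw [Finsupp.notMem_support_iff, hcoeff, if_pos hmem]
        · intro κ hκ
          rw [Finsupp.mem_support_iff, hcoeff] at hκ
          rw [Finsupp.mem_support_iff]
          split_ifs at hκ with h
          · exact absurd rfl hκ
          · exact hκ
      have h1 := ih _ (hk ▸ Finset.card_lt_card hsub) (P - c • monomialSymm mu)
        (hP.sub ((isWeylInvariant_monomialSymm mu).smul c)) (fun mu' hmu' h => by
          rw [hcoeff] at h
          split_ifs at h with h2
          · exact absurd rfl h
          · exact hS mu' hmu' h) rfl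
      rw [← sub_add_cancel P (c • monomialSymm mu)]
      exact Submodule.add_mem _ h1 (Submodule.smul_mem _ _
        (Submodule.subset_span ⟨mu, hS mu hmu hne, rfl⟩))

/-- Distinct partitions have disjoint orbits, so the coefficient at a partition outside `S` is zero
on every generator. -/
theorem mem_of_mem_span_monomialSymm {S : Set (Fin n → ℕ)} (hS : ∀ mu ∈ S, IsPartition mu)
    {P : LaurentPoly n} (hP : P ∈ Submodule.span ℂ (monomialSymm '' S)) {mu : Fin n → ℕ}
    (hmu : IsPartition mu) (h : P.coeff (fun i => (mu i : ℤ)) ≠ 0) : mu ∈ S := by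
  by_contra hmem
  refine h ?_
  clear h
  induction hP using Submodule.span_induction with
  | mem Q hQ =>
    obtain ⟨mu', hmu', rfl⟩ := hQ
    rw [coeff_monomialSymm, if_neg]
    intro h1
    exact hmem (eq_of_mem_weylOrbit (hS mu' hmu') hmu h1 ▸ hmu')
  | zero => rfl
  | add Q R _ _ hQ hR =>
    rw [AddMonoidAlgebra.coeff_add, Finsupp.add_apply, hQ, hR, add_zero]
  | smul c Q _ hQ =>
    rw [AddMonoidAlgebra.coeff_smul_apply, hQ, smul_zero]

end Laurent

/-! ### The tableau sum is a Macdonald polynomial -/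

section Existence

variable {n : ℕ}

theorem genSeries_signed (q t : ℂ) (ε : Fin n → ℤˣ) (σ : Equiv.Perm (Fin n)) (x : Fin n → ℂ) :
    genSeries q t (fun j => x (σ.symm j) ^ (ε (σ.symm j) : ℤ)) = genSeries q t x := by
  refine Fintype.prod_equiv σ.symm _ _ fun j => ?_
  beta_reduce
  rcases Int.units_eq_one_or (ε (σ.symm j)) with h | h
  · rw [h, Units.val_one, zpow_one]
  · rw [h, Units.val_neg, Units.val_one, zpow_neg_one, inv_inv, mul_comm]

/-- The tableau sums are determined by the generating series. -/
theorem tabFun_congr {q t : ℂ} (hq : ∀ k, qShift q q k ≠ 0) (hq0 : q ≠ 0) (ht0 : t ≠ 0)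
    {r : ℕ} (h1 : ∀ k m : ℕ, 1 ≤ k → k ≤ n → m < r → q ^ m * t ^ k ≠ 1)
    (h2 : ∀ k m : ℕ, 2 ≤ k → k ≤ n + 1 → m < r → q ^ m * (t ^ k / q) ≠ 1)
    {x y : Fin n → ℂ} (hx : ∀ i, x i ≠ 0) (hy : ∀ i, y i ≠ 0)
    (h : genSeries q t y = genSeries q t x) {s : ℕ} (hs : s ≤ r) :
    tabFun q t y s = tabFun q t x s := by
  induction s using Nat.strong_induction_on with
  | _ s ih =>
    have e := coeff_genSeries_range hq hq0 ht0 h1 h2 hx hs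
    rw [← h, coeff_genSeries_range hq hq0 ht0 h1 h2 hy hs, ← sub_eq_zero,
      ← Finset.sum_sub_distrib, Finset.sum_eq_single s] at e
    · rwa [levelSeq_self, mul_one, mul_one, sub_eq_zero] at e
    · intro s' hs' hne
      rcases lt_or_gt_of_ne hne with hlt | hlt
      · rw [ih s' hlt (by omega), sub_self]
      · rw [levelSeq_of_lt _ _ _ (by omega), mul_zero, mul_zero, sub_self]
    · intro h
      exact absurd (mem_range.2 (by omega)) h

theorem evalAt_tableauSumC (q t : ℂ) (r : ℕ) {x : Fin n → ℂ} (hx : ∀ i, x i ≠ 0) :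
    (tableauSumC n r q t).evalAt x = qShift q q r / qShift t q r * tabFun q t x r := by
  rw [← evalLin_apply, tableauSumC, map_sum, tabFun, Finset.mul_sum]
  refine Finset.sum_congr rfl fun θ _ => ?_
  rw [evalLin_apply, evalAt_single, mul_assoc]
  congr 3
  funext i
  rw [zpow_sub₀ (hx i), zpow_natCast, zpow_natCast, inv_pow, div_eq_mul_inv]

/-- The individual coefficients are not visibly symmetric; invariance is inherited from the
generating series, which determines the tableau sums. -/
theorem isWeylInvariant_tableauSumC {q t : ℂ} (hq : ∀ k, qShift q q k ≠ 0) (hq0 : q ≠ 0)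
    (ht0 : t ≠ 0) {r : ℕ} (h1 : ∀ k m : ℕ, 1 ≤ k → k ≤ n → m < r → q ^ m * t ^ k ≠ 1)
    (h2 : ∀ k m : ℕ, 2 ≤ k → k ≤ n + 1 → m < r → q ^ m * (t ^ k / q) ≠ 1) :
    (tableauSumC n r q t).IsWeylInvariant := by
  refine isWeylInvariant_of_evalAt fun ε σ x hx => ?_
  have hy : ∀ j, x (σ.symm j) ^ (ε (σ.symm j) : ℤ) ≠ 0 := fun j => zpow_ne_zero _ (hx _)
  rw [evalAt_tableauSumC q t r hx, evalAt_tableauSumC q t r hy,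
    tabFun_congr hq hq0 ht0 h1 h2 hx hy (genSeries_signed q t ε σ x) le_rfl]

theorem sum_letterC (θ : LetterC n → ℕ) :
    ∑ k, θ k = ∑ i, (θ (Sum.inl i) + θ (Sum.inr i)) := by
  rw [Fintype.sum_sum_type, Finset.sum_add_distrib]

theorem coeff_tableauSumC (q t : ℂ) (r : ℕ) (ν : Fin n → ℤ) :
    (tableauSumC n r q t).coeff ν = ∑ θ ∈ (univ : Finset (LetterC n)).piAntidiag r,
      if (fun i => (θ (Sum.inl i) : ℤ) - (θ (Sum.inr i) : ℤ)) = ν then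
        qShift q q r / qShift t q r * tableauCoeffC q t θ else 0 := by
  classical
  rw [tableauSumC, AddMonoidAlgebra.coeff_sum, Finsupp.finsetSum_apply]
  simp only [AddMonoidAlgebra.coeff_single, Finsupp.single_apply]

theorem sum_natAbs_le_of_coeff_tableauSumC {q t : ℂ} {r : ℕ} {ν : Fin n → ℤ}
    (h : (tableauSumC n r q t).coeff ν ≠ 0) : ∑ i, (ν i).natAbs ≤ r := by
  rw [coeff_tableauSumC] at h
  obtain ⟨θ, hθ, h1⟩ := Finset.exists_ne_zero_of_sum_ne_zero h
  rw [Finset.mem_piAntidiag] at hθ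
  have h2 : (fun i => (θ (Sum.inl i) : ℤ) - (θ (Sum.inr i) : ℤ)) = ν := by
    by_contra h3
    exact h1 (if_neg h3)
  rw [← hθ.1, sum_letterC, ← h2]
  refine Finset.sum_le_sum fun i _ => ?_
  beta_reduce
  omega

/-- Obtaining x_1^r needs θ_1 - θ_{1̄} = r, the full total, so all of θ sits on the letter 1. The
coefficient (t;q)_r/(q;q)_r of this θ is undone by the normalization. -/
theorem coeff_tableauSumC_oneRow {q t : ℂ} {r : ℕ} (hn : 1 ≤ n) (hq : qShift q q r ≠ 0)
    (ht : qShift t q r ≠ 0) :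
    (tableauSumC n r q t).coeff (fun i => (oneRow n r i : ℤ)) = 1 := by
  let i₀ : Fin n := ⟨0, hn⟩
  let θ₀ : LetterC n → ℕ := Pi.single (Sum.inl i₀) r
  have hl : ∀ i, θ₀ (Sum.inl i) = oneRow n r i := by
    intro i
    simp only [θ₀, oneRow, Pi.single_apply, Sum.inl.injEq, i₀, Fin.ext_iff]
  have hr : ∀ i, θ₀ (Sum.inr i) = 0 := by
    intro i
    simp [θ₀]
  have hsum : ∑ k, θ₀ k = r := by simp [θ₀]
  rw [coeff_tableauSumC, Finset.sum_eq_single θ₀]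
  · rw [if_pos]
    · rw [tableauCoeffC, Finset.prod_eq_single (Sum.inl i₀)]
      · simp only [hr, qShift_zero]
        simp only [θ₀, Pi.single_eq_same]
        field_simp
        simp
      · intro k _ hk
        simp [θ₀, hk, qShift_zero]
      · simp
    · funext i
      rw [hl, hr, Nat.cast_zero, sub_zero]
  · intro θ hθ hne
    refine if_neg fun h => hne ?_
    rw [Finset.mem_piAntidiag] at hθ
    have h0 := congrFun h i₀
    change (θ (Sum.inl i₀) : ℤ) - θ (Sum.inr i₀) = r at h0
    have hs := Finset.add_sum_erase univ θ (mem_univ (Sum.inl i₀))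
    rw [hθ.1] at hs
    have e : θ (Sum.inl i₀) = r := le_antisymm (hs ▸ Nat.le_add_right _ _) (by omega)
    rw [e, Nat.add_eq_left] at hs
    funext k
    by_cases hk : k = Sum.inl i₀
    · subst hk
      simpa [θ₀] using e
    · rw [Finset.sum_eq_zero_iff] at hs
      rw [hs k (by simp [hk])]
      simp [θ₀, hk]
  · intro h
    refine absurd ?_ h
    rw [Finset.mem_piAntidiag]
    exact ⟨hsum, by simp⟩

theorem dominanceLT_oneRow {r : ℕ} (hn : 1 ≤ n) {mu : Fin n → ℕ} (hne : mu ≠ oneRow n r)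
    (h : ∑ i, mu i ≤ r) : DominanceLT mu (oneRow n r) := by
  refine ⟨hne, fun k => ?_⟩
  calc ∑ i ∈ Iic k, mu i ≤ ∑ i, mu i := Finset.sum_le_sum_of_subset (subset_univ _)
    _ ≤ r := h
    _ = oneRow n r ⟨0, hn⟩ := by simp [oneRow]
    _ ≤ ∑ i ∈ Iic k, oneRow n r i :=
      Finset.single_le_sum (f := oneRow n r) (fun _ _ => Nat.zero_le _)
        (mem_Iic.2 (Fin.mk_le_of_le_val (Nat.zero_le _)))

theorem isPartition_oneRow (r : ℕ) : IsPartition (oneRow n r) := by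
  intro i j hij
  have : (i : ℕ) ≤ j := hij
  simp only [oneRow]
  split_ifs <;> omega

theorem tableauSumC_sub_mem_span {q t : ℂ} {r : ℕ} (hn : 1 ≤ n) (hq : qShift q q r ≠ 0)
    (ht : qShift t q r ≠ 0) (hinv : (tableauSumC n r q t).IsWeylInvariant) :
    tableauSumC n r q t - monomialSymm (oneRow n r) ∈ Submodule.span ℂ
      (monomialSymm '' {mu : Fin n → ℕ | IsPartition mu ∧ DominanceLT mu (oneRow n r)}) := by
  refine mem_span_monomialSymm _ _ (hinv.sub (isWeylInvariant_monomialSymm _)) fun mu hmu h => ?_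
  rw [AddMonoidAlgebra.coeff_sub, Finsupp.sub_apply, coeff_monomialSymm] at h
  have hne : mu ≠ oneRow n r := by
    rintro rfl
    rw [if_pos (self_mem_weylOrbit _), coeff_tableauSumC_oneRow hn hq ht, sub_self] at h
    exact h rfl
  refine ⟨hmu, dominanceLT_oneRow hn hne ?_⟩
  rw [if_neg, sub_zero] at h
  · simpa using sum_natAbs_le_of_coeff_tableauSumC h
  · exact fun h1 => hne (eq_of_mem_weylOrbit (isPartition_oneRow r) hmu h1)

/-- Opposite parameters combine to (1 - ay)(1 - by) = 1 - Ty², and likewise for c, d. The sign ε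
allows for either square root in alpha. -/
theorem koornwinderOp_eq_macOp {a b c d q t ε : ℂ} (hε : ε * ε = 1)
    (hα : koornwinderAlpha a b c d q = ε * (t ^ 2 / q)) (h1 : a + b = 0)
    (h2 : a * b = -(t ^ 2 / q)) (h3 : c + d = 0) (h4 : c * d = -(q * (t ^ 2 / q)))
    (f : (Fin n → ℂ) → ℂ) (x : Fin n → ℂ) :
    koornwinderOp a b c d q t f x = ε * macOp q t f x := by
  have hi : ε⁻¹ = ε := inv_eq_of_mul_eq_one_left hε
  have hnum : ∀ y : ℂ, (1 - a * y) * (1 - b * y) * (1 - c * y) * (1 - d * y) =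
      (1 - t ^ 2 / q * y ^ 2) * (1 - q * (t ^ 2 / q) * y ^ 2) := by
    intro y
    have e1 : (1 - a * y) * (1 - b * y) = 1 - t ^ 2 / q * y ^ 2 := by
      linear_combination (-y) * h1 + y ^ 2 * h2
    have e2 : (1 - c * y) * (1 - d * y) = 1 - q * (t ^ 2 / q) * y ^ 2 := by
      linear_combination (-y) * h3 + y ^ 2 * h4
    rw [← e1, ← e2]
    ring
  rw [koornwinderOp, macOp, Finset.mul_sum, ← Finset.sum_add_distrib]
  refine Finset.sum_congr rfl fun i _ => ?_
  rw [hα, mul_add]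
  congr 1
  · rw [hnum, macCoeff, pairProd, pairProd, ← Finset.prod_div_distrib]
    simp only [div_eq_mul_inv, mul_inv, hi, mul_assoc]
    ring
  · simp only [div_eq_mul_inv, one_mul]
    rw [hnum, macCoeff, pairProd, pairProd, ← Finset.prod_div_distrib]
    have e : ∀ j, (1 - t * x j * (x i)⁻¹) * (1 - t * (x i * x j)⁻¹) *
        ((1 - x j * (x i)⁻¹) * (1 - (x i * x j)⁻¹))⁻¹ =
        (1 - t * (x i)⁻¹ * x j) * (1 - t * (x i)⁻¹ * (x j)⁻¹) /
          ((1 - (x i)⁻¹ * x j) * (1 - (x i)⁻¹ * (x j)⁻¹)) := by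
      intro j
      rw [div_eq_mul_inv, mul_inv (x i), mul_right_comm t (x j), mul_comm (x j), mul_assoc t _ (x j)⁻¹]
    simp only [e]
    simp only [div_eq_mul_inv, mul_inv, hi, mul_assoc, inv_pow]
    ring

theorem koornwinderEigenvalue_mul {ε : ℂ} (hε : ε * ε = 1) (T q t : ℂ) (mu : Fin n → ℕ) :
    koornwinderEigenvalue (ε * T) q t mu = ε * koornwinderEigenvalue T q t mu := by
  have hi : ε⁻¹ = ε := inv_eq_of_mul_eq_one_left hε
  simp only [koornwinderEigenvalue, Finset.mul_sum, mul_inv, hi]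
  exact Finset.sum_congr rfl fun _ _ => by ring

theorem koornwinderEigenvalue_oneRow (hn : 1 ≤ n) {q t : ℂ} (hq0 : q ≠ 0) (ht0 : t ≠ 0) (r : ℕ) :
    koornwinderEigenvalue (t ^ 2 / q) q t (oneRow n r) = rowEigenvalue q t (t ^ n) r := by
  rw [koornwinderEigenvalue, Finset.sum_eq_single ⟨0, hn⟩]
  · obtain ⟨m, rfl⟩ : ∃ m, n = m + 1 := ⟨n - 1, by omega⟩
    simp only [oneRow, rowEigenvalue, Nat.sub_zero, if_true, Nat.add_sub_cancel]
    field_simp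
    ring
  · intro j _ hj
    have : (j : ℕ) ≠ 0 := fun h => hj (Fin.ext h)
    simp [oneRow, this]
  · simp

theorem half_cpow_sq (w : ℂ) : (w ^ (1 / 2 : ℂ)) ^ 2 = w := by
  rw [one_div]
  exact_mod_cast Complex.cpow_nat_inv_pow w two_ne_zero

/-- The eigenvalue equation in terms of `macOp`. -/
theorem isMacdonaldC_iff {q t : ℂ} (hq0 : q ≠ 0) {lam : Fin n → ℕ} {P : LaurentPoly n} :
    IsMacdonaldC q t (t ^ 2 / q) lam P ↔ P.IsWeylInvariant ∧
      P - monomialSymm lam ∈ Submodule.span ℂ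
        (monomialSymm '' {mu : Fin n → ℕ | IsPartition mu ∧ DominanceLT mu lam}) ∧
      ∀ x : Fin n → ℂ, IsRegularPoint q x → macOp q t P.evalAt x =
        koornwinderEigenvalue (t ^ 2 / q) q t lam * P.evalAt x := by
  set T := t ^ 2 / q with hT
  have hs := half_cpow_sq T
  have hs' := half_cpow_sq q
  set u := T ^ (1 / 2 : ℂ)
  set v := q ^ (1 / 2 : ℂ)
  have h4 : -(v * u) * (v * u) = -(q * T) := by
    rw [← hs, ← hs']
    ring
  have hsq : koornwinderAlpha (-u) u (-(v * u)) (v * u) q ^ 2 = T ^ 2 := by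
    rw [koornwinderAlpha, half_cpow_sq, mul_assoc _ (-(v * u)), h4, ← hs]
    field_simp
  -- The chosen branch of the root determines alpha only up to sign. Operator and eigenvalue are
  -- both multiplied by ε, so it drops out.
  obtain ⟨ε, hε, hα⟩ : ∃ ε : ℂ, ε * ε = 1 ∧
      koornwinderAlpha (-u) u (-(v * u)) (v * u) q = ε * T := by
    rcases sq_eq_sq_iff_eq_or_eq_neg.1 hsq with h | h
    · exact ⟨1, by ring, by rw [h, one_mul]⟩
    · exact ⟨-1, by ring, by rw [h, neg_one_mul]⟩
  have hε0 : ε ≠ 0 := left_ne_zero_of_mul_eq_one hε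
  have hop : ∀ f (x : Fin n → ℂ), koornwinderOp (-u) u (-(v * u)) (v * u) q t f x =
      ε * macOp q t f x := fun f x =>
    koornwinderOp_eq_macOp hε hα (neg_add_cancel u) (by rw [← hT, ← hs]; ring)
      (neg_add_cancel _) h4 f x
  change IsKoornwinder (-u) u (-(v * u)) (v * u) q t lam P ↔ _
  rw [IsKoornwinder, hα, koornwinderEigenvalue_mul hε]
  simp only [hop, mul_assoc, mul_right_inj' hε0]

theorem isMacdonaldC_tableauSumC {q t : ℂ} (hq : ∀ k, qShift q q k ≠ 0) (hq0 : q ≠ 0)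
    (ht0 : t ≠ 0) {r : ℕ} (hn : 1 ≤ n) (ht : qShift t q r ≠ 0)
    (h1 : ∀ k m : ℕ, 1 ≤ k → k ≤ n → m < r → q ^ m * t ^ k ≠ 1)
    (h2 : ∀ k m : ℕ, 2 ≤ k → k ≤ n + 1 → m < r → q ^ m * (t ^ k / q) ≠ 1) :
    IsMacdonaldC q t (t ^ 2 / q) (oneRow n r) (tableauSumC n r q t) := by
  have hinv := isWeylInvariant_tableauSumC hq hq0 ht0 h1 h2
  refine (isMacdonaldC_iff hq0).2 ⟨hinv, tableauSumC_sub_mem_span hn (hq r) ht hinv, ?_⟩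
  intro x hx
  have hx0 : ∀ i, x i ≠ 0 := fun i => (hx.1 i).1
  rw [evalAt_tableauSumC q t r hx0, koornwinderEigenvalue_oneRow hn hq0 ht0, mul_left_comm,
    ← macOp_tabFun hq hq0 ht0 hn h1 h2 hx le_rfl, macOp_congr hq0 (fun y hy =>
      evalAt_tableauSumC q t r hy) hx0]
  have := macOp_sum q t {()} (fun _ y => tabFun q t y r)
    (fun _ => qShift q q r / qShift t q r) x
  simp only [Finset.sum_singleton] at this
  simp only [mul_comm (qShift q q r / qShift t q r), this]

end Existence

/-! ### Uniqueness by asymptotics along a ray -/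

section Uniqueness

open Filter Topology

variable {n : ℕ}

theorem tendsto_ofReal_zpow {k : ℤ} (hk : k < 0) :
    Tendsto (fun s : ℝ => (s : ℂ) ^ k) atTop (𝓝 0) := by
  have h := (tendsto_zpow_atTop_zero (𝕜 := ℝ) hk).ofReal
  simpa only [Complex.ofReal_zpow, Complex.ofReal_zero] using h

theorem eventually_ofReal_ne_zero : ∀ᶠ s : ℝ in atTop, (s : ℂ) ≠ 0 := by
  filter_upwards [eventually_gt_atTop 0] with s hs
  exact_mod_cast hs.ne'

theorem eventually_zpow_ne {k : ℤ} (hk : k ≠ 0) {c : ℂ} (hc : c ≠ 0) :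
    ∀ᶠ s : ℝ in atTop, (s : ℂ) ^ k ≠ c := by
  rcases lt_or_gt_of_ne hk with h | h
  · exact (tendsto_ofReal_zpow h).eventually_ne hc.symm
  · filter_upwards [(tendsto_ofReal_zpow (neg_lt_zero.2 h)).eventually_ne (inv_ne_zero hc).symm]
      with s hs h1
    exact hs (by rw [zpow_neg, h1])

theorem tendsto_one_sub_div {k : ℤ} (hk : k ≠ 0) (c : ℂ) {d : ℂ} (hd : d ≠ 0) :
    Tendsto (fun s : ℝ => (1 - c * (s : ℂ) ^ k) / (1 - d * (s : ℂ) ^ k)) atTop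
      (𝓝 (if 0 < k then c / d else 1)) := by
  rcases lt_or_gt_of_ne hk with h | h
  · rw [if_neg (by omega)]
    have h0 := tendsto_ofReal_zpow h
    have h1 := ((h0.const_mul c).const_sub 1).div ((h0.const_mul d).const_sub 1) (by simp)
    simp only [mul_zero, sub_zero, div_one] at h1
    exact h1
  · rw [if_pos h]
    have h0 := tendsto_ofReal_zpow (neg_lt_zero.2 h)
    have h1 := (h0.sub_const c).div (h0.sub_const d) (by simpa using hd)
    rw [zero_sub, zero_sub, neg_div_neg_eq] at h1
    refine h1.congr' ?_
    filter_upwards [eventually_ofReal_ne_zero] with s hs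
    have hs' : (s : ℂ) ^ k ≠ 0 := zpow_ne_zero k hs
    rw [Pi.div_apply, zpow_neg]
    generalize (s : ℂ) ^ k = w at *
    rw [← mul_div_mul_left (1 - c * w) (1 - d * w) (inv_ne_zero hs')]
    congr 1 <;> field_simp

/-- The point with coordinates `s ^ b i`. -/
def rayPoint (b : Fin n → ℕ) (s : ℝ) (i : Fin n) : ℂ := (s : ℂ) ^ (b i : ℤ)

/-- The degree in `s` of the monomial with exponent `ν` at the point `rayPoint b s`. -/
def rayWeight (b : Fin n → ℕ) (ν : Fin n → ℤ) : ℤ := ∑ i, (b i : ℤ) * ν i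

theorem prod_rayPoint (b : Fin n → ℕ) {s : ℝ} (hs : (s : ℂ) ≠ 0) (ν : Fin n → ℤ) :
    ∏ i, rayPoint b s i ^ ν i = (s : ℂ) ^ rayWeight b ν := by
  have h : ∀ S : Finset (Fin n),
      ∏ i ∈ S, rayPoint b s i ^ ν i = (s : ℂ) ^ ∑ i ∈ S, (b i : ℤ) * ν i := by
    intro S
    induction S using Finset.induction_on with
    | empty => simp
    | insert i S hi ih =>
      rw [Finset.prod_insert hi, Finset.sum_insert hi, zpow_add₀ hs, ih, rayPoint, zpow_mul]
  exact h univ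

theorem prod_update_zpow (x : Fin n → ℂ) (i : Fin n) (p : ℂ) (ν : Fin n → ℤ) :
    ∏ j, Function.update x i (p * x i) j ^ ν j = p ^ ν i * ∏ j, x j ^ ν j := by
  rw [← Finset.mul_prod_erase univ _ (mem_univ i), ← Finset.mul_prod_erase univ _ (mem_univ i),
    Function.update_self, mul_zpow, mul_assoc]
  congr 2
  refine Finset.prod_congr rfl fun j hj => ?_
  rw [Function.update_of_ne (Finset.ne_of_mem_erase hj)]

theorem eventually_isRegularPoint {q : ℂ} (hq0 : q ≠ 0) {b : Fin n → ℕ}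
    (hb : Function.Injective b) (hb0 : ∀ i, b i ≠ 0) :
    ∀ᶠ s : ℝ in atTop, IsRegularPoint q (rayPoint b s) := by
  have h1 : ∀ᶠ s : ℝ in atTop, ∀ i, (s : ℂ) ^ ((b i : ℤ) * 2) ≠ 1 ∧
      (s : ℂ) ^ ((b i : ℤ) * 2) ≠ q⁻¹ ∧ (s : ℂ) ^ ((b i : ℤ) * 2) ≠ q := by
    refine eventually_all.2 fun i => ?_
    have hk : (b i : ℤ) * 2 ≠ 0 := by
      have := hb0 i
      omega
    exact (eventually_zpow_ne hk one_ne_zero).and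
      ((eventually_zpow_ne hk (inv_ne_zero hq0)).and (eventually_zpow_ne hk hq0))
  have h2 : ∀ᶠ s : ℝ in atTop, ∀ i j, i ≠ j → (s : ℂ) ^ ((b i : ℤ) - b j) ≠ 1 ∧
      (s : ℂ) ^ ((b i : ℤ) + b j) ≠ 1 := by
    refine eventually_all.2 fun i => eventually_all.2 fun j => ?_
    by_cases hij : i = j
    · exact Eventually.of_forall fun s h => absurd hij h
    · have h3 := hb.ne hij
      have h4 := hb0 i
      filter_upwards [eventually_zpow_ne (k := (b i : ℤ) - b j) (by omega) one_ne_zero,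
        eventually_zpow_ne (k := (b i : ℤ) + b j) (by omega) one_ne_zero] with s hs hs' _
      exact ⟨hs, hs'⟩
  filter_upwards [h1, h2, eventually_ofReal_ne_zero] with s h1 h2 h0
  have e : ∀ i, rayPoint b s i ^ 2 = (s : ℂ) ^ ((b i : ℤ) * 2) := fun i => by
    rw [zpow_mul, rayPoint]
    norm_cast
  refine ⟨fun i => ⟨zpow_ne_zero _ h0, ?_, ?_, ?_⟩, fun i j hij => ⟨?_, ?_⟩⟩
  · rw [e]
    exact (h1 i).1
  · rw [e]
    exact fun h => (h1 i).2.1 (eq_inv_of_mul_eq_one_right h)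
  · rw [e]
    exact (h1 i).2.2
  · intro h
    refine (h2 i j hij).1 ?_
    rw [zpow_sub₀ h0]
    exact (div_eq_one_iff_eq (zpow_ne_zero _ h0)).2 h
  · rw [rayPoint, rayPoint, ← zpow_add₀ h0]
    exact (h2 i j hij).2

/-- The monomial of strictly largest weight dominates as s → ∞; the factor p in one coordinate
accounts for a shift, and p = 1 for none. -/
theorem tendsto_evalAt_rayPoint {P : LaurentPoly n} {b : Fin n → ℕ} {κ : Fin n → ℤ}
    (hκ : ∀ ν, P.coeff ν ≠ 0 → ν ≠ κ → rayWeight b ν < rayWeight b κ) (i : Fin n) (p : ℂ) :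
    Tendsto (fun s : ℝ => P.evalAt (Function.update (rayPoint b s) i (p * rayPoint b s i)) *
      (s : ℂ) ^ (-rayWeight b κ)) atTop (𝓝 (p ^ κ i * P.coeff κ)) := by
  have h : Tendsto (fun s : ℝ => ∑ ν ∈ P.coeff.support,
      p ^ ν i * P.coeff ν * (s : ℂ) ^ (rayWeight b ν - rayWeight b κ)) atTop
      (𝓝 (∑ ν ∈ P.coeff.support, if ν = κ then p ^ κ i * P.coeff κ else 0)) := by
    refine tendsto_finsetSum _ fun ν hν => ?_
    split_ifs with h
    · subst h
      simp
    · have h1 := hκ ν (Finsupp.mem_support_iff.1 hν) h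
      simpa using (tendsto_ofReal_zpow (sub_neg.2 h1)).const_mul (p ^ ν i * P.coeff ν)
  have e : (∑ ν ∈ P.coeff.support, if ν = κ then p ^ κ i * P.coeff κ else 0) =
      p ^ κ i * P.coeff κ := by
    rw [Finset.sum_ite_eq']
    split_ifs with h
    · rfl
    · rw [Finsupp.notMem_support_iff.1 h, mul_zero]
  rw [e] at h
  refine h.congr' ?_
  filter_upwards [eventually_ofReal_ne_zero] with s hs
  rw [LaurentPoly.evalAt, Finsupp.sum, Finset.sum_mul]
  refine Finset.sum_congr rfl fun ν _ => ?_
  rw [prod_update_zpow, prod_rayPoint b hs, sub_eq_add_neg, zpow_add₀ hs]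
  ring

theorem tendsto_macCoeff {q t : ℂ} (hq0 : q ≠ 0) (b : Fin n → ℕ) (i : Fin n) {k : ℤ}
    (hk : k ≠ 0) (h : ∀ j ≠ i, k + b j ≠ 0 ∧ k - b j ≠ 0) :
    Tendsto (fun s : ℝ => macCoeff q t (rayPoint b s) i ((s : ℂ) ^ k)) atTop
      (𝓝 ((if 0 < k then (t ^ 2 / q) ^ 2 else 1) / (t ^ 2 / q * t ^ (n - 1)) *
        ∏ j ∈ univ.erase i, (if 0 < k + b j then t else 1) * (if 0 < k - b j then t else 1))) := by
  have hk2 : k * 2 ≠ 0 := by omega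
  have h1 := tendsto_one_sub_div hk2 (t ^ 2 / q) one_ne_zero
  have h2 := tendsto_one_sub_div hk2 (q * (t ^ 2 / q)) hq0
  have h3 : Tendsto (fun s : ℝ => ∏ j ∈ univ.erase i,
      ((1 - t * (s : ℂ) ^ (k + b j)) / (1 - 1 * (s : ℂ) ^ (k + b j))) *
        ((1 - t * (s : ℂ) ^ (k - b j)) / (1 - 1 * (s : ℂ) ^ (k - b j)))) atTop
      (𝓝 (∏ j ∈ univ.erase i,
        (if 0 < k + b j then t / 1 else 1) * (if 0 < k - b j then t / 1 else 1))) :=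
    tendsto_finsetProd _ fun j hj =>
      (tendsto_one_sub_div (h j (Finset.ne_of_mem_erase hj)).1 t one_ne_zero).mul
        (tendsto_one_sub_div (h j (Finset.ne_of_mem_erase hj)).2 t one_ne_zero)
  have h4 := ((h1.mul h2).div_const (t ^ 2 / q * t ^ (n - 1))).mul h3
  simp only [div_one, mul_div_cancel_left₀ _ hq0] at h4
  have e : (if 0 < k then (t ^ 2 / q) ^ 2 else 1) =
      (if 0 < k * 2 then t ^ 2 / q else 1) * (if 0 < k * 2 then t ^ 2 / q else 1) := by
    by_cases h0 : 0 < k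
    · rw [if_pos h0, if_pos (by omega), pow_two]
    · rw [if_neg h0, if_neg (by omega), one_mul]
  rw [e]
  refine h4.congr' ?_
  filter_upwards [eventually_ofReal_ne_zero] with s hs
  have e2 : ((s : ℂ) ^ k) ^ 2 = (s : ℂ) ^ (k * 2) := by
    rw [zpow_mul]
    norm_cast
  rw [macCoeff, pairProd, pairProd, ← Finset.prod_div_distrib, e2]
  congr 1
  · simp only [div_eq_mul_inv, mul_inv, one_mul]
    ring
  · refine Finset.prod_congr rfl fun j _ => ?_
    rw [zpow_add₀ hs, zpow_sub₀ hs, div_mul_div_comm]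
    simp only [rayPoint, div_eq_mul_inv, one_mul, mul_assoc]

theorem prod_erase_ite (t : ℂ) (i : Fin n) (p : Fin n → Prop) [DecidablePred p]
    (S : Finset (Fin n)) (hS : ∀ j, j ≠ i → (p j ↔ j ∈ S)) (hi : i ∉ S) :
    ∏ j ∈ univ.erase i, (if p j then t else 1) = t ^ S.card := by
  rw [← Finset.prod_filter, Finset.prod_const]
  congr 2
  ext j
  simp only [mem_filter, mem_erase, mem_univ, and_true]
  constructor
  · rintro ⟨h1, h2⟩
    exact (hS j h1).1 h2
  · intro h
    have h1 : j ≠ i := by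
      rintro rfl
      exact hi h
    exact ⟨h1, (hS j h1).2 h⟩

/-- Since x_i → ∞, the one-variable part tends to T²/(T t^(n-1)). Each product x_i x_j gives a
factor t, and x_i/x_j gives one exactly when b_j < b_i, that is for the n - 1 - i indices j > i. -/
theorem tendsto_macCoeff_forward {q t : ℂ} (hq0 : q ≠ 0) (ht0 : t ≠ 0) {b : Fin n → ℕ}
    (hb : StrictAnti b) (hb0 : ∀ i, b i ≠ 0) (i : Fin n) :
    Tendsto (fun s : ℝ => macCoeff q t (rayPoint b s) i (rayPoint b s i)) atTop
      (𝓝 (t ^ 2 / q * t ^ (n - 1 - (i : ℕ)))) := by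
  have hi := hb0 i
  have h := tendsto_macCoeff (t := t) hq0 b i (k := b i) (by omega) fun j hj => by
    have := hb.injective.ne hj
    omega
  have e1 : ∏ j ∈ univ.erase i, (if 0 < (b i : ℤ) + b j then t else 1) = t ^ (n - 1) := by
    rw [prod_erase_ite t i _ (univ.erase i) (fun j hj => ?_) (by simp), card_erase_of_mem (mem_univ i),
      card_univ, Fintype.card_fin]
    exact ⟨fun _ => by simp [hj], fun _ => by omega⟩
  have e2 : ∏ j ∈ univ.erase i, (if 0 < (b i : ℤ) - b j then t else 1) =
      t ^ (n - 1 - (i : ℕ)) := by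
    rw [prod_erase_ite t i _ (Ioi i) (fun j hj => ?_) (by simp), Fin.card_Ioi]
    rw [mem_Ioi, ← hb.lt_iff_gt]
    omega
  rw [Finset.prod_mul_distrib, e1, e2, if_pos (by omega)] at h
  have e3 : (t ^ 2 / q) ^ 2 / (t ^ 2 / q * t ^ (n - 1)) * (t ^ (n - 1) * t ^ (n - 1 - (i : ℕ))) =
      t ^ 2 / q * t ^ (n - 1 - (i : ℕ)) := by
    field_simp
  rw [e3] at h
  exact h

/-- Now x_i⁻¹ → 0, so the only factors t come from x_j/x_i with j < i, and t^i/(T t^(n-1)) remains.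
-/
theorem tendsto_macCoeff_backward {q t : ℂ} (hq0 : q ≠ 0) (ht0 : t ≠ 0) {b : Fin n → ℕ}
    (hb : StrictAnti b) (hb0 : ∀ i, b i ≠ 0) (i : Fin n) :
    Tendsto (fun s : ℝ => macCoeff q t (rayPoint b s) i (rayPoint b s i)⁻¹) atTop
      (𝓝 (t ^ 2 / q * t ^ (n - 1 - (i : ℕ)))⁻¹) := by
  have hi := hb0 i
  have h := tendsto_macCoeff (t := t) hq0 b i (k := -b i) (by omega) fun j hj => by
    have := hb.injective.ne hj
    omega
  have e1 : ∏ j ∈ univ.erase i, (if 0 < -(b i : ℤ) + b j then t else 1) = t ^ (i : ℕ) := by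
    rw [prod_erase_ite t i _ (Iio i) (fun j hj => ?_) (by simp), Fin.card_Iio]
    rw [mem_Iio, ← hb.lt_iff_gt]
    omega
  have e2 : ∏ j ∈ univ.erase i, (if 0 < -(b i : ℤ) - b j then t else 1) = t ^ 0 := by
    rw [prod_erase_ite t i _ ∅ (fun j hj => ?_) (by simp), card_empty]
    simp only [notMem_empty, iff_false]
    omega
  rw [Finset.prod_mul_distrib, e1, e2, if_neg (by omega)] at h
  simp only [zpow_neg] at h
  have e3 : t ^ (n - 1) = t ^ (n - 1 - (i : ℕ)) * t ^ (i : ℕ) := by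
    rw [← pow_add]
    congr 1
    omega
  have e4 : 1 / (t ^ 2 / q * t ^ (n - 1)) * (t ^ (i : ℕ) * t ^ 0) =
      (t ^ 2 / q * t ^ (n - 1 - (i : ℕ)))⁻¹ := by
    rw [e3]
    field_simp
  rw [e4] at h
  exact h

/-- A strictly decreasing positive weight that separates finitely many exponent vectors. -/
theorem exists_injOn_rayWeight (S : Finset (Fin n → ℤ)) :
    ∃ b : Fin n → ℕ, StrictAnti b ∧ (∀ i, b i ≠ 0) ∧ Set.InjOn (rayWeight b) S := by
  -- With b_i = B^(n-1-i) the weight of ν is the value of this polynomial at `B`. Two exponents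
  -- collide only if `B` is a root of the polynomial of their difference, so every large `B`
  -- separates them; `B ≥ 2` makes the weights decrease.
  let p : (Fin n → ℤ) → Polynomial ℝ := fun ν =>
    ∑ i, Polynomial.C (ν i : ℝ) * Polynomial.X ^ (n - 1 - (i : ℕ))
  have hp : ∀ ν ≠ 0, p ν ≠ 0 := by
    intro ν hν h0
    refine hν (funext fun j => ?_)
    have h := congrArg (fun P => P.coeff (n - 1 - (j : ℕ))) h0
    simp only [p, Polynomial.finsetSum_coeff, Polynomial.coeff_C_mul, Polynomial.coeff_X_pow,
      Polynomial.coeff_zero] at h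
    rw [Finset.sum_eq_single j] at h
    · simpa using h
    · intro i _ hij
      rw [if_neg, mul_zero]
      intro h1
      exact hij (Fin.ext (by omega))
    · simp
  have hev : ∀ᶠ B : ℕ in atTop, ∀ w ∈ S ×ˢ S, w.1 ≠ w.2 → ¬ (p (w.1 - w.2)).IsRoot (B : ℝ) := by
    refine (Filter.eventually_all_finset _).2 fun w _ => ?_
    by_cases hw : w.1 = w.2
    · exact Eventually.of_forall fun B h => absurd hw h
    · filter_upwards [tendsto_natCast_atTop_atTop.eventually
        (Polynomial.eventually_atTop_not_isRoot _ (hp _ (sub_ne_zero.2 hw)))] with B hB _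
      exact hB
  obtain ⟨B, hB, hB2⟩ := (hev.and (eventually_ge_atTop 2)).exists
  refine ⟨fun i => B ^ (n - 1 - (i : ℕ)), fun i j hij => ?_, fun i => ?_, ?_⟩
  · have : (i : ℕ) < j := hij
    exact Nat.pow_lt_pow_right (by omega) (by omega)
  · exact pow_ne_zero _ (by omega)
  · intro ν hν μ hμ h
    by_contra hne
    refine hB (ν, μ) (by simp_all) hne ?_
    have h1 := congrArg (Int.cast : ℤ → ℝ) (sub_eq_zero.2 h)
    simp only [rayWeight, ← Finset.sum_sub_distrib] at h1
    push_cast at h1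
    simp only [Polynomial.IsRoot, p, Polynomial.eval_finsetSum, Polynomial.eval_mul,
      Polynomial.eval_C, Polynomial.eval_pow, Polynomial.eval_X, Pi.sub_apply]
    rw [← h1]
    refine Finset.sum_congr rfl fun i _ => ?_
    push_cast
    ring

/-- The exponent of largest weight of an invariant Laurent polynomial is a partition. -/
theorem isPartition_of_max {P : LaurentPoly n} (hP : P.IsWeylInvariant) {b : Fin n → ℕ}
    (hb : StrictAnti b) (hb0 : ∀ i, b i ≠ 0) {κ : Fin n → ℤ} (h0 : P.coeff κ ≠ 0)
    (hκ : ∀ ν, P.coeff ν ≠ 0 → ν ≠ κ → rayWeight b ν < rayWeight b κ) :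
    ∃ mu : Fin n → ℕ, IsPartition mu ∧ κ = fun i => (mu i : ℤ) := by
  have key : ∀ ε σ, rayWeight b (signedPerm ε σ κ) ≤ rayWeight b κ := by
    intro ε σ
    by_cases h : signedPerm ε σ κ = κ
    · rw [h]
    · exact (hκ _ (by rwa [hP]) h).le
  have hpos : ∀ i, 0 ≤ κ i := by
    intro i
    by_contra hi
    -- Changing the sign of a negative entry would increase the weight.
    have h1 := key (Function.update 1 i (-1)) 1
    rw [rayWeight, rayWeight, ← Finset.add_sum_erase univ _ (mem_univ i),
      ← Finset.add_sum_erase univ (fun j => (b j : ℤ) * κ j) (mem_univ i),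
      Finset.sum_congr rfl (g := fun j => (b j : ℤ) * κ j)] at h1
    · have h2 := hb0 i
      simp only [signedPerm, Function.update_self, Equiv.Perm.coe_one, id, Units.val_neg,
        Units.val_one, add_le_add_iff_right] at h1
      have : 0 < (b i : ℤ) := by omega
      nlinarith
    · intro j hj
      simp [signedPerm, Function.update_of_ne (Finset.ne_of_mem_erase hj)]
  have hanti : Antitone κ := by
    intro i j hij
    rcases hij.eq_or_lt with rfl | hlt
    · rfl
    · by_contra hi
      -- Swapping an ascent would increase the weight, since `b` is strictly decreasing.
      have h1 := key 1 (Equiv.swap i j)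
      have hji : j ∈ univ.erase i := by simp [hlt.ne']
      rw [rayWeight, rayWeight, ← Finset.add_sum_erase univ _ (mem_univ i),
        ← Finset.add_sum_erase univ (fun j => (b j : ℤ) * κ j) (mem_univ i),
        ← Finset.add_sum_erase _ _ hji,
        ← Finset.add_sum_erase _ (fun j => (b j : ℤ) * κ j) hji,
        Finset.sum_congr rfl (g := fun j => (b j : ℤ) * κ j)] at h1
      · have h2 := hb hlt
        simp only [signedPerm, Equiv.swap_apply_left, Equiv.swap_apply_right, Pi.one_apply,
          Units.val_one, one_mul] at h1
        have : (b j : ℤ) < b i := by exact_mod_cast h2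
        nlinarith
      · intro k hk
        rw [mem_erase, mem_erase] at hk
        simp [signedPerm, Equiv.swap_apply_of_ne_of_ne hk.2.1 hk.1]
  refine ⟨fun i => (κ i).toNat, fun i j hij => Int.toNat_le_toNat (hanti hij), ?_⟩
  funext i
  exact (Int.toNat_of_nonneg (hpos i)).symm

/-- An invariant eigenfunction vanishes if its eigenvalue differs from the eigenvalues of all
partitions that occur in it. -/
theorem eq_zero_of_macOp (hn : 1 ≤ n) {q t : ℂ} (hq0 : q ≠ 0) (ht0 : t ≠ 0) {P : LaurentPoly n}
    (hP : P.IsWeylInvariant) {d : ℂ}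
    (hop : ∀ x : Fin n → ℂ, IsRegularPoint q x → macOp q t P.evalAt x = d * P.evalAt x)
    (hd : ∀ mu : Fin n → ℕ, IsPartition mu → P.coeff (fun i => (mu i : ℤ)) ≠ 0 →
      koornwinderEigenvalue (t ^ 2 / q) q t mu ≠ d) : P = 0 := by
  by_contra hne
  obtain ⟨b, hb, hb0, hinj⟩ := exists_injOn_rayWeight P.coeff.support
  have hsupp : P.coeff.support.Nonempty := by
    rw [Finsupp.support_nonempty_iff]
    exact fun h => hne (AddMonoidAlgebra.coeff_eq_zero.1 h)
  obtain ⟨κ, hκ, hmax⟩ := Finset.exists_max_image _ (rayWeight b) hsupp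
  have hlt : ∀ ν, P.coeff ν ≠ 0 → ν ≠ κ → rayWeight b ν < rayWeight b κ := fun ν hν h =>
    lt_of_le_of_ne (hmax ν (Finsupp.mem_support_iff.2 hν))
      fun h1 => h (hinj (Finsupp.mem_support_iff.2 hν) hκ h1)
  have h0 := Finsupp.mem_support_iff.1 hκ
  obtain ⟨mu, hmu, rfl⟩ := isPartition_of_max hP hb hb0 h0 hlt
  have hP1 : ∀ i : Fin n, Tendsto (fun s : ℝ => P.evalAt (rayPoint b s) *
      (s : ℂ) ^ (-rayWeight b fun i => (mu i : ℤ))) atTop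
      (𝓝 (P.coeff fun i => (mu i : ℤ))) := by
    intro i
    have := tendsto_evalAt_rayPoint hlt i 1
    simpa only [one_mul, one_zpow, Function.update_eq_self] using this
  -- With v = αt^(n-1-i), where α = t²/q, the two shifts of x_i contribute v(q^{μ_i} - 1) +
  -- v⁻¹(q^{-μ_i} - 1) in the limit; summed over i this is the eigenvalue of `mu`. Comparison with
  -- the limit of `d * P` gives the contradiction.
  have hL : Tendsto (fun s : ℝ => macOp q t P.evalAt (rayPoint b s) *
      (s : ℂ) ^ (-rayWeight b fun i => (mu i : ℤ))) atTop
      (𝓝 (koornwinderEigenvalue (t ^ 2 / q) q t mu * P.coeff fun i => (mu i : ℤ))) := by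
    have h : Tendsto (fun s : ℝ => ∑ i,
        (macCoeff q t (rayPoint b s) i (rayPoint b s i) *
          (P.evalAt (Function.update (rayPoint b s) i (q * rayPoint b s i)) *
            (s : ℂ) ^ (-rayWeight b fun i => (mu i : ℤ)) - P.evalAt (rayPoint b s) *
            (s : ℂ) ^ (-rayWeight b fun i => (mu i : ℤ))) +
        macCoeff q t (rayPoint b s) i (rayPoint b s i)⁻¹ *
          (P.evalAt (Function.update (rayPoint b s) i (q⁻¹ * rayPoint b s i)) *
            (s : ℂ) ^ (-rayWeight b fun i => (mu i : ℤ)) - P.evalAt (rayPoint b s) *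
            (s : ℂ) ^ (-rayWeight b fun i => (mu i : ℤ))))) atTop (𝓝 (∑ i, _)) :=
      tendsto_finsetSum _ fun i _ =>
        ((tendsto_macCoeff_forward hq0 ht0 hb hb0 i).mul
          ((tendsto_evalAt_rayPoint hlt i q).sub (hP1 i))).add
        ((tendsto_macCoeff_backward hq0 ht0 hb hb0 i).mul
          ((tendsto_evalAt_rayPoint hlt i q⁻¹).sub (hP1 i)))
    convert h using 2
    · rw [macOp, Finset.sum_mul]
      exact Finset.sum_congr rfl fun i _ => by ring
    · rw [koornwinderEigenvalue, Finset.sum_mul]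
      refine Finset.sum_congr rfl fun i _ => ?_
      simp only [zpow_natCast, mul_inv, inv_pow]
      ring
  have hR := (hP1 ⟨0, hn⟩).const_mul d
  have hE : (fun s : ℝ => macOp q t P.evalAt (rayPoint b s) *
      (s : ℂ) ^ (-rayWeight b fun i => (mu i : ℤ))) =ᶠ[atTop]
      fun s : ℝ => d * (P.evalAt (rayPoint b s) *
        (s : ℂ) ^ (-rayWeight b fun i => (mu i : ℤ))) := by
    filter_upwards [eventually_isRegularPoint hq0 hb.injective hb0] with s hs
    rw [hop _ hs, mul_assoc]
  exact hd mu hmu h0 (mul_right_cancel₀ h0 (tendsto_nhds_unique (hL.congr' hE) hR))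

/-- The orbit sum of `lam` cancels in P - Q, so only partitions strictly below `lam` occur there,
and genericity separates their eigenvalues from that of `lam`. -/
theorem isMacdonaldC_unique (hn : 1 ≤ n) {q t : ℂ} (hq0 : q ≠ 0) (ht0 : t ≠ 0)
    {lam : Fin n → ℕ}
    (hgen : ∀ mu : Fin n → ℕ, IsPartition mu → DominanceLT mu lam →
      koornwinderEigenvalue (t ^ 2 / q) q t mu ≠ koornwinderEigenvalue (t ^ 2 / q) q t lam)
    {P Q : LaurentPoly n} (hP : IsMacdonaldC q t (t ^ 2 / q) lam P)
    (hQ : IsMacdonaldC q t (t ^ 2 / q) lam Q) : P = Q := by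
  rw [isMacdonaldC_iff hq0] at hP hQ
  obtain ⟨hPi, hPs, hPe⟩ := hP
  obtain ⟨hQi, hQs, hQe⟩ := hQ
  have he : ∀ x : Fin n → ℂ, (P - Q).evalAt x = P.evalAt x - Q.evalAt x := fun x =>
    map_sub (evalLin x) P Q
  have hs := Submodule.sub_mem _ hPs hQs
  rw [sub_sub_sub_cancel_right] at hs
  refine sub_eq_zero.1 (eq_zero_of_macOp hn hq0 ht0 (hPi.sub hQi)
    (d := koornwinderEigenvalue (t ^ 2 / q) q t lam) (fun x hx => ?_) fun mu hmu h => ?_)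
  · rw [he, mul_sub, ← hPe x hx, ← hQe x hx]
    simp only [macOp, he, ← Finset.sum_sub_distrib]
    exact Finset.sum_congr rfl fun i _ => by ring
  · exact hgen mu hmu (mem_of_mem_span_monomialSymm (fun _ h => h.1) hs hmu h).2

end Uniqueness

end

theorem mainTheorem2 (n r : ℕ) (hn : 1 ≤ n) (q t : ℂ) (hq0 : q ≠ 0) (hq1 : ‖q‖ < 1) (ht0 : t ≠ 0)
    (hden1 : ∀ k m : ℕ, 1 ≤ k → k ≤ n → m < r → t ^ k * q ^ m ≠ 1)
    (hden2 : ∀ k m : ℕ, 2 ≤ k → k ≤ n + 1 → m < r → t ^ k * q ^ ((m : ℤ) - 1) ≠ 1)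
    (hgen : ∀ mu : Fin n → ℕ, IsPartition mu → DominanceLT mu (oneRow n r) →
      koornwinderEigenvalue (t ^ 2 / q) q t mu ≠
        koornwinderEigenvalue (t ^ 2 / q) q t (oneRow n r))
    (P : LaurentPoly n) :
    IsMacdonaldC q t (t ^ 2 / q) (oneRow n r) P ↔ P = tableauSumC n r q t := by
  have h1 : ∀ k m : ℕ, 1 ≤ k → k ≤ n → m < r → q ^ m * t ^ k ≠ 1 := fun k m a b c => by
    rw [mul_comm]
    exact hden1 k m a b c
  have h2 : ∀ k m : ℕ, 2 ≤ k → k ≤ n + 1 → m < r → q ^ m * (t ^ k / q) ≠ 1 := fun k m a b c => by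
    have h := hden2 k m a b c
    rwa [zpow_sub_one₀ hq0, zpow_natCast, ← mul_assoc, mul_right_comm, ← div_eq_mul_inv,
      mul_comm] at h
  have ht : qShift t q r ≠ 0 := qShift_ne_zero_iff.2 fun j hj => by
    simpa using h1 1 j le_rfl hn hj
  have hT := isMacdonaldC_tableauSumC (qShift_self_ne_zero hq1) hq0 ht0 hn ht h1 h2
  exact ⟨fun hP => isMacdonaldC_unique hn hq0 ht0 hgen hP hT, fun h => h ▸ hT⟩
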